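/- **Setting.** Let $\Sigma$ be a finite many-sorted first-order alphabet (predicate, function and constant symbols). Timestamped facts are $F@t$ with $F$ a fact over $\Sigma$ and $t\in\mathbb N$; $Time$ is a special nullary predicate. A *configuration* is a finite multiset of ground timestamped facts containing exactly one fact $Time@t$; $t$ is its global time. A *timed MSR system* $\mathcal A$ consists of the Tick rule $Time@T\to Time@(T+1)$ and finitely many instantaneous rules $$Time@T,\ \mathcal W,\ F_1@T'_1,\dots,F_n@T'_n \mid \mathcal C\ \longrightarrow\ Time@T,\ \mathcal W,\ Q_1@(T+D_1),\dots,Q_l@(T+D_l),$$ where $\mathcal W$ is a list of timestamped fact patterns, $D_i\in\mathbb N$, and $\mathcal C$ is a finite set of constraints $X>Y\pm N$, $X=Y\pm N$, $X\ge Y\pm N$ ($N\in\mathbb N$) on time variables occurring in the pre-condition. A rule applies to $\mathcal S$ if for some ground substitution the instance of its pre-condition is a sub-multiset of $\mathcal S$ and its constraints hold; then the instances of the $F_i@T'_i$ are replaced by those of the $Q_i@(T+D_i)$. $\mathcal A$ is *progressive* (a PTS) if for every instantaneous rule $l=n$, some $D_i\ge 1$, and $\mathcal C$ contains $T\ge T'_i$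 for all $i\le n$. A *critical configuration specification* $\mathcal{CS}$ is a finite set of pairs $\langle\{F_1@T_1,\dots,F_p@T_p\},\mathcal C\rangle$ with $\mathcal C$ a set of such constraints on $T_1,\dots,T_p$; $\mathcal S$ is *critical* if for some pair and some ground substitution the instance of the facts is a sub-multiset of $\mathcal S$ and the constraints hold. A trace is a sequence of configurations, each obtained from the previous one by a rule of $\mathcal A$; it is *compliant* if it contains no critical configuration, and *lazy* if Tick is used only at configurations to which no instantaneous rule applies. $\mathcal A$ is *realizable* for $\mathcal{CS},\mathcal S_0$ if some compliant lazy trace from $\mathcal S_0$ has global time tending to infinity. $\mathcal A$ is *survivable* for $\mathcal{CS},\mathcal S_0$ if it is realizable and every infinite lazy trace from $\mathcal S_0$ is compliant with global time tending to infinity. **Theorem.** For every finite alphabet $\Sigma$ there is a polynomial $p$ in three variables such that for every PTS $\mathcal A$ and every critical configuration specification $\mathcal{CS}$ over $\Sigma$ there is a deterministic (multi-stack, finite-alphabet) Turing machine $M$ with the following property. Let $\mathcal S_0$ be a configuration with $m$ facts ($Time$ included), given to $M$ as a string with timestamps in binary. Let $k$ be an upper bound on the size (number of alphabet symbols) of all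 facts occurring in infinite lazy traces from $\mathcal S_0$, and let $D_{\max}$ be an upper bound on the timestamps of $\mathcal S_0$, on the numbers $D_i$ and $N$ in $\mathcal A$, and on the numbers $N$ in $\mathcal{CS}$. Then $M$ halts on $\mathcal S_0$ with the correct answer to the question whether $\mathcal A$ is survivable for $\mathcal{CS}$ and $\mathcal S_0$, and it uses at most $p(m,k,\lfloor\log_2 D_{\max}\rfloor)$ cells, the cells holding the input included (here $\log_2 0$ is read as $0$). -/

import Mathlib

/-!
Timed multiset rewriting systems over a finite typed first-order alphabet, lazy time sampling,
realizability and survivability, and space usage of multi-stack Turing machines.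
-/

namespace TimedMSR

/-! ### Alphabets, terms, facts -/

/-- A finite many-sorted first-order alphabet: finitely many sorts, function symbols (constants are
the function symbols of arity `0`) and predicate symbols, each with its typing. The special predicate
`Time` is not listed here; it is built into configurations below. Nothing is assumed about which
symbols are present, so alphabets with `z : Nat` and `s : Nat → Nat` are a special case. -/
structure Alphabet where
  Srt : Type
  Fn : Type
  Pred : Type
  [fintypeSrt : Fintype Srt]
  [fintypeFn : Fintype Fn]
  [fintypePred : Fintype Pred]
  [decEqSrt : DecidableEq Srt]
  [decEqFn : DecidableEq Fn]
  [decEqPred : DecidableEq Pred]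
  fnArity : Fn → ℕ
  fnDom : (f : Fn) → Fin (fnArity f) → Srt
  fnCod : Fn → Srt
  predArity : Pred → ℕ
  predDom : (p : Pred) → Fin (predArity p) → Srt

attribute [instance] Alphabet.fintypeSrt Alphabet.fintypeFn Alphabet.fintypePred
  Alphabet.decEqSrt Alphabet.decEqFn Alphabet.decEqPred

/-- Well-sorted terms with variables of sort `s` taken from `V s`. -/
inductive Term (Sg : Alphabet) (V : Sg.Srt → Type) : Sg.Srt → Type
  | var {s : Sg.Srt} (x : V s) : Term Sg V s
  | app (f : Sg.Fn) (args : (i : Fin (Sg.fnArity f)) → Term Sg V (Sg.fnDom f i)) :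
      Term Sg V (Sg.fnCod f)

/-- Facts (atomic formulas) other than `Time`. -/
structure Fact (Sg : Alphabet) (V : Sg.Srt → Type) where
  pred : Sg.Pred
  args : (i : Fin (Sg.predArity pred)) → Term Sg V (Sg.predDom pred i)

/-- The empty supply of variables. -/
abbrev NoVars (Sg : Alphabet) : Sg.Srt → Type := fun _ => Empty

/-- `n s` variables of each sort `s`. -/
abbrev Vars (Sg : Alphabet) (n : Sg.Srt → ℕ) : Sg.Srt → Type := fun s => Fin (n s)

abbrev GroundTerm (Sg : Alphabet) (s : Sg.Srt) : Type := Term Sg (NoVars Sg) s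

abbrev GroundFact (Sg : Alphabet) : Type := Fact Sg (NoVars Sg)

/-- A ground substitution for the (non-time) variables `V`. -/
abbrev GroundSubst (Sg : Alphabet) (V : Sg.Srt → Type) : Type :=
  (s : Sg.Srt) → V s → GroundTerm Sg s

section

variable {Sg : Alphabet} {V : Sg.Srt → Type}

/-- Number of alphabet symbols occurring in a term. -/
def Term.size : {s : Sg.Srt} → Term Sg V s → ℕ
  | _, .var _ => 1
  | _, .app _ args => 1 + ∑ i, (args i).size

/-- Number of alphabet symbols occurring in a fact (the timestamp is not counted). -/
def Fact.size (F : Fact Sg V) : ℕ := 1 + ∑ i, (F.args i).size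

def Term.subst (σ : GroundSubst Sg V) : {s : Sg.Srt} → Term Sg V s → GroundTerm Sg s
  | s, .var x => σ s x
  | _, .app f args => .app f fun i => (args i).subst σ

def Fact.subst (σ : GroundSubst Sg V) (F : Fact Sg V) : GroundFact Sg :=
  ⟨F.pred, fun i => (F.args i).subst σ⟩

end

/-! ### Configurations -/

/-- A configuration `{Time@time} ∪ facts`: a multiset of ground timestamped facts with exactly one
occurrence of `Time`, which is kept separately from the other facts. -/
structure Config (Sg : Alphabet) where
  time : ℕ
  facts : Multiset (GroundFact Sg × ℕ)

/-- The number of facts of a configuration, the fact `Time` included. -/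
def Config.numFacts {Sg : Alphabet} (S : Config Sg) : ℕ := Multiset.card S.facts + 1

/-! ### Time constraints -/

/-- Time variables are named by natural numbers. -/
abbrev TimeVar : Type := ℕ

inductive Rel
  | gt
  | eq
  | ge

/-- A time constraint `left ⋈ right + offset` with `⋈` one of `>`, `=`, `≥`. The integer `offset`
covers both signs of `± N`. -/
structure Constraint where
  rel : Rel
  left : TimeVar
  right : TimeVar
  offset : ℤ

def Constraint.Holds (τ : TimeVar → ℕ) (c : Constraint) : Prop :=
  match c.rel with
  | .gt => (τ c.left : ℤ) > τ c.right + c.offset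
  | .eq => (τ c.left : ℤ) = τ c.right + c.offset
  | .ge => (τ c.left : ℤ) ≥ τ c.right + c.offset

/-- A fact pattern together with the time variable that stands for its timestamp. -/
abbrev TimedPattern (Sg : Alphabet) (n : Sg.Srt → ℕ) : Type := Fact Sg (Vars Sg n) × TimeVar

/-- Instance of a list of timed patterns under a ground substitution `σ` and an assignment `τ` of
natural numbers to the time variables. -/
def instances {Sg : Alphabet} {n : Sg.Srt → ℕ} (σ : GroundSubst Sg (Vars Sg n)) (τ : TimeVar → ℕ)
    (L : List (TimedPattern Sg n)) : Multiset (GroundFact Sg × ℕ) :=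
  ↑(L.map fun q => (q.1.subst σ, τ q.2))

/-! ### Rules -/

/-- An instantaneous rule
`Time@T, side, consumed ∣ guard ⟶ Time@T, side, created`.
The time variable `T` is the variable `0`; a created entry `(Q, D)` stands for `Q@(T + D)`. -/
structure Rule (Sg : Alphabet) where
  numVars : Sg.Srt → ℕ
  side : List (TimedPattern Sg numVars)
  consumed : List (TimedPattern Sg numVars)
  guard : List Constraint
  created : List (Fact Sg (Vars Sg numVars) × ℕ)
  /-- The time variables of the guard occur in the pre-condition. -/
  guard_vars : ∀ c ∈ guard, ∀ x ∈ [c.left, c.right],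
    x = 0 ∨ (∃ q ∈ side, q.2 = x) ∨ ∃ q ∈ consumed, q.2 = x

variable {Sg : Alphabet}

/-- `S` is rewritten to `S'` by an instance of the instantaneous rule `r`: the instance of the
pre-condition is contained in `S`, the guard holds, and the consumed facts are replaced by the
created ones. -/
def Rule.Step (r : Rule Sg) (S S' : Config Sg) : Prop :=
  ∃ (σ : GroundSubst Sg (Vars Sg r.numVars)) (τ : TimeVar → ℕ)
    (rest : Multiset (GroundFact Sg × ℕ)),
    τ 0 = S.time ∧
    (∀ c ∈ r.guard, c.Holds τ) ∧
    S.facts = instances σ τ r.side + instances σ τ r.consumed + rest ∧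
    S'.time = S.time ∧
    S'.facts = instances σ τ r.side +
      ↑(r.created.map fun q => (q.1.subst σ, S.time + q.2)) + rest

/-- The `Tick` rule `Time@T ⟶ Time@(T+1)`. -/
def TickStep (S S' : Config Sg) : Prop := S' = ⟨S.time + 1, S.facts⟩

/-- A timed MSR system, given by its finitely many instantaneous rules; the `Tick` rule is always
understood to belong to it. -/
abbrev System (Sg : Alphabet) : Type := Finset (Rule Sg)

/-- Every instantaneous rule creates as many facts as it consumes. -/
def Balanced (A : System Sg) : Prop := ∀ r ∈ A, r.created.length = r.consumed.length

/-- Progressive timed MSR systems (PTS): balanced, every rule creates a fact with a timestamp in the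
future, and the guard of every rule contains `T ≥ T'` for each consumed fact `F@T'`. -/
def Progressive (A : System Sg) : Prop :=
  Balanced A ∧ ∀ r ∈ A,
    (∃ q ∈ r.created, 1 ≤ q.2) ∧
    ∀ q ∈ r.consumed, (⟨.ge, 0, q.2, 0⟩ : Constraint) ∈ r.guard

/-! ### Critical configurations -/

/-- One pair of a critical configuration specification: a list of timed patterns, possibly with the
fact `Time@x` (`clock = some x`), and constraints on the time variables that occur in it. -/
structure CriticalPair (Sg : Alphabet) where
  numVars : Sg.Srt → ℕ
  clock : Option TimeVar
  pattern : List (TimedPattern Sg numVars)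
  constraints : List Constraint
  constraint_vars : ∀ c ∈ constraints, ∀ x ∈ [c.left, c.right],
    clock = some x ∨ ∃ q ∈ pattern, q.2 = x

abbrev CriticalSpec (Sg : Alphabet) : Type := Finset (CriticalPair Sg)

def CriticalPair.Matches (P : CriticalPair Sg) (S : Config Sg) : Prop :=
  ∃ (σ : GroundSubst Sg (Vars Sg P.numVars)) (τ : TimeVar → ℕ),
    (∀ x, P.clock = some x → τ x = S.time) ∧
    instances σ τ P.pattern ≤ S.facts ∧
    ∀ c ∈ P.constraints, c.Holds τ

def Critical (CS : CriticalSpec Sg) (S : Config Sg) : Prop := ∃ P ∈ CS, P.Matches S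

/-! ### Traces and verification problems -/

/-- An infinite trace of `A`. -/
def IsTrace (A : System Sg) (P : ℕ → Config Sg) : Prop :=
  ∀ i, TickStep (P i) (P (i + 1)) ∨ ∃ r ∈ A, r.Step (P i) (P (i + 1))

/-- Lazy time sampling: `Tick` is used only when no instance of an instantaneous rule applies. (A
`Tick` step changes the global time, an instantaneous step does not, so the two cannot be
confused.) -/
def LazySampling (A : System Sg) (P : ℕ → Config Sg) : Prop :=
  ∀ i, TickStep (P i) (P (i + 1)) → ¬ ∃ r ∈ A, ∃ S', r.Step (P i) S'

/-- Infinite traces of `A` from `S₀` that use the lazy time sampling. -/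
def LazyTrace (A : System Sg) (S₀ : Config Sg) (P : ℕ → Config Sg) : Prop :=
  P 0 = S₀ ∧ IsTrace A P ∧ LazySampling A P

def Compliant (CS : CriticalSpec Sg) (P : ℕ → Config Sg) : Prop := ∀ i, ¬ Critical CS (P i)

def TimeDiverges (P : ℕ → Config Sg) : Prop :=
  Filter.Tendsto (fun i => (P i).time) Filter.atTop Filter.atTop

def Realizable (A : System Sg) (CS : CriticalSpec Sg) (S₀ : Config Sg) : Prop :=
  ∃ P, LazyTrace A S₀ P ∧ Compliant CS P ∧ TimeDiverges P

def Survivable (A : System Sg) (CS : CriticalSpec Sg) (S₀ : Config Sg) : Prop :=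
  Realizable A CS S₀ ∧ ∀ P, LazyTrace A S₀ P → Compliant CS P ∧ TimeDiverges P

/-! ### The parameters `k` and `Dmax` -/

/-- `k` bounds the size of the facts: every fact of every configuration on an infinite lazy trace
from `S₀` has size at most `k`. -/
def FactsBounded (A : System Sg) (S₀ : Config Sg) (k : ℕ) : Prop :=
  ∀ P, LazyTrace A S₀ P → ∀ i, ∀ F ∈ (P i).facts, F.1.size ≤ k

/-- `D` bounds the numeric values in `S₀` (its timestamps), in `A` (the numbers `D` in `T + D` and
the numbers `N` in the guards) and in `CS` (the numbers `N` in the constraints). -/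
def ValuesBounded (A : System Sg) (CS : CriticalSpec Sg) (S₀ : Config Sg) (D : ℕ) : Prop :=
  (S₀.time ≤ D ∧ ∀ F ∈ S₀.facts, F.2 ≤ D) ∧
  (∀ r ∈ A, (∀ q ∈ r.created, q.2 ≤ D) ∧ ∀ c ∈ r.guard, c.offset.natAbs ≤ D) ∧
  ∀ P ∈ CS, ∀ c ∈ P.constraints, c.offset.natAbs ≤ D

/-! ### Encoding of configurations as strings -/

/-- Input alphabet: predicate symbols, function symbols, the two bits, and a separator
(`none`). -/
abbrev InputSymbol (Sg : Alphabet) : Type := Sg.Pred ⊕ Sg.Fn ⊕ Option Bool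

def encodeNat (Sg : Alphabet) (n : ℕ) : List (InputSymbol Sg) :=
  n.bits.map fun b => .inr (.inr (some b))

def separator (Sg : Alphabet) : InputSymbol Sg := .inr (.inr none)

/-- Prefix notation. -/
def encodeTerm : {s : Sg.Srt} → GroundTerm Sg s → List (InputSymbol Sg)
  | _, .var x => x.elim
  | _, .app f args => .inr (.inl f) :: (List.ofFn fun i => encodeTerm (args i)).flatten

def encodeFact (F : GroundFact Sg) : List (InputSymbol Sg) :=
  .inl F.pred :: (List.ofFn fun i => encodeTerm (F.args i)).flatten

/-- The string for `{Time@t, F₁@t₁, …, Fₙ@tₙ}`, the facts being listed in the given order and the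
timestamps being written in binary. -/
def encodeConfig (t : ℕ) (L : List (GroundFact Sg × ℕ)) : List (InputSymbol Sg) :=
  encodeNat Sg t ++ separator Sg ::
    L.flatMap fun F => encodeFact F.1 ++ encodeNat Sg F.2 ++ [separator Sg]

/-! ### Deterministic machines and their space usage -/

/-- Started on `input`, the machine `M` halts with the single symbol `b` as output. -/
def HaltsWith {Γ : Type} (M : Turing.TM2ComputableAux Γ Bool) (input : List Γ) (b : Bool) : Prop :=
  Nonempty (Turing.TM2Outputs M.tm (input.map M.inputAlphabet.symm)
    (some [M.outputAlphabet.symm b]))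

/-- Number of stack cells in use in a configuration of a machine. -/
def cellsUsed (tm : Turing.FinTM2) (c : tm.Cfg) : ℕ :=
  letI := tm.kFin
  ∑ j : tm.K, (Turing.TM2.Cfg.stk c j).length

/-- In the run of `M` on `input`, at most `s` stack cells are ever in use at the same time (the
cells that hold the input are counted). -/
def RunsInSpace {Γ : Type} (M : Turing.TM2ComputableAux Γ Bool) (input : List Γ) (s : ℕ) : Prop :=
  ∀ c : M.tm.Cfg, StateTransition.Reaches M.tm.step
    (Turing.initList M.tm (input.map M.inputAlphabet.symm)) c → cellsUsed M.tm c ≤ s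

end TimedMSR

/-! In a progressive system an instantaneous rule consumes only facts that do not lie in the future
and creates at least one that does, while the number of facts stays fixed. Hence only finitely many
instantaneous steps separate two ticks, and time diverges on every infinite lazy trace
(`LazyTrace.timeDiverges`). Lazy runs never get stuck, so survivability just says that no critical
configuration is lazily reachable (`survivable_iff`).

This graph is infinite because time grows. Let `D` bound the numbers occurring in the system and in
the specification. If `D + 1` consecutive instants of the past carry no timestamp, removing one of
them changes the truth of no constraint; such changes of timestamps are bisimulations (`Faithful`).
Cutting after a tick whenever possible keeps timestamps bounded in terms of the initial ones, `m`
and `D` (`CutReach.time_le`), so with `N = m + k + log₂ Dmax + 1` a configuration fits into `O(N ^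
2)` symbols (`exists_treeSize_lt`). The machine may depend on `D`; `Dmax` matters only for the
timestamps of the initial configuration.

Reachability is decided by Savitch's bisection on numbers that name configurations
(`exists_ev_reach`), which squares the space and gives `O(N ^ 4)`. Bisection is deterministic, so
negation is free. The machine knows neither `k` nor `Dmax`: it tries size limits 2, 3, ... and asks
by the same bisection whether a configuration exceeding the limit is reachable
(`exists_ev_critical`).

A rule may create facts with variables that its pre-condition does not bind. If the sort of such a
variable has arbitrarily large terms, an applicable instance would have successors with facts larger
than `k`; so finitely many values suffice (`Rule.Step.exists_small`).

All constants so far depend on the system, but the polynomial must not. Packing `c` bits into one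
cell divides the working space by `c` (`Frag.machine_spec`), which absorbs them. The input is not
packed, but its length has a bound with an absolute constant. -/

namespace LinSpace

/-! ### Stack programs with finite control, and their compilation with compressed space. -/

open Function

/-! ### Stack programs with finite control -/

/-- The data of a stack program: the unread input and four stacks of bits. -/
structure Store (I : Type) where
  inp : List I
  stk : Fin 4 → List Bool

def Store.size {I : Type} (s : Store I) : ℕ := ∑ k, (s.stk k).length

/-- An elementary action; `Q` is the type of successor states. -/
inductive Act (I Q : Type)
  | nop (q : Q)
  | push (k : Fin 4) (a : Bool) (q : Q)
  | pop (k : Fin 4) (q : Option Bool → Q)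
  | read (q : Option I → Q)

section

variable {I Q Q' E E' : Type}

def Act.map (φ : Q → Q') : Act I Q → Act I Q'
  | .nop q => .nop (φ q)
  | .push k a q => .push k a (φ q)
  | .pop k q => .pop k fun o => φ (q o)
  | .read q => .read fun o => φ (q o)

def Act.run : Act I Q → Store I → Q × Store I
  | .nop q, s => (q, s)
  | .push k a q, s => (q, ⟨s.inp, update s.stk k (a :: s.stk k)⟩)
  | .pop k q, s => (q (s.stk k).head?, ⟨s.inp, update s.stk k (s.stk k).tail⟩)
  | .read q, s => (q s.inp.head?, ⟨s.inp.tail, s.stk⟩)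

theorem Act.run_map (φ : Q → Q') (a : Act I Q) (s : Store I) :
    (a.map φ).run s = (φ (a.run s).1, (a.run s).2) := by
  cases a <;> rfl

/-- `Path δ B x s y t`: the program `δ` leads from state `x` with data `s` to state `y` with data
`t`, all data on the way having size at most `B`. -/
inductive Path (δ : Q → Act I (Q ⊕ E)) (B : ℕ) : Q ⊕ E → Store I → Q ⊕ E → Store I → Prop
  | refl {x s} : s.size ≤ B → Path δ B x s x s
  | step {q s y t} : s.size ≤ B → Path δ B ((δ q).run s).1 ((δ q).run s).2 y t →
      Path δ B (.inl q) s y t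

theorem Path.trans {δ : Q → Act I (Q ⊕ E)} {B : ℕ} {x s y t z u} (h : Path δ B x s y t)
    (h' : Path δ B y t z u) : Path δ B x s z u := by
  induction h with
  | refl _ => exact h'
  | step h1 _ ih => exact .step h1 (ih h')

theorem Path.mono {δ : Q → Act I (Q ⊕ E)} {B B' : ℕ} (hB : B ≤ B') {x s y t}
    (h : Path δ B x s y t) : Path δ B' x s y t := by
  induction h with
  | refl h => exact .refl (h.trans hB)
  | step h1 _ ih => exact .step (h1.trans hB) ih

/-- Only the inner states must be mapped to inner states. Exits may be sent anywhere, which is how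
exits get redirected in `Frag.bind` and `Frag.loop`. -/
theorem Path.map {δ : Q → Act I (Q ⊕ E)} {δ' : Q' → Act I (Q' ⊕ E')} {B : ℕ}
    (φ : Q ⊕ E → Q' ⊕ E')
    (hφ : ∀ q, ∃ q', φ (.inl q) = .inl q' ∧ δ' q' = (δ q).map φ) {x s y t}
    (h : Path δ B x s y t) : Path δ' B (φ x) s (φ y) t := by
  induction h with
  | refl h => exact .refl h
  | @step q s y t h1 _ ih =>
    obtain ⟨q', e1, e2⟩ := hφ q
    rw [e1]
    refine .step h1 ?_
    rw [e2, Act.run_map]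
    exact ih

/-- A program fragment with finite control and exits `E`. -/
structure Frag (I E : Type) where
  Q : Type
  fin : Finite Q
  start : Q
  δ : Q → Act I (Q ⊕ E)

def Frag.Runs (F : Frag I E) (B : ℕ) (s : Store I) (e : E) (t : Store I) : Prop :=
  Path F.δ B (.inl F.start) s (.inr e) t

theorem Frag.Runs.mono {F : Frag I E} {B B' : ℕ} {s : Store I} {e : E} {t : Store I}
    (h : F.Runs B s e t) (hB : B ≤ B') : F.Runs B' s e t :=
  Path.mono hB h

def Frag.act (a : Act I E) : Frag I E := ⟨Unit, inferInstance, (), fun _ => a.map .inr⟩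

theorem Frag.runs_act {a : Act I E} {B : ℕ} {s : Store I} (h : s.size ≤ B)
    (h' : (a.run s).2.size ≤ B) : (Frag.act a).Runs B s (a.run s).1 (a.run s).2 := by
  refine Path.step h ?_
  cases a <;> exact Path.refl h'

/-- Each exit `e` leads into its own copy of `G e`, so results can steer the control; `Finite E`
keeps the control finite. -/
def Frag.bind [Finite E] (F : Frag I E) (G : E → Frag I E') : Frag I E' where
  Q := F.Q ⊕ Σ e, (G e).Q
  fin := by
    have := F.fin
    have := fun e => (G e).fin
    infer_instance
  start := .inl F.start
  δ := Sum.elim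
    (fun q => (F.δ q).map (Sum.elim (fun q => .inl (.inl q)) fun e => .inl (.inr ⟨e, (G e).start⟩)))
    (fun q => ((G q.1).δ q.2).map (Sum.map (fun q' => .inr ⟨q.1, q'⟩) id))

theorem Frag.runs_bind [Finite E] {F : Frag I E} {G : E → Frag I E'} {B : ℕ} {s : Store I} {e : E}
    {t : Store I} {e' : E'} {u : Store I} (h : F.Runs B s e t) (h' : (G e).Runs B t e' u) :
    (F.bind G).Runs B s e' u := by
  have h1 := Path.map (δ' := (F.bind G).δ)
    (Sum.elim (fun q => .inl (.inl q)) fun e => .inl (.inr ⟨e, (G e).start⟩))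
    (fun q => ⟨_, rfl, rfl⟩) h
  have h2 := Path.map (δ' := (F.bind G).δ) (Sum.map (fun q' => .inr ⟨e, q'⟩) id)
    (fun q => ⟨_, rfl, rfl⟩) h'
  exact h1.trans h2

def Frag.again (F : Frag I (Option E)) : F.Q ⊕ Option E → F.Q ⊕ E :=
  Sum.elim .inl fun o => o.elim (.inl F.start) .inr

/-- Repeat `F` while it leaves through the exit `none`. -/
def Frag.loop (F : Frag I (Option E)) : Frag I E where
  Q := F.Q
  fin := F.fin
  start := F.start
  δ q := (F.δ q).map F.again

theorem Frag.runs_loop_exit {F : Frag I (Option E)} {B : ℕ} {s : Store I} {e : E} {t : Store I}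
    (h : F.Runs B s (some e) t) : F.loop.Runs B s e t :=
  Path.map (δ' := F.loop.δ) F.again (fun q => ⟨q, rfl, rfl⟩) h

theorem Frag.runs_loop_again {F : Frag I (Option E)} {B : ℕ} {s : Store I} {e : E} {t u : Store I}
    (h : F.Runs B s none t) (h' : F.loop.Runs B t e u) : F.loop.Runs B s e u :=
  (Path.map (δ' := F.loop.δ) F.again (fun q => ⟨q, rfl, rfl⟩) h).trans h'

end

/-! ### Compilation to multi-stack machines, several bits being packed into one cell -/

section

variable (I : Type) (c : ℕ)

/-- The top of every bit stack, at most `c` bits, is kept in the finite control. The rest lies in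
full cells of exactly `c` bits, so cells are at most the number of bits divided by `c`. -/
abbrev Buffer : Type := {l : List Bool // l.length ≤ c}

instance : Finite (Buffer c) := (List.finite_length_le Bool c).to_subtype

/-- The default `[]` for overlong lists is never reached when `0 < c`. -/
def Buffer.ofList (l : List Bool) : Buffer c :=
  if h : l.length ≤ c then ⟨l, h⟩ else ⟨[], Nat.zero_le _⟩

theorem Buffer.val_ofList {l : List Bool} (h : l.length ≤ c) : (Buffer.ofList c l).1 = l := by
  simp [Buffer.ofList, h]

/-- `inr false` is the input stack and `inr true` the output stack; the stacks `inl k` carry packed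
cells. -/
abbrev Cell : Fin 4 ⊕ Bool → Type :=
  Sum.elim (fun _ => Fin c → Bool) fun b => match b with | true => Bool | false => I

/-- Buffers of the four stacks, and the last symbols read from a stack and from the input. -/
abbrev Reg : Type := (Fin 4 → Buffer c) × (Option Bool × Option I)

def Reg.init : Reg I c := (fun _ => ⟨[], Nat.zero_le _⟩, (none, none))

open Turing.TM2 (Stmt)

variable {I c} in
/-- Pop from the buffer of the stack `k`. -/
def popBufferStmt {Λ : Type} (k : Fin 4) (q : Option Bool → Λ) : Stmt (Cell I c) Λ (Reg I c) :=
  .load (fun v => (update v.1 k (Buffer.ofList c (v.1 k).1.tail), ((v.1 k).1.head?, none)))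
    (.goto fun v => q v.2.1)

variable {I c} in
def Act.toStmt {Λ : Type} : Act I Λ → Stmt (Cell I c) Λ (Reg I c)
  | .nop q => .goto fun _ => q
  | .push k a q => .branch (fun v => decide ((v.1 k).1.length < c))
      (.load (fun v => (update v.1 k (Buffer.ofList c (a :: (v.1 k).1)), v.2)) (.goto fun _ => q))
      (.push (.inl k) (fun v => (fun i => (v.1 k).1.getD i false : Fin c → Bool))
        (.load (fun v => (update v.1 k (Buffer.ofList c [a]), v.2)) (.goto fun _ => q)))
  | .pop k q => .branch (fun v => (v.1 k).1.isEmpty)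
      (.pop (.inl k) (fun v (o : Option (Fin c → Bool)) =>
        (update v.1 k (Buffer.ofList c (o.elim [] List.ofFn)), v.2)) (popBufferStmt k q))
      (popBufferStmt k q)
  | .read q => .pop (.inr false) (fun v (o : Option I) => (v.1, (none, o))) (.goto fun v => q v.2.2)

/-- The register is reset because `Turing.haltList` prescribes the initial internal state. -/
def outputStmt {Λ : Type} (b : Bool) : Stmt (Cell I c) Λ (Reg I c) :=
  .push (.inr true) (fun _ => b) (.load (fun _ => Reg.init I c) .halt)

variable {I c}

/-- The bits packed into a list of cells. -/
def unpack (l : List (Fin c → Bool)) : List Bool := l.flatMap fun f => List.ofFn f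

theorem length_unpack (l : List (Fin c → Bool)) : (unpack l).length = l.length * c := by
  simp [unpack, List.length_flatMap]

theorem unpack_cons (f : Fin c → Bool) (l : List (Fin c → Bool)) :
    unpack (f :: l) = List.ofFn f ++ unpack l := rfl

/-- The stacks `S` with the buffers in `v` represent the data `s`. -/
structure Represents (v : Reg I c) (S : ∀ k, List (Cell I c k)) (s : Store I) : Prop where
  inp : S (.inr false) = s.inp
  out : S (.inr true) = []
  stk : ∀ k, s.stk k = (v.1 k).1 ++ unpack (S (.inl k))

theorem ofFn_getD {l : List Bool} (h : l.length = c) :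
    List.ofFn (fun i : Fin c => l.getD i false) = l := by
  subst h
  apply List.ext_getElem <;> simp

/-- Reading the buffer is correct only if an empty buffer means an empty stack; this is `hk`, and a
refill beforehand guarantees it. -/
theorem stepAux_popBufferStmt {Λ : Type} (k : Fin 4) (q : Option Bool → Λ) {v : Reg I c}
    {S : ∀ k, List (Cell I c k)} {s : Store I} (h : Represents v S s)
    (hk : (v.1 k).1 = [] → s.stk k = []) :
    ∃ v' S', Turing.TM2.stepAux (popBufferStmt k q) v S =
      ⟨some ((Act.pop k q : Act I Λ).run s).1, v', S'⟩ ∧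
      Represents v' S' ((Act.pop k q : Act I Λ).run s).2 := by
  have htail : (v.1 k).1.tail.length ≤ c := by
    rw [List.length_tail]
    exact (Nat.sub_le _ _).trans (v.1 k).2
  have hs := h.stk k
  refine ⟨(update v.1 k (Buffer.ofList c (v.1 k).1.tail), ((v.1 k).1.head?, none)), S, ?_, h.inp,
    h.out, fun j => ?_⟩
  · simp only [popBufferStmt, Turing.TM2.stepAux, Act.run]
    congr 3
    rcases hv : (v.1 k).1 with _ | ⟨a, l⟩
    · rw [hk hv]
    · rw [hs, hv]
      rfl
  · simp only [Act.run]
    rcases eq_or_ne j k with rfl | hj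
    · simp only [update_self]
      rw [Buffer.val_ofList c htail]
      rcases hv : (v.1 j).1 with _ | ⟨a, l⟩
      · rw [hk hv, hv] at hs
        rw [hk hv]
        simpa using hs
      · rw [hs, hv]
        rfl
    · simpa [hj] using h.stk j

theorem Represents.refill {v : Reg I c} {S : ∀ k, List (Cell I c k)} {s : Store I}
    (h : Represents v S s) {k : Fin 4} (he : (v.1 k).1 = []) (o : Option (Fin c → Bool))
    (ho : o = (S (.inl k)).head?) :
    Represents ((update v.1 k (Buffer.ofList c (o.elim [] List.ofFn)), v.2) : Reg I c)
      (update S (.inl k) (S (.inl k)).tail) s := by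
  refine ⟨(update_of_ne (by simp) _ _).trans h.inp, (update_of_ne (by simp) _ _).trans h.out,
    fun j => ?_⟩
  rcases eq_or_ne j k with rfl | hj
  · have e : update S (.inl j) (S (.inl j)).tail (.inl j) = (S (.inl j)).tail := update_self _ _ _
    refine Eq.trans ?_ (congrArg (fun l => _ ++ unpack l) e.symm)
    have hl : (o.elim [] List.ofFn).length ≤ c := by cases o <;> simp
    simp only [update_self]
    rw [Buffer.val_ofList c hl, h.stk, he, ho]
    generalize S (.inl j) = l
    change List (Fin c → Bool) at l
    cases l <;> rfl
  · have e : update S (.inl k) (S (.inl k)).tail (.inl j) = S (.inl j) :=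
      update_of_ne (by simpa using hj) _ _
    simp only [ne_eq, hj, not_false_eq_true, update_of_ne]
    exact (h.stk j).trans (congrArg (fun l => (v.1 j).1 ++ unpack l) e.symm)

/-- A cell holds `c > 0` bits, so a buffer that is still empty after a refill shows that there was
no cell left. -/
theorem unpack_eq_nil (hc : 0 < c) (l : List (Fin c → Bool)) (o : Option (Fin c → Bool))
    (ho : o = l.head?) (h : (Buffer.ofList c (o.elim [] List.ofFn)).1 = []) : unpack l = [] := by
  subst ho
  rw [Buffer.val_ofList c (by cases l.head? <;> simp)] at h
  rcases l with _ | ⟨f, l⟩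
  · rfl
  · exact absurd (List.ofFn_eq_nil_iff.1 h) hc.ne'

theorem stepAux_toStmt {Λ : Type} (hc : 0 < c) (a : Act I Λ) {v : Reg I c}
    {S : ∀ k, List (Cell I c k)} {s : Store I} (h : Represents v S s) :
    ∃ v' S', Turing.TM2.stepAux a.toStmt v S = ⟨some (a.run s).1, v', S'⟩ ∧
      Represents v' S' (a.run s).2 := by
  cases a with
  | nop q => exact ⟨v, S, rfl, h⟩
  | read q =>
    refine ⟨(v.1, (none, (S (.inr false)).head?)), update S (.inr false) (S (.inr false)).tail,
      ?_, ?_⟩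
    · simp only [Act.toStmt, Turing.TM2.stepAux]
      congr 2
      rw [h.inp]; rfl
    · refine ⟨?_, ?_, fun k => ?_⟩
      · exact (update_self _ _ _).trans (congrArg List.tail h.inp)
      · exact (update_of_ne (by simp) _ _).trans h.out
      · have e : update S (.inr false) (S (.inr false)).tail (.inl k) = S (.inl k) :=
          update_of_ne (by simp) _ _
        exact (h.stk k).trans (congrArg (fun l => (v.1 k).1 ++ unpack l) e.symm)
  | push k a q =>
    by_cases hl : (v.1 k).1.length < c
    · refine ⟨(update v.1 k (Buffer.ofList c (a :: (v.1 k).1)), v.2), S, ?_, h.inp, h.out,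
        fun j => ?_⟩
      · simp [Act.toStmt, hl, Act.run]
      · simp only [Act.run]
        rcases eq_or_ne j k with rfl | hj
        · simp only [update_self]
          rw [Buffer.val_ofList c (by simpa using hl), h.stk]
          rfl
        · simpa [hj] using h.stk j
    · have hl' : (v.1 k).1.length = c := le_antisymm (v.1 k).2 (not_lt.1 hl)
      refine ⟨(update v.1 k (Buffer.ofList c [a]), v.2), update S (.inl k)
        ((fun i => (v.1 k).1.getD i false : Fin c → Bool) :: S (.inl k)), ?_, ?_, ?_, fun j => ?_⟩
      · simp only [Act.toStmt, Turing.TM2.stepAux, hl, decide_false, cond_false]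
        rfl
      · exact (update_of_ne (by simp) _ _).trans h.inp
      · exact (update_of_ne (by simp) _ _).trans h.out
      · simp only [Act.run]
        rcases eq_or_ne j k with rfl | hj
        · simp only [update_self]
          rw [Buffer.val_ofList c (by exact hc), h.stk]
          erw [unpack_cons]
          rw [ofFn_getD hl']
          rfl
        · have e : update S (.inl k) ((fun i => (v.1 k).1.getD i false : Fin c → Bool) ::
              S (.inl k)) (.inl j) = S (.inl j) := update_of_ne (by simpa using hj) _ _
          simp only [ne_eq, hj, not_false_eq_true, update_of_ne]
          exact (h.stk j).trans (congrArg (fun l => (v.1 j).1 ++ unpack l) e.symm)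
  | pop k q =>
    by_cases he : (v.1 k).1 = []
    · obtain ⟨v', S', h1, h2⟩ := stepAux_popBufferStmt k q (h.refill he _ rfl) (fun hk => by
        rw [h.stk, he]
        exact unpack_eq_nil hc (S (.inl k)) _ rfl ((congrArg Subtype.val (update_self k _ v.1)).symm.trans hk))
      refine ⟨v', S', Eq.trans ?_ h1, h2⟩
      simp only [Act.toStmt, Turing.TM2.stepAux, he, List.isEmpty_nil, cond_true]
    · obtain ⟨v', S', h1, h2⟩ := stepAux_popBufferStmt k q h (fun hk => absurd hk he)
      refine ⟨v', S', Eq.trans ?_ h1, h2⟩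
      simp only [Act.toStmt, Turing.TM2.stepAux]
      rw [List.isEmpty_eq_false_iff.2 he]
      rfl

variable (c) in
noncomputable def Frag.machine [Finite I] (F : Frag I Bool) : Turing.TM2ComputableAux I Bool where
  tm :=
    { K := Fin 4 ⊕ Bool
      k₀ := .inr false
      k₁ := .inr true
      Γ := Cell I c
      Λ := F.Q ⊕ Bool
      main := .inl F.start
      ΛFin := by
        have := F.fin
        exact Fintype.ofFinite _
      σ := Reg I c
      initialState := Reg.init I c
      σFin := Fintype.ofFinite _
      Γk₀Fin := Fintype.ofFinite I
      m := Sum.elim (fun q => (F.δ q).toStmt) (outputStmt I c) }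
  inputAlphabet := Equiv.refl I
  outputAlphabet := Equiv.refl Bool

/-- By determinism every configuration reachable from `a` lies on the given run to the halting
configuration `b`, so checking `P` along that one run is enough. -/
theorem cells_le {tm : Turing.FinTM2} {a b : tm.Cfg} {P : tm.Cfg → Prop}
    (hb : tm.step b = none)
    (h : Relation.ReflTransGen (fun x y => y ∈ tm.step x ∧ P x) a b) (hP : P b) {x : tm.Cfg}
    (hx : StateTransition.Reaches tm.step a x) : P x := by
  induction h using Relation.ReflTransGen.head_induction_on with
  | refl =>
    rcases Relation.ReflTransGen.cases_head hx with rfl | ⟨y, hy, _⟩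
    · exact hP
    · rw [hb] at hy
      cases hy
  | head h1 h2 ih =>
    rcases Relation.ReflTransGen.cases_head hx with rfl | ⟨y, hy, hyx⟩
    · exact h1.2
    · cases Option.mem_unique h1.1 hy
      exact ih hyx

theorem evalsTo_of_reflTransGen {σ : Type*} {f : σ → Option σ} {a b : σ}
    (h : Relation.ReflTransGen (fun x y => y ∈ f x) a b) :
    Nonempty (StateTransition.EvalsTo f a (some b)) := by
  induction h with
  | refl => exact ⟨StateTransition.EvalsTo.refl _ _⟩
  | tail _ h2 ih =>
    exact ⟨StateTransition.EvalsTo.trans f _ _ _ ih.some ⟨1, by simpa [flip] using h2⟩⟩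

theorem Frag.machine_finite [Finite I] (F : Frag I Bool) (j : (F.machine c).tm.K) :
    Finite ((F.machine c).tm.Γ j) := by
  change Finite (Cell I c j)
  rcases j with j | (_ | _)
  · change Finite (Fin c → Bool)
    infer_instance
  · assumption
  · change Finite Bool
    infer_instance

theorem cellsUsed_machine [Finite I] (F : Frag I Bool) (l : Option (F.Q ⊕ Bool)) (v : Reg I c)
    (S : ∀ k, List (Cell I c k)) :
    TimedMSR.cellsUsed (F.machine c).tm ⟨l, v, S⟩ =
      ∑ k, (S (.inl k)).length + ((S (.inr true)).length + (S (.inr false)).length) := by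
  change ∑ j : Fin 4 ⊕ Bool, (S j).length = _
  rw [Fintype.sum_sum_type, Fintype.sum_bool]

/-- Every cell of a packed stack stands for `c` bits of the store. This is the linear compression.
-/
theorem Represents.cells_le (hc : 0 < c) {v : Reg I c} {S : ∀ k, List (Cell I c k)} {s : Store I}
    (h : Represents v S s) {B : ℕ} (hB : s.size ≤ B) : ∑ k, (S (.inl k)).length ≤ B / c := by
  rw [Nat.le_div_iff_mul_le hc, Finset.sum_mul]
  refine le_trans (Finset.sum_le_sum fun k _ => ?_) hB
  rw [h.stk, List.length_append]
  exact (length_unpack (S (.inl k))).ge.trans (Nat.le_add_left _ _)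

theorem Represents.cellsUsed_le [Finite I] (hc : 0 < c) {F : Frag I Bool} {v : Reg I c}
    {S : ∀ k, List (Cell I c k)} {s : Store I} (h : Represents v S s) {B n : ℕ} (hB : s.size ≤ B)
    (hn : s.inp.length ≤ n) (l : Option (F.Q ⊕ Bool)) :
    TimedMSR.cellsUsed (F.machine c).tm ⟨l, v, S⟩ ≤ n + B / c := by
  have h1 := h.cells_le hc hB
  have h2 : (S (.inr true)).length = 0 := by rw [h.out]; rfl
  have h3 : (S (.inr false)).length ≤ n := by rw [h.inp]; exact hn
  refine (cellsUsed_machine F _ v S).trans_le ?_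
  omega

theorem Path.machine [Finite I] (hc : 0 < c) (F : Frag I Bool) {B n : ℕ} {x s y t}
    (h : Path F.δ B x s y t) {v : Reg I c} {S : ∀ k, List (Cell I c k)}
    (hr : Represents v S s) (hn : s.inp.length ≤ n) :
    ∃ v' S', Represents v' S' t ∧
      Relation.ReflTransGen (fun a b : (F.machine c).tm.Cfg => b ∈ (F.machine c).tm.step a ∧
        TimedMSR.cellsUsed (F.machine c).tm a ≤ n + B / c + 1) ⟨some x, v, S⟩ ⟨some y, v', S'⟩ ∧
      TimedMSR.cellsUsed (F.machine c).tm ⟨some y, v', S'⟩ ≤ n + B / c := by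
  induction h generalizing v S with
  | refl h =>
    exact ⟨v, S, hr, .refl, hr.cellsUsed_le hc h hn _⟩
  | @step q s y t h1 _ ih =>
    obtain ⟨v1, S1, e1, hr1⟩ := stepAux_toStmt hc (F.δ q) hr
    have hlen : ((F.δ q).run s).2.inp.length ≤ n := by
      refine le_trans ?_ hn
      cases F.δ q <;> simp [Act.run]
    obtain ⟨v2, S2, hr2, h2, h3⟩ := ih hr1 hlen
    refine ⟨v2, S2, hr2, .head ⟨?_, ?_⟩ h2, h3⟩
    · exact congrArg some e1
    · exact (hr.cellsUsed_le hc h1 hn _).trans (Nat.le_succ _)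

/-- The program must end with an empty store because a halting machine has nothing but the output on
its stacks. The bound counts the unpacked input, the packed stacks, and one cell for the output. -/
theorem Frag.machine_spec [Finite I] (hc : 0 < c) {F : Frag I Bool} {B : ℕ} {w : List I} {b : Bool}
    (h : F.Runs B ⟨w, fun _ => []⟩ b ⟨[], fun _ => []⟩) :
    TimedMSR.HaltsWith (F.machine c) w b ∧
      TimedMSR.RunsInSpace (F.machine c) w (w.length + B / c + 1) := by
  let S0 : ∀ k, List (Cell I c k) := fun k => match k with
    | .inl _ => []
    | .inr true => []
    | .inr false => w
  have hr : Represents (Reg.init I c) S0 ⟨w, fun _ => []⟩ := ⟨rfl, rfl, fun _ => rfl⟩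
  obtain ⟨v, S, hr', h1, h2⟩ := Path.machine hc F h hr le_rfl
  have hinit : Turing.initList (F.machine c).tm (w.map (F.machine c).inputAlphabet.symm) =
      ⟨some (.inl F.start), Reg.init I c, S0⟩ := by
    have : w.map (F.machine c).inputAlphabet.symm = w := List.map_id w
    rw [this]
    change Turing.TM2.Cfg.mk _ _ _ = Turing.TM2.Cfg.mk _ _ _
    congr 1
    funext k
    rcases k with k | (_ | _) <;> rfl
  -- No bits are left, and a remaining cell would carry `c > 0` of them.
  have hS : ∀ k, S (.inl k) = [] := by
    intro k
    have := hr'.stk k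
    rcases hk : S (.inl k) with _ | ⟨f, fs⟩
    · rfl
    · rw [eq_comm, List.append_eq_nil_iff] at this
      have h3 := this.2
      erw [hk] at h3
      have h4 := (length_unpack (f :: fs : List (Fin c → Bool))).symm.trans (congrArg List.length h3)
      rw [List.length_nil, Nat.mul_eq_zero] at h4
      rcases h4 with h4 | h4
      · exact absurd h4 (Nat.succ_ne_zero _)
      · exact absurd h4 hc.ne'
  have hfin : (F.machine c).tm.step ⟨some (.inr b), v, S⟩ = some (Turing.haltList (F.machine c).tm
      [(F.machine c).outputAlphabet.symm b]) := by
    change some (Turing.TM2.Cfg.mk _ _ _) = some (Turing.TM2.Cfg.mk _ _ _)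
    congr 2
    funext k
    rcases k with k | (_ | _)
    · exact hS k
    · exact hr'.inp
    · change b :: S (.inr true) = _
      rw [hr'.out]
      rfl
  have hall := Relation.ReflTransGen.tail h1 (⟨hfin, h2.trans (Nat.le_succ _)⟩ :
    _ ∈ (F.machine c).tm.step _ ∧ _ ≤ _)
  refine ⟨?_, fun x hx => ?_⟩
  · unfold TimedMSR.HaltsWith Turing.TM2Outputs
    rw [hinit]
    exact evalsTo_of_reflTransGen (hall.lift id fun _ _ h => h.1)
  · rw [hinit] at hx
    refine cells_le (P := fun a => TimedMSR.cellsUsed (F.machine c).tm a ≤ w.length + B / c + 1)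
      ?_ hall ?_ hx
    · rfl
    · change ∑ j : Fin 4 ⊕ Bool, _ ≤ _
      rw [Fintype.sum_sum_type, Fintype.sum_bool]
      have : ∀ k : Fin 4, ((Turing.haltList (F.machine c).tm
        [(F.machine c).outputAlphabet.symm b]).stk (.inl k)).length = 0 := fun k => rfl
      erw [Finset.sum_eq_zero fun k _ => this k]
      change 0 + (1 + 0) ≤ _
      exact Nat.le_add_left _ _

end

end LinSpace

/-! ### Binary trees in prefix code as the data of stack programs. -/

namespace LinSpace

open Function

/-! ### Binary trees as stack items -/

/-- Trees are the only data type. Their prefix code is self-delimiting, so several items can lie on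
one stack without separators. -/
inductive Tr
  | nil
  | node (l r : Tr)

namespace Tr

/-- Prefix code. -/
def code : Tr → List Bool
  | nil => [false]
  | node l r => true :: (l.code ++ r.code)

def size (t : Tr) : ℕ := t.code.length

@[simp] theorem size_nil : nil.size = 1 := rfl

@[simp] theorem size_node (l r : Tr) : (node l r).size = 1 + l.size + r.size := by
  simp [size, code]; ring

theorem length_code (t : Tr) : t.code.length = t.size := rfl

theorem size_pos (t : Tr) : 1 ≤ t.size := by
  cases t <;> simp; omega

def fst : Tr → Tr
  | nil => nil
  | node l _ => l

def snd : Tr → Tr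
  | nil => nil
  | node _ r => r

@[simp] theorem fst_node (l r : Tr) : (node l r).fst = l := rfl
@[simp] theorem snd_node (l r : Tr) : (node l r).snd = r := rfl
@[simp] theorem fst_nil : nil.fst = nil := rfl
@[simp] theorem snd_nil : nil.snd = nil := rfl

end Tr

variable {I E : Type}

def st (w : List I) (a b c d : List Bool) : Store I := ⟨w, ![a, b, c, d]⟩

@[simp] theorem size_st (w : List I) (a b c d : List Bool) :
    (st w a b c d).size = a.length + b.length + c.length + d.length := by
  simp [st, Store.size, Fin.sum_univ_four]

theorem st_eq {w : List I} {f : Fin 4 → List Bool} {a b c d : List Bool} (h0 : f 0 = a)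
    (h1 : f 1 = b) (h2 : f 2 = c) (h3 : f 3 = d) : (⟨w, f⟩ : Store I) = st w a b c d := by
  unfold st
  congr
  funext i
  fin_cases i <;> assumption

section

variable {Q : Type} (w : List I) (a b c d : List Bool) (x : Bool) (q : Q) (f : Option Bool → Q)

@[simp] theorem run_push0 : (Act.push 0 x q).run (st w a b c d) = (q, st w (x :: a) b c d) :=
  congrArg (Prod.mk q) (st_eq rfl rfl rfl rfl)

@[simp] theorem run_push1 : (Act.push 1 x q).run (st w a b c d) = (q, st w a (x :: b) c d) :=
  congrArg (Prod.mk q) (st_eq rfl rfl rfl rfl)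

@[simp] theorem run_push2 : (Act.push 2 x q).run (st w a b c d) = (q, st w a b (x :: c) d) :=
  congrArg (Prod.mk q) (st_eq rfl rfl rfl rfl)

@[simp] theorem run_push3 : (Act.push 3 x q).run (st w a b c d) = (q, st w a b c (x :: d)) :=
  congrArg (Prod.mk q) (st_eq rfl rfl rfl rfl)

@[simp] theorem run_pop0 : (Act.pop 0 f).run (st w a b c d) = (f a.head?, st w a.tail b c d) :=
  congrArg (Prod.mk (f a.head?)) (st_eq rfl rfl rfl rfl)

@[simp] theorem run_pop1 : (Act.pop 1 f).run (st w a b c d) = (f b.head?, st w a b.tail c d) :=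
  congrArg (Prod.mk (f b.head?)) (st_eq rfl rfl rfl rfl)

@[simp] theorem run_pop2 : (Act.pop 2 f).run (st w a b c d) = (f c.head?, st w a b c.tail d) :=
  congrArg (Prod.mk (f c.head?)) (st_eq rfl rfl rfl rfl)

@[simp] theorem run_pop3 : (Act.pop 3 f).run (st w a b c d) = (f d.head?, st w a b c d.tail) :=
  congrArg (Prod.mk (f d.head?)) (st_eq rfl rfl rfl rfl)

@[simp] theorem run_nop (s : Store I) : (Act.nop q).run s = (q, s) := rfl

@[simp] theorem run_read (g : Option I → Q) :
    (Act.read g).run (st w a b c d) = (g w.head?, st w.tail a b c d) := rfl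

end

theorem Frag.runs_act_of {A : Act I E} {B : ℕ} {s : Store I} {e : E} {t : Store I}
    (h : A.run s = (e, t)) (hs : s.size ≤ B) (ht : t.size ≤ B) : (Frag.act A).Runs B s e t := by
  have := Frag.runs_act hs (a := A) (by rw [h]; exact ht)
  rwa [h] at this

theorem Frag.Runs.size_left {F : Frag I E} {B : ℕ} {s : Store I} {e : E} {t : Store I}
    (h : F.Runs B s e t) : s.size ≤ B := by
  cases h with
  | step h _ => exact h

theorem Path.size_right {Q : Type} {δ : Q → Act I (Q ⊕ E)} {B : ℕ} {x s y t}
    (h : Path δ B x s y t) : t.size ≤ B := by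
  induction h with
  | refl h => exact h
  | step _ _ ih => exact ih

theorem Frag.Runs.size_right {F : Frag I E} {B : ℕ} {s : Store I} {e : E} {t : Store I}
    (h : F.Runs B s e t) : t.size ≤ B :=
  Path.size_right h

/-- Move the symbols of stack `k` to stack `j` one by one. -/
def pour (k j : Fin 4) : Frag I Unit :=
  Frag.loop (.bind (.act (.pop k id)) fun o => match o with
    | none => .act (.nop (some ()))
    | some a => .act (.push j a none))

theorem runs_pour10 {B : ℕ} {w : List I} {a b c d : List Bool}
    (h : a.length + b.length + c.length + d.length ≤ B) :
    (pour 1 0).Runs B (st w a b c d) () (st w (b.reverse ++ a) [] c d) := by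
  induction b generalizing a with
  | nil =>
    refine Frag.runs_loop_exit (Frag.runs_bind
      (Frag.runs_act_of (run_pop1 _ _ _ _ _ _) ?_ ?_) (Frag.runs_act_of (run_nop _ _) ?_ ?_)) <;>
    simpa using h
  | cons x b ih =>
    simp only [List.length_cons] at h
    have := ih (a := x :: a) (by simp only [List.length_cons]; omega)
    rw [List.reverse_cons, List.append_assoc]
    refine Frag.runs_loop_again (Frag.runs_bind (Frag.runs_act_of (run_pop1 _ _ _ _ _ _) ?_ ?_)
      (Frag.runs_act_of (run_push0 _ _ _ _ _ _ _) ?_ ?_)) this <;> simp <;> omega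

theorem runs_pour20 {B : ℕ} {w : List I} {a b c d : List Bool}
    (h : a.length + b.length + c.length + d.length ≤ B) :
    (pour 2 0).Runs B (st w a b c d) () (st w (c.reverse ++ a) b [] d) := by
  induction c generalizing a with
  | nil =>
    refine Frag.runs_loop_exit (Frag.runs_bind
      (Frag.runs_act_of (run_pop2 _ _ _ _ _ _) ?_ ?_) (Frag.runs_act_of (run_nop _ _) ?_ ?_)) <;>
    simpa using h
  | cons x b ih =>
    simp only [List.length_cons] at h
    have := ih (a := x :: a) (by simp only [List.length_cons]; omega)
    rw [List.reverse_cons, List.append_assoc]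
    refine Frag.runs_loop_again (Frag.runs_bind (Frag.runs_act_of (run_pop2 _ _ _ _ _ _) ?_ ?_)
      (Frag.runs_act_of (run_push0 _ _ _ _ _ _ _) ?_ ?_)) this <;> simp <;> omega

theorem runs_pour21 {B : ℕ} {w : List I} {a b c d : List Bool}
    (h : a.length + b.length + c.length + d.length ≤ B) :
    (pour 2 1).Runs B (st w a b c d) () (st w a (c.reverse ++ b) [] d) := by
  induction c generalizing b with
  | nil =>
    refine Frag.runs_loop_exit (Frag.runs_bind
      (Frag.runs_act_of (run_pop2 _ _ _ _ _ _) ?_ ?_) (Frag.runs_act_of (run_nop _ _) ?_ ?_)) <;>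
    simpa using h
  | cons x c ih =>
    simp only [List.length_cons] at h
    have := ih (b := x :: b) (by simp only [List.length_cons]; omega)
    rw [List.reverse_cons, List.append_assoc]
    refine Frag.runs_loop_again (Frag.runs_bind (Frag.runs_act_of (run_pop2 _ _ _ _ _ _) ?_ ?_)
      (Frag.runs_act_of (run_push1 _ _ _ _ _ _ _) ?_ ?_)) this <;> simp <;> omega

/-- Move stack `1` to both of the stacks `0` and `2`. -/
def pourBoth : Frag I Unit :=
  Frag.loop (.bind (.act (.pop 1 id)) fun o => match o with
    | none => .act (.nop (some ()))
    | some a => .bind (.act (.push 0 a ())) fun _ => .act (.push 2 a none))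

theorem runs_pourBoth {B : ℕ} {w : List I} {a b c d : List Bool}
    (h : a.length + 2 * b.length + c.length + d.length ≤ B) :
    pourBoth.Runs B (st w a b c d) () (st w (b.reverse ++ a) [] (b.reverse ++ c) d) := by
  induction b generalizing a c with
  | nil =>
    refine Frag.runs_loop_exit (Frag.runs_bind
      (Frag.runs_act_of (run_pop1 _ _ _ _ _ _) ?_ ?_) (Frag.runs_act_of (run_nop _ _) ?_ ?_)) <;>
    simpa using h
  | cons x b ih =>
    simp only [List.length_cons] at h
    have := ih (a := x :: a) (c := x :: c) (by simp only [List.length_cons]; omega)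
    rw [List.reverse_cons, List.append_assoc, List.append_assoc]
    refine Frag.runs_loop_again (Frag.runs_bind (Frag.runs_act_of (run_pop1 _ _ _ _ _ _) ?_ ?_)
      (Frag.runs_bind (Frag.runs_act_of (run_push0 _ _ _ _ _ _ _) ?_ ?_)
      (Frag.runs_act_of (run_push2 _ _ _ _ _ _ _) ?_ ?_))) this <;> simp <;> omega

/-- Erase stack `1`. -/
def clear : Frag I Unit :=
  Frag.loop (.bind (.act (.pop 1 id)) fun o => match o with
    | none => .act (.nop (some ()))
    | some _ => .act (.nop none))

theorem runs_clear {B : ℕ} {w : List I} {a b c d : List Bool}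
    (h : a.length + b.length + c.length + d.length ≤ B) :
    clear.Runs B (st w a b c d) () (st w a [] c d) := by
  induction b with
  | nil =>
    refine Frag.runs_loop_exit (Frag.runs_bind
      (Frag.runs_act_of (run_pop1 _ _ _ _ _ _) ?_ ?_) (Frag.runs_act_of (run_nop _ _) ?_ ?_)) <;>
    simpa using h
  | cons x b ih =>
    simp only [List.length_cons] at h
    have := ih (by omega)
    refine Frag.runs_loop_again (Frag.runs_bind (Frag.runs_act_of (run_pop1 _ _ _ _ _ _) ?_ ?_)
      (Frag.runs_act_of (run_nop _ _) ?_ ?_)) this <;> simp <;> omega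

/-- Move items from stack `0` to stack `j`, their number being the height of stack `3`. -/
def moveItems (j : Fin 4) : Frag I Unit :=
  Frag.loop (.bind (.act (.pop 3 id)) fun o => match o with
    | none => .act (.nop (some ()))
    | some _ => .bind (.act (.pop 0 id)) fun o => match o with
      | none => .act (.nop (some ()))
      | some false => .act (.push j false none)
      | some true => .bind (.act (.push j true ())) fun _ =>
        .bind (.act (.push 3 true ())) fun _ => .act (.push 3 true none))

def moveItem (j : Fin 4) : Frag I Unit := .bind (.act (.push 3 true ())) fun _ => moveItems j

/-- Stack `3` counts in unary the subtrees still to be moved: a leaf uses up one, a node trades one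
for two. The continuation form (any later run to `s`) lets the two induction hypotheses be chained.
The counter accounts for the factor 2 of `t.size`. -/
theorem runs_moveItems1 {B : ℕ} {w : List I} {t : Tr} {a b c d : List Bool} {s : Store I}
    (h : 2 * t.size + a.length + b.length + c.length + d.length + 1 ≤ B)
    (hs : (moveItems 1).Runs B (st w a (t.code.reverse ++ b) c d) () s) :
    (moveItems 1).Runs B (st w (t.code ++ a) b c (true :: d)) () s := by
  induction t generalizing a b d with
  | nil =>
    simp only [Tr.size_nil] at h
    refine Frag.runs_loop_again (Frag.runs_bind (Frag.runs_act_of (run_pop3 _ _ _ _ _ _) ?_ ?_)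
      (Frag.runs_bind (Frag.runs_act_of (run_pop0 _ _ _ _ _ _) ?_ ?_)
      (Frag.runs_act_of (run_push1 _ _ _ _ _ _ _) ?_ ?_))) hs <;> simp [Tr.code] <;> omega
  | node l r ihl ihr =>
    simp only [Tr.size_node] at h
    have h2 := ihl (a := r.code ++ a) (b := true :: b) (d := true :: d)
      (by simp only [List.length_cons, List.length_append, Tr.length_code]; omega)
      (ihr (by simp only [List.length_cons, List.length_append, List.length_reverse,
        Tr.length_code]; omega) (by simpa [Tr.code] using hs))
    rw [← List.append_assoc] at h2
    refine Frag.runs_loop_again (Frag.runs_bind (Frag.runs_act_of (run_pop3 _ _ _ _ _ _) ?_ ?_)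
      (Frag.runs_bind (Frag.runs_act_of (run_pop0 _ _ _ _ _ _) ?_ ?_)
      (Frag.runs_bind (Frag.runs_act_of (run_push1 _ _ _ _ _ _ _) ?_ ?_)
      (Frag.runs_bind (Frag.runs_act_of (run_push3 _ _ _ _ _ _ _) ?_ ?_)
      (Frag.runs_act_of (run_push3 _ _ _ _ _ _ _) ?_ ?_))))) h2 <;>
      simp [Tr.code, Tr.length_code] <;> omega

theorem runs_moveItems2 {B : ℕ} {w : List I} {t : Tr} {a b c d : List Bool} {s : Store I}
    (h : 2 * t.size + a.length + b.length + c.length + d.length + 1 ≤ B)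
    (hs : (moveItems 2).Runs B (st w a b (t.code.reverse ++ c) d) () s) :
    (moveItems 2).Runs B (st w (t.code ++ a) b c (true :: d)) () s := by
  induction t generalizing a c d with
  | nil =>
    simp only [Tr.size_nil] at h
    refine Frag.runs_loop_again (Frag.runs_bind (Frag.runs_act_of (run_pop3 _ _ _ _ _ _) ?_ ?_)
      (Frag.runs_bind (Frag.runs_act_of (run_pop0 _ _ _ _ _ _) ?_ ?_)
      (Frag.runs_act_of (run_push2 _ _ _ _ _ _ _) ?_ ?_))) hs <;> simp [Tr.code] <;> omega
  | node l r ihl ihr =>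
    simp only [Tr.size_node] at h
    have h2 := ihl (a := r.code ++ a) (c := true :: c) (d := true :: d)
      (by simp only [List.length_cons, List.length_append, Tr.length_code]; omega)
      (ihr (by simp only [List.length_cons, List.length_append, List.length_reverse,
        Tr.length_code]; omega) (by simpa [Tr.code] using hs))
    rw [← List.append_assoc] at h2
    refine Frag.runs_loop_again (Frag.runs_bind (Frag.runs_act_of (run_pop3 _ _ _ _ _ _) ?_ ?_)
      (Frag.runs_bind (Frag.runs_act_of (run_pop0 _ _ _ _ _ _) ?_ ?_)
      (Frag.runs_bind (Frag.runs_act_of (run_push2 _ _ _ _ _ _ _) ?_ ?_)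
      (Frag.runs_bind (Frag.runs_act_of (run_push3 _ _ _ _ _ _ _) ?_ ?_)
      (Frag.runs_act_of (run_push3 _ _ _ _ _ _ _) ?_ ?_))))) h2 <;>
      simp [Tr.code, Tr.length_code] <;> omega

theorem runs_moveItem1 {B : ℕ} {w : List I} {t : Tr} {a b c : List Bool}
    (h : 2 * t.size + a.length + b.length + c.length + 1 ≤ B) :
    (moveItem 1).Runs B (st w (t.code ++ a) b c []) () (st w a (t.code.reverse ++ b) c []) := by
  refine Frag.runs_bind (Frag.runs_act_of (run_push3 _ _ _ _ _ _ _) ?_ ?_)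
    (runs_moveItems1 (by simpa using h) (Frag.runs_loop_exit (Frag.runs_bind
      (Frag.runs_act_of (run_pop3 _ _ _ _ _ _) ?_ ?_) (Frag.runs_act_of (run_nop _ _) ?_ ?_)))) <;>
    simp [Tr.length_code] <;> omega

theorem runs_moveItem2 {B : ℕ} {w : List I} {t : Tr} {a b c : List Bool}
    (h : 2 * t.size + a.length + b.length + c.length + 1 ≤ B) :
    (moveItem 2).Runs B (st w (t.code ++ a) b c []) () (st w a b (t.code.reverse ++ c) []) := by
  refine Frag.runs_bind (Frag.runs_act_of (run_push3 _ _ _ _ _ _ _) ?_ ?_)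
    (runs_moveItems2 (by simpa using h) (Frag.runs_loop_exit (Frag.runs_bind
      (Frag.runs_act_of (run_pop3 _ _ _ _ _ _) ?_ ?_) (Frag.runs_act_of (run_nop _ _) ?_ ?_)))) <;>
    simp [Tr.length_code] <;> omega

def dup : Frag I Unit :=
  .bind (moveItem 1) fun _ => .bind pourBoth fun _ => .bind (pour 2 1) fun _ => pour 1 0

def swap : Frag I Unit :=
  .bind (moveItem 1) fun _ => .bind (moveItem 2) fun _ => .bind (pour 1 0) fun _ => pour 2 0

def drop : Frag I Unit := .bind (moveItem 1) fun _ => clear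

/-- All items lie on the main stack. -/
abbrev items (a : List Bool) : Store I := st [] a [] [] []

theorem runs_dup {B : ℕ} {t : Tr} {a : List Bool} (h : 2 * t.size + a.length + 1 ≤ B) :
    (dup : Frag I Unit).Runs B (items (t.code ++ a)) () (items (t.code ++ (t.code ++ a))) := by
  have := t.length_code
  have h1 := runs_moveItem1 (I := I) (w := []) (t := t) (a := a) (b := []) (c := []) (B := B)
    (by simpa using h)
  have h2 := runs_pourBoth (I := I) (w := []) (a := a) (b := t.code.reverse) (c := []) (d := [])
    (B := B) (by simp; omega)
  have h3 := runs_pour21 (I := I) (w := []) (a := t.code ++ a) (b := []) (c := t.code) (d := [])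
    (B := B) (by simp; omega)
  have h4 := runs_pour10 (I := I) (w := []) (a := t.code ++ a) (b := t.code.reverse) (c := [])
    (d := []) (B := B) (by simp; omega)
  simp only [List.append_nil, List.reverse_reverse] at h1 h2 h3 h4
  exact Frag.runs_bind h1 (Frag.runs_bind h2 (Frag.runs_bind h3 h4))

theorem runs_swap {B : ℕ} {t u : Tr} {a : List Bool}
    (h : 2 * (t.size + u.size) + a.length + 1 ≤ B) :
    (swap : Frag I Unit).Runs B (items (t.code ++ (u.code ++ a))) ()
      (items (u.code ++ (t.code ++ a))) := by
  have := t.length_code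
  have := u.length_code
  have h1 := runs_moveItem1 (I := I) (w := []) (t := t) (a := u.code ++ a) (b := []) (c := [])
    (B := B) (by simp; omega)
  have h2 := runs_moveItem2 (I := I) (w := []) (t := u) (a := a) (b := t.code.reverse) (c := [])
    (B := B) (by simp; omega)
  have h3 := runs_pour10 (I := I) (w := []) (a := a) (b := t.code.reverse) (c := u.code.reverse)
    (d := []) (B := B) (by simp; omega)
  have h4 := runs_pour20 (I := I) (w := []) (a := t.code ++ a) (b := []) (c := u.code.reverse)
    (d := []) (B := B) (by simp; omega)
  simp only [List.append_nil, List.reverse_reverse] at h1 h2 h3 h4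
  exact Frag.runs_bind h1 (Frag.runs_bind h2 (Frag.runs_bind h3 h4))

theorem runs_drop {B : ℕ} {t : Tr} {a : List Bool} (h : 2 * t.size + a.length + 1 ≤ B) :
    (drop : Frag I Unit).Runs B (items (t.code ++ a)) () (items a) := by
  have := t.length_code
  exact Frag.runs_bind (runs_moveItem1 (by simpa using h)) (runs_clear (by simp; omega))

/-- Push a list of symbols. -/
def pushList : List Bool → Frag I Unit
  | [] => .act (.nop ())
  | x :: l => .bind (pushList l) fun _ => .act (.push 0 x ())

theorem runs_pushList {B : ℕ} {w : List I} (l : List Bool) {a : List Bool}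
    (h : l.length + a.length ≤ B) :
    (pushList l).Runs B (st w a [] [] []) () (st w (l ++ a) [] [] []) := by
  induction l with
  | nil => exact Frag.runs_act_of (run_nop _ _) (by simpa using h) (by simpa using h)
  | cons x l ih =>
    simp only [List.length_cons] at h
    exact Frag.runs_bind (ih (by omega)) (Frag.runs_act_of (run_push0 _ _ _ _ _ _ _)
      (by simp; omega) (by simp; omega))

/-! ### Programs acting on the top item -/

/-- The program `F` replaces the top item `x` by `y`, using `B` symbols for this. -/
def Ev (F : Frag I Unit) (x y : Tr) (B : ℕ) : Prop :=
  ∀ a : List Bool, F.Runs (B + a.length) (items (x.code ++ a)) () (items (y.code ++ a))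

variable {F G P : Frag I Unit} {x y z : Tr} {B B₁ B₂ : ℕ}

theorem Ev.mono (h : Ev F x y B₁) (hB : B₁ ≤ B₂) : Ev F x y B₂ :=
  fun a => (h a).mono (by omega)

theorem Ev.size_left (h : Ev F x y B) : x.size ≤ B := by
  simpa [Tr.length_code] using (h []).size_left

theorem Ev.size_right (h : Ev F x y B) : y.size ≤ B := by
  simpa [Tr.length_code] using (h []).size_right

namespace Frag

def ident : Frag I Unit := .act (.nop ())

def const (t : Tr) : Frag I Unit := .bind drop fun _ => pushList t.code

def seq (F G : Frag I Unit) : Frag I Unit := .bind F fun _ => G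

def pair (F G : Frag I Unit) : Frag I Unit :=
  .bind dup fun _ => .bind F fun _ => .bind swap fun _ => .bind G fun _ => .bind swap fun _ =>
    .act (.push 0 true ())

def first : Frag I Unit :=
  .bind (.act (.pop 0 id)) fun o => match o with
    | some true => .bind swap fun _ => drop
    | _ => .act (.push 0 false ())

def second : Frag I Unit :=
  .bind (.act (.pop 0 id)) fun o => match o with
    | some true => drop
    | _ => .act (.push 0 false ())

/-- Evaluate `P` on a copy of the top item, and test whether the result is a node. -/
def test (P : Frag I Unit) : Frag I Bool :=
  .bind dup fun _ => .bind P fun _ => .bind (.act (.pop 0 id)) fun o => match o with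
    | some true => .bind drop fun _ => .bind drop fun _ => .act (.nop true)
    | _ => .act (.nop false)

def ite (P F G : Frag I Unit) : Frag I Unit :=
  .bind (test P) fun b => match b with
    | true => F
    | false => G

def whileDo (P F : Frag I Unit) : Frag I Unit :=
  .loop (.bind (test P) fun b => match b with
    | true => .bind F fun _ => .act (.nop none)
    | false => .act (.nop (some ())))

end Frag

theorem Ev.ident : Ev (Frag.ident : Frag I Unit) x x x.size := fun a => by
  refine Frag.runs_act_of (run_nop _ _) ?_ ?_ <;> simp [Tr.length_code]

theorem Ev.const (t : Tr) : Ev (Frag.const t : Frag I Unit) x t (2 * x.size + t.size + 1) :=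
  fun a => Frag.runs_bind (runs_drop (by omega)) (runs_pushList _ (by rw [Tr.length_code]; omega))

theorem Ev.seq (h1 : Ev F x y B) (h2 : Ev G y z B) : Ev (Frag.seq F G) x z B :=
  fun a => Frag.runs_bind (h1 a) (h2 a)

theorem Ev.pair (h1 : Ev F x y B₁) (h2 : Ev G x z B₂) :
    Ev (Frag.pair F G) x (.node y z) (4 * (B₁ + B₂) + 1) := fun a => by
  have e1 := h1.size_left
  have e2 := h1.size_right
  have e3 := h2.size_right
  have e4 := x.length_code
  have e5 := y.length_code
  have e6 := z.length_code
  refine Frag.runs_bind (runs_dup (by omega)) (Frag.runs_bind ((h1 _).mono ?_)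
    (Frag.runs_bind (runs_swap ?_) (Frag.runs_bind ((h2 _).mono ?_)
    (Frag.runs_bind (runs_swap ?_) (Frag.runs_act_of ?_ ?_ ?_)))))
  · simp; omega
  · omega
  · simp; omega
  · omega
  · rw [run_push0]
    simp [Tr.code]
  · simp; omega
  · simp [Tr.code]; omega

theorem Ev.first : Ev (Frag.first : Frag I Unit) x x.fst (2 * x.size + 1) := fun a => by
  cases x with
  | nil =>
    refine Frag.runs_bind (Frag.runs_act_of (run_pop0 _ _ _ _ _ _) ?_ ?_)
      (Frag.runs_act_of (run_push0 _ _ _ _ _ _ _) ?_ ?_) <;> simp [Tr.code]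
  | node l r =>
    have e1 := l.length_code
    have e2 := r.length_code
    refine Frag.runs_bind (t := items (l.code ++ (r.code ++ a))) (Frag.runs_act_of (e := some true)
      ?_ ?_ ?_) (Frag.runs_bind (runs_swap ?_) (runs_drop ?_))
    · rw [run_pop0]; simp [Tr.code]
    · simp [Tr.code]; omega
    · simp; omega
    · simp
    · simp; omega

theorem Ev.second : Ev (Frag.second : Frag I Unit) x x.snd (2 * x.size + 1) := fun a => by
  cases x with
  | nil =>
    refine Frag.runs_bind (Frag.runs_act_of (run_pop0 _ _ _ _ _ _) ?_ ?_)
      (Frag.runs_act_of (run_push0 _ _ _ _ _ _ _) ?_ ?_) <;> simp [Tr.code]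
  | node l r =>
    have e1 := l.length_code
    have e2 := r.length_code
    refine Frag.runs_bind (t := items (l.code ++ (r.code ++ a))) (Frag.runs_act_of (e := some true)
      ?_ ?_ ?_) (runs_drop ?_)
    · rw [run_pop0]; simp [Tr.code]
    · simp [Tr.code]; omega
    · simp; omega
    · simp; omega

theorem runs_test_nil (h : Ev P x .nil B) (a : List Bool) :
    (Frag.test P).Runs (3 * B + 1 + a.length) (items (x.code ++ a)) false
      (items (x.code ++ a)) := by
  have e1 := h.size_left
  have e2 := h.size_right
  have e4 := x.length_code
  refine Frag.runs_bind (runs_dup (by omega)) (Frag.runs_bind ((h _).mono ?_)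
    (Frag.runs_bind (Frag.runs_act_of (run_pop0 _ _ _ _ _ _) ?_ ?_)
    (Frag.runs_act_of (run_nop _ _) ?_ ?_))) <;> simp [Tr.code] <;> omega

theorem runs_test_node (h : Ev P x (.node y z) B) (a : List Bool) :
    (Frag.test P).Runs (3 * B + 1 + a.length) (items (x.code ++ a)) true
      (items (x.code ++ a)) := by
  have e1 := h.size_left
  have e2 := h.size_right
  have e4 := x.length_code
  have e5 := y.length_code
  have e6 := z.length_code
  simp only [Tr.size_node] at e2
  refine Frag.runs_bind (runs_dup (by omega)) (Frag.runs_bind ((h _).mono ?_)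
    (Frag.runs_bind (t := items (y.code ++ (z.code ++ (x.code ++ a))))
      (Frag.runs_act_of (e := some true) ?_ ?_ ?_)
    (Frag.runs_bind (runs_drop ?_) (Frag.runs_bind (runs_drop ?_)
    (Frag.runs_act_of (run_nop _ _) ?_ ?_)))))
  · simp; omega
  · rw [run_pop0]; simp [Tr.code]
  all_goals simp [Tr.code]; omega

theorem Ev.ite_nil (h : Ev P x .nil B₁) (h' : Ev G x y B₂) :
    Ev (Frag.ite P F G) x y (3 * B₁ + B₂ + 1) := fun a =>
  Frag.runs_bind ((runs_test_nil h a).mono (by omega)) ((h' a).mono (by omega))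

theorem Ev.ite_node {u v : Tr} (h : Ev P x (.node u v) B₁) (h' : Ev F x y B₂) :
    Ev (Frag.ite P F G) x y (3 * B₁ + B₂ + 1) := fun a =>
  Frag.runs_bind ((runs_test_node h a).mono (by omega)) ((h' a).mono (by omega))

theorem Ev.while_nil (h : Ev P x .nil B₁) (hB : 3 * B₁ + 1 ≤ B) : Ev (Frag.whileDo P F) x x B :=
  fun a => by
  have h1 := (runs_test_nil h a).mono (B' := B + a.length) (by omega)
  exact Frag.runs_loop_exit (Frag.runs_bind h1
    (Frag.runs_act_of (run_nop _ _) h1.size_right h1.size_right))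

theorem Ev.while_node {u v : Tr} (h : Ev P x (.node u v) B₁) (hB : 3 * B₁ + 1 ≤ B)
    (h1 : Ev F x y B) (h2 : Ev (Frag.whileDo P F) y z B) : Ev (Frag.whileDo P F) x z B := fun a =>
  Frag.runs_loop_again (Frag.runs_bind ((runs_test_node h a).mono (by omega)) (Frag.runs_bind (h1 a)
    (Frag.runs_act_of (run_nop _ _) (h1 a).size_right (h1 a).size_right))) (h2 a)

end LinSpace

/-! ### A calculus of linear space functions and predicates on trees. -/

namespace LinSpace

open Classical

/-! ### Functions and predicates on trees computable in linear space -/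

/-- The tree function `f` is computed by a stack program in linear space. -/
@[fun_prop]
def Lin (f : Tr → Tr) : Prop :=
  ∃ C : ℕ, ∀ I : Type, ∃ F : Frag I Unit, ∀ x, Ev F x (f x) (C * x.size)

/-- Truth values as trees. -/
noncomputable def tt (P : Prop) : Tr := if P then .node .nil .nil else .nil

@[simp] theorem tt_eq_nil {P : Prop} : tt P = .nil ↔ ¬P := by
  by_cases h : P <;> simp [tt, h]

theorem tt_true {P : Prop} (h : P) : tt P = .node .nil .nil := by simp [tt, h]

theorem tt_false {P : Prop} (h : ¬P) : tt P = .nil := by simp [tt, h]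

theorem size_tt_le (P : Prop) : (tt P).size ≤ 3 := by
  by_cases h : P <;> simp [tt, h]

@[fun_prop]
def LinP (P : Tr → Prop) : Prop := Lin fun x => tt (P x)

@[fun_prop]
theorem Lin.id : Lin fun x => x :=
  ⟨1, fun _ => ⟨Frag.ident, fun _ => Ev.ident.mono (by omega)⟩⟩

@[fun_prop]
theorem Lin.const (t : Tr) : Lin fun _ => t :=
  ⟨t.size + 3, fun _ => ⟨Frag.const t, fun x => (Ev.const t).mono (by
    have := x.size_pos
    nlinarith)⟩⟩

@[fun_prop]
-- The output lies on the stack at the end, so a linear space program has an output of linear size;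
-- therefore the constants multiply and the class is closed under composition.
theorem Lin.comp {f g : Tr → Tr} (hf : Lin f) (hg : Lin g) : Lin fun x => f (g x) := by
  obtain ⟨C, h⟩ := hf
  obtain ⟨D, h'⟩ := hg
  refine ⟨(C + 1) * D, fun I => ?_⟩
  obtain ⟨F, hF⟩ := h I
  obtain ⟨G, hG⟩ := h' I
  refine ⟨Frag.seq G F, fun x => Ev.seq ((hG x).mono ?_) ((hF (g x)).mono ?_)⟩
  · nlinarith [Nat.zero_le (C * D * x.size)]
  · have := (hG x).size_right
    calc C * (g x).size ≤ C * (D * x.size) := Nat.mul_le_mul_left _ this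
      _ ≤ _ := by nlinarith [Nat.zero_le (D * x.size)]

@[fun_prop]
theorem Lin.node {f g : Tr → Tr} (hf : Lin f) (hg : Lin g) : Lin fun x => .node (f x) (g x) := by
  obtain ⟨C, h⟩ := hf
  obtain ⟨D, h'⟩ := hg
  refine ⟨4 * (C + D) + 1, fun I => ?_⟩
  obtain ⟨F, hF⟩ := h I
  obtain ⟨G, hG⟩ := h' I
  refine ⟨Frag.pair F G, fun x => (Ev.pair (hF x) (hG x)).mono ?_⟩
  have := x.size_pos
  nlinarith

theorem Lin.fst' : Lin Tr.fst :=
  ⟨3, fun _ => ⟨Frag.first, fun x => Ev.first.mono (by have := x.size_pos; omega)⟩⟩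

theorem Lin.snd' : Lin Tr.snd :=
  ⟨3, fun _ => ⟨Frag.second, fun x => Ev.second.mono (by have := x.size_pos; omega)⟩⟩

@[fun_prop]
theorem Lin.fst {f : Tr → Tr} (hf : Lin f) : Lin fun x => (f x).fst := Lin.fst'.comp hf

@[fun_prop]
theorem Lin.snd {f : Tr → Tr} (hf : Lin f) : Lin fun x => (f x).snd := Lin.snd'.comp hf

theorem Lin.iteAux {p f g : Tr → Tr} (hp : Lin p) (hf : Lin f) (hg : Lin g) :
    Lin fun x => if p x ≠ .nil then f x else g x := by
  obtain ⟨A, ha⟩ := hp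
  obtain ⟨C, h⟩ := hf
  obtain ⟨D, h'⟩ := hg
  refine ⟨3 * A + C + D + 1, fun I => ?_⟩
  obtain ⟨P, hP⟩ := ha I
  obtain ⟨F, hF⟩ := h I
  obtain ⟨G, hG⟩ := h' I
  refine ⟨Frag.ite P F G, fun x => ?_⟩
  have := x.size_pos
  have hx := hP x
  rcases hpx : p x with _ | ⟨u, v⟩
  · rw [hpx] at hx
    have h3 := (Ev.ite_nil (F := F) hx (hG x)).mono (B₂ := (3 * A + C + D + 1) * x.size)
      (by nlinarith [Nat.zero_le (C * x.size)])
    simpa [hpx] using h3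
  · rw [hpx] at hx
    have h3 := (Ev.ite_node (G := G) hx (hF x)).mono (B₂ := (3 * A + C + D + 1) * x.size)
      (by nlinarith [Nat.zero_le (D * x.size)])
    simpa [hpx] using h3

@[fun_prop]
theorem Lin.ite {P : Tr → Prop} [∀ x, Decidable (P x)] {f g : Tr → Tr} (hp : LinP P) (hf : Lin f)
    (hg : Lin g) : Lin fun x => if P x then f x else g x := by
  have := Lin.iteAux (p := fun x => LinSpace.tt (P x)) hp hf hg
  refine cast (congrArg Lin (funext fun x => ?_)) this
  by_cases h : P x <;> simp [h]

@[fun_prop]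
theorem Lin.tt {P : Tr → Prop} (hP : LinP P) : Lin fun x => tt (P x) := hP

theorem LinP.of_iff {P Q : Tr → Prop} (h : LinP P) (hPQ : ∀ x, Q x ↔ P x) : LinP Q := by
  have : Q = P := funext fun x => propext (hPQ x)
  rwa [this]

@[fun_prop]
theorem LinP.comp {P : Tr → Prop} {f : Tr → Tr} (hP : LinP P) (hf : Lin f) :
    LinP fun x => P (f x) :=
  Lin.comp hP hf

@[fun_prop]
theorem LinP.const (P : Prop) : LinP fun _ => P := Lin.const _

@[fun_prop]
theorem LinP.isNil {f : Tr → Tr} (hf : Lin f) : LinP fun x => f x = .nil := by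
  have := Lin.iteAux hf (Lin.const .nil) (Lin.const (.node .nil .nil))
  refine cast (congrArg Lin (funext fun x => ?_)) this
  by_cases h : f x = .nil <;> simp [tt, h]

@[fun_prop]
theorem LinP.not {P : Tr → Prop} (hP : LinP P) : LinP fun x => ¬P x := by
  have := Lin.ite hP (Lin.const .nil) (Lin.const (.node .nil .nil))
  refine cast (congrArg Lin (funext fun x => ?_)) this
  by_cases h : P x <;> simp [tt, h]

@[fun_prop]
theorem LinP.and {P Q : Tr → Prop} (hP : LinP P) (hQ : LinP Q) : LinP fun x => P x ∧ Q x := by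
  have := Lin.ite hP hQ (Lin.const .nil)
  refine cast (congrArg Lin (funext fun x => ?_)) this
  by_cases h : P x <;> simp [tt, h]

@[fun_prop]
theorem LinP.or {P Q : Tr → Prop} (hP : LinP P) (hQ : LinP Q) : LinP fun x => P x ∨ Q x := by
  have := (hP.not.and hQ.not).not
  refine this.of_iff fun x => ?_
  tauto

theorem LinP.exists_list {α : Type*} (l : List α) {P : α → Tr → Prop}
    (hP : ∀ a ∈ l, LinP (P a)) : LinP fun x => ∃ a ∈ l, P a x := by
  induction l with
  | nil => simpa using LinP.const False
  | cons a l ih =>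
    simpa using (hP a (by simp)).or (ih fun b hb => hP b (by simp [hb]))

theorem LinP.forall_list {α : Type*} (l : List α) {P : α → Tr → Prop}
    (hP : ∀ a ∈ l, LinP (P a)) : LinP fun x => ∀ a ∈ l, P a x :=
  (LinP.exists_list l fun a ha => (hP a ha).not).not.of_iff fun x => by push Not; rfl

/-! ### Loops -/

/-- Iterating `f` while `P` holds leads from `x` to `y`, through trees of size at most `B`. -/
inductive WhileTo (P : Tr → Prop) (f : Tr → Tr) (B : ℕ) : Tr → Tr → Prop
  | done {x} : ¬P x → x.size ≤ B → WhileTo P f B x x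
  | step {x y} : P x → x.size ≤ B → WhileTo P f B (f x) y → WhileTo P f B x y

theorem exists_ev_while {P : Tr → Prop} {f : Tr → Tr} (hP : LinP P) (hf : Lin f) :
    ∃ C : ℕ, ∀ I : Type, ∃ F : Frag I Unit, ∀ B x y, WhileTo P f B x y → Ev F x y (C * B) := by
  obtain ⟨C, h⟩ := hP
  obtain ⟨D, h'⟩ := hf
  refine ⟨3 * C + D + 1, fun I => ?_⟩
  obtain ⟨G, hG⟩ := h I
  obtain ⟨F, hF⟩ := h' I
  refine ⟨Frag.whileDo G F, fun B x y hw => ?_⟩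
  have key : ∀ x : Tr, x.size ≤ B → 3 * (C * x.size) + 1 ≤ (3 * C + D + 1) * B := fun x hx => by
    have := x.size_pos
    nlinarith [Nat.mul_le_mul_left C hx, Nat.zero_le (D * B)]
  induction hw with
  | @done x h1 h2 =>
    have hx : Ev G x (tt (P x)) _ := hG x
    rw [tt_false h1] at hx
    exact Ev.while_nil hx (key x h2)
  | @step x y h1 h2 _ ih =>
    have hx : Ev G x (tt (P x)) _ := hG x
    rw [tt_true h1] at hx
    refine Ev.while_node hx (key x h2) ((hF x).mono ?_) ih
    nlinarith [Nat.mul_le_mul_left D h2, Nat.zero_le (C * B)]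

/-- The space of a loop is governed by the largest tree on the way and not by the number of
iterations, so exponentially long loops are allowed. -/
theorem Lin.while {P : Tr → Prop} {f i g : Tr → Tr} (hP : LinP P) (hf : Lin f) (hi : Lin i) (c : ℕ)
    (h : ∀ x, WhileTo P f (c * x.size) (i x) (g x)) : Lin g := by
  obtain ⟨C, hC⟩ := exists_ev_while hP hf
  obtain ⟨D, hD⟩ := hi
  refine ⟨C * c + D, fun I => ?_⟩
  obtain ⟨F, hF⟩ := hC I
  obtain ⟨G, hG⟩ := hD I
  refine ⟨Frag.seq G F, fun x => Ev.seq ((hG x).mono ?_) ((hF _ _ _ (h x)).mono ?_)⟩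
  · exact Nat.mul_le_mul_right _ (Nat.le_add_left _ _)
  · rw [← mul_assoc]
    exact Nat.mul_le_mul_right _ (Nat.le_add_right _ _)

/-! ### Equality -/

/-- The state is `node flag W` with a worklist `W` of pairs still to be compared. Two nodes are
replaced by their two pairs of children; a mismatch clears both the flag and the worklist. -/
noncomputable def eqStep (x : Tr) : Tr :=
  if x.snd.fst.fst = .nil then
    if x.snd.fst.snd = .nil then .node x.fst x.snd.snd else .node .nil .nil
  else if x.snd.fst.snd = .nil then .node .nil .nil
  else .node x.fst (.node (.node x.snd.fst.fst.fst x.snd.fst.snd.fst)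
    (.node (.node x.snd.fst.fst.snd x.snd.fst.snd.snd) x.snd.snd))

theorem whileTo_eqStep {B : ℕ} {a b W y : Tr} (h : a.size + b.size + W.size + 6 ≤ B)
    (h' : WhileTo (fun x => x.fst ≠ .nil ∧ x.snd ≠ .nil) eqStep B
      (if a = b then .node (.node .nil .nil) W else .node .nil .nil) y) :
    WhileTo (fun x => x.fst ≠ .nil ∧ x.snd ≠ .nil) eqStep B
      (.node (.node .nil .nil) (.node (.node a b) W)) y := by
  induction a generalizing b W with
  | nil =>
    refine .step (by simp) (by simp at h ⊢; omega) ?_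
    cases b <;> simpa [eqStep] using h'
  | node a1 a2 ih1 ih2 =>
    refine .step (by simp) (by simp at h ⊢; omega) ?_
    rcases b with _ | ⟨b1, b2⟩
    · simpa [eqStep] using h'
    · simp only [Tr.size_node] at h
      simp only [eqStep, Tr.snd_node, Tr.fst_node, reduceCtorEq, if_false]
      refine ih1 (by simp only [Tr.size_node]; omega) ?_
      by_cases h1 : a1 = b1
      · rw [if_pos h1]
        refine ih2 (by omega) ?_
        simpa [h1] using h'
      · simpa [h1] using h'

@[fun_prop]
theorem LinP.eq {f g : Tr → Tr} (hf : Lin f) (hg : Lin g) : LinP fun x => f x = g x := by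
  have h : Lin fun x => if x.fst = x.snd then Tr.node (.node .nil .nil) .nil
      else .node .nil .nil := by
    refine Lin.while (P := fun x => x.fst ≠ .nil ∧ x.snd ≠ .nil) (f := eqStep)
      (i := fun x => .node (.node .nil .nil) (.node (.node x.fst x.snd) .nil)) (by fun_prop)
      (by unfold eqStep; fun_prop) (by fun_prop) 10 fun x => whileTo_eqStep ?_ ?_
    · rcases x with _ | ⟨l, r⟩ <;> simp
      omega
    · have := x.size_pos
      split_ifs <;> exact .done (by simp) (by simp; omega)
  have := (h.fst).comp (hf.node hg)
  refine cast (congrArg Lin (funext fun x => ?_)) this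
  by_cases h : f x = g x <;> simp [tt, h]

/-! ### Lists -/

namespace Tr

/-- A tree as a list of trees: the left branches along its right spine. -/
def toList : Tr → List Tr
  | nil => []
  | node a r => a :: r.toList

def ofList : List Tr → Tr
  | [] => nil
  | a :: l => node a (ofList l)

@[simp] theorem toList_ofList (l : List Tr) : (ofList l).toList = l := by
  induction l <;> simp [ofList, toList, *]

@[simp] theorem ofList_toList (t : Tr) : ofList t.toList = t := by
  induction t <;> simp [ofList, toList, *]

theorem size_ofList (l : List Tr) : (ofList l).size = 1 + (l.map fun t => t.size + 1).sum := by
  induction l with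
  | nil => rfl
  | cons a l ih => simp [ofList, ih]; omega

def revApp : Tr → Tr → Tr
  | nil, t => t
  | node a r, t => r.revApp (node a t)

theorem size_revApp (s t : Tr) : (s.revApp t).size + 1 = s.size + t.size := by
  induction s generalizing t with
  | nil => simp [revApp]; omega
  | node a r _ ih => simp [revApp, ih]; omega

theorem toList_revApp (s t : Tr) : (s.revApp t).toList = s.toList.reverse ++ t.toList := by
  induction s generalizing t with
  | nil => simp [revApp, toList]
  | node a r _ ih => simp [revApp, ih, toList]

end Tr

theorem whileTo_revApp (B : ℕ) {s t : Tr} (h : s.size + t.size + 1 ≤ B) :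
    WhileTo (fun x => x.fst ≠ .nil) (fun x => .node x.fst.snd (.node x.fst.fst x.snd)) B
      (.node s t) (.node .nil (s.revApp t)) := by
  induction s generalizing t with
  | nil => exact .done (by simp) (by simp at h ⊢; omega)
  | node a r _ ih =>
    refine .step (by simp) (by simp at h ⊢; omega) (ih ?_)
    simp at h ⊢; omega

@[fun_prop]
theorem Lin.revApp {f g : Tr → Tr} (hf : Lin f) (hg : Lin g) :
    Lin fun x => (f x).revApp (g x) := by
  have h : Lin fun x => Tr.node .nil (x.fst.revApp x.snd) :=
    Lin.while (i := fun x => .node x.fst x.snd) (by fun_prop) (by fun_prop) (by fun_prop) 3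
      fun x => whileTo_revApp _ (by cases x <;> simp; omega)
  exact h.snd.comp (hf.node hg)

section listRec

variable (g z : Tr → Tr)

/-- Recursion along the right spine, with a parameter `c`. -/
def listRec (c : Tr) : Tr → Tr
  | .nil => z c
  | .node a r => g (.node c (.node a (.node r (listRec c r))))

variable {g z}

/-- The recursion is evaluated from the end of the list: the state holds the reversed unread prefix
`s`, the suffix `r` already treated, and the value at `r`. Space stays linear because `hC` bounds
all intermediate values. -/
theorem whileTo_listRec {C B : ℕ} {c s r : Tr}
    (hC : ∀ c t, (listRec g z c t).size ≤ C * (c.size + t.size))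
    (h : c.size + s.size + r.size + C * (c.size + s.size + r.size) + 3 ≤ B) :
    WhileTo (fun x => x.snd.fst ≠ .nil) (fun x => .node x.fst (.node x.snd.fst.snd
        (.node (.node x.snd.fst.fst x.snd.snd.fst)
          (g (.node x.fst (.node x.snd.fst.fst x.snd.snd)))))) B
      (.node c (.node s (.node r (listRec g z c r))))
      (.node c (.node .nil (.node (s.revApp r) (listRec g z c (s.revApp r))))) := by
  have hsize : (Tr.node c (.node s (.node r (listRec g z c r)))).size ≤ B := by
    have := hC c r
    have := Nat.mul_le_mul_left C (by omega : c.size + r.size ≤ c.size + s.size + r.size)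
    simp only [Tr.size_node]
    omega
  induction s generalizing r with
  | nil => exact .done (by simp) hsize
  | node a s _ ih =>
    refine .step (by simp) hsize ?_
    have e : c.size + s.size + (Tr.node a r).size = c.size + (Tr.node a s).size + r.size := by
      simp only [Tr.size_node]; omega
    refine ih (r := .node a r) (by rw [e]; exact h) ?_
    have := hC c (.node a r)
    have := Nat.mul_le_mul_left C (by rw [← e]; omega :
      c.size + (Tr.node a r).size ≤ c.size + (Tr.node a s).size + r.size)
    simp only [Tr.size_node] at *
    omega

theorem Lin.listRec (hg : Lin g) (hz : Lin z) {C : ℕ}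
    (hC : ∀ c t, (listRec g z c t).size ≤ C * (c.size + t.size)) {f h : Tr → Tr} (hf : Lin f)
    (hh : Lin h) : Lin fun x => listRec g z (f x) (h x) := by
  have key : Lin fun x => Tr.node x.fst (.node .nil (.node
      ((x.snd.revApp .nil).revApp .nil)
      (LinSpace.listRec g z x.fst ((x.snd.revApp .nil).revApp .nil)))) := by
    refine Lin.while
      (i := fun x => .node x.fst (.node (x.snd.revApp .nil) (.node .nil (z x.fst))))
      (P := fun x => x.snd.fst ≠ .nil) (f := fun x => .node x.fst (.node x.snd.fst.snd
        (.node (.node x.snd.fst.fst x.snd.snd.fst)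
          (g (.node x.fst (.node x.snd.fst.fst x.snd.snd)))))) (by fun_prop) (by fun_prop)
      (by fun_prop) (6 * (C + 1)) fun x => ?_
    refine whileTo_listRec (r := .nil) hC ?_
    have h1 := Tr.size_revApp x.snd .nil
    have h2 : x.fst.size + x.snd.size ≤ 2 * x.size := by cases x <;> simp; omega
    have h3 := x.size_pos
    simp only [Tr.size_nil] at h1 ⊢
    have h4 : x.fst.size + (x.snd.revApp .nil).size + 1 ≤ 3 * x.size := by omega
    have := Nat.mul_le_mul_left C h4
    nlinarith
  -- The loop starts from the reversed list and rebuilds the original one.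
  have e : ∀ t : Tr, (t.revApp .nil).revApp .nil = t := fun t => by
    rw [← Tr.ofList_toList ((t.revApp .nil).revApp .nil)]
    simp [Tr.toList_revApp, Tr.toList]
  simp only [e] at key
  exact key.snd.snd.snd.comp (hf.node hh)

end listRec

def mapTr (g : Tr → Tr) (c : Tr) : Tr → Tr
  | .nil => .nil
  | .node a r => .node (g (.node c a)) (mapTr g c r)

theorem toList_mapTr (g : Tr → Tr) (c t : Tr) :
    (mapTr g c t).toList = t.toList.map fun a => g (.node c a) := by
  induction t <;> simp [mapTr, Tr.toList, *]

/-! ### Choosing an element of a list -/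

/-- The entries passed over are kept in reverse, so `R` lists the others in a changed order. This is
harmless since lists only represent multisets. -/
def PickAux (a R : Tr) : Tr → Tr → Prop
  | _, .nil => False
  | seen, .node b r => (a = b ∧ R = seen.revApp r) ∨ PickAux a R (.node b seen) r

/-- `a` is an element of the list `l`, and `R` lists the other ones. -/
def Pick (l a R : Tr) : Prop := PickAux a R .nil l

theorem PickAux.coe_eq {a R seen l : Tr} (h : PickAux a R seen l) :
    (l.toList : Multiset Tr) + (seen.toList : Multiset Tr) = a ::ₘ (R.toList : Multiset Tr) := by
  induction l generalizing seen with
  | nil => exact h.elim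
  | node b r _ ih =>
    rcases h with ⟨rfl, rfl⟩ | h
    · simp only [Tr.toList, Tr.toList_revApp]
      rw [← Multiset.coe_add, Multiset.coe_reverse, ← Multiset.cons_coe, Multiset.cons_add,
        add_comm]
    · rw [← ih h]
      simp only [Tr.toList]
      rw [← Multiset.cons_coe, ← Multiset.cons_coe, Multiset.cons_add, Multiset.add_cons]

theorem Pick.coe_eq {a R l : Tr} (h : Pick l a R) :
    (l.toList : Multiset Tr) = a ::ₘ (R.toList : Multiset Tr) := by
  simpa [Tr.toList] using PickAux.coe_eq h

theorem exists_pick {l a : Tr} (h : a ∈ l.toList) : ∃ R, Pick l a R := by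
  unfold Pick
  generalize Tr.nil = seen
  induction l generalizing seen with
  | nil => simp [Tr.toList] at h
  | node b r _ ih =>
    rcases List.mem_cons.1 h with rfl | h
    · exact ⟨_, .inl ⟨rfl, rfl⟩⟩
    · obtain ⟨R, hR⟩ := ih h (.node b seen)
      exact ⟨R, .inr hR⟩

noncomputable def pickStep (Q : Tr → Prop) (x : Tr) : Tr :=
  if Q (.node x.snd.fst.snd.fst (.node (x.snd.fst.fst.revApp x.snd.fst.snd.snd) x.snd.snd)) then
    .node (.node .nil .nil) .nil
  else .node .nil (.node (.node (.node x.snd.fst.snd.fst x.snd.fst.fst) x.snd.fst.snd.snd)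
    x.snd.snd)

theorem whileTo_pickStep (Q : Tr → Prop) {B : ℕ} {seen l x : Tr}
    (h : seen.size + l.size + x.size + 5 ≤ B) :
    ∃ y, WhileTo (fun x => x.fst = .nil ∧ x.snd.fst.snd ≠ .nil) (pickStep Q) B
      (.node .nil (.node (.node seen l) x))
      (.node (tt (∃ a R, PickAux a R seen l ∧ Q (.node a (.node R x)))) y) := by
  induction l generalizing seen with
  | nil =>
    rw [tt_false (by simp [PickAux])]
    exact ⟨_, .done (by simp) (by simp at h ⊢; omega)⟩
  | node b r _ ih =>
    by_cases hq : Q (.node b (.node (seen.revApp r) x))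
    · refine ⟨.nil, .step (by simp) (by simp at h ⊢; omega) ?_⟩
      rw [tt_true ⟨b, _, .inl ⟨rfl, rfl⟩, hq⟩]
      simp only [pickStep, Tr.snd_node, Tr.fst_node, hq, if_true]
      exact .done (by simp) (by simp at h ⊢; omega)
    · obtain ⟨y, hy⟩ := ih (seen := .node b seen) (by simp at h ⊢; omega)
      refine ⟨y, .step (by simp) (by simp at h ⊢; omega) ?_⟩
      simp only [pickStep, Tr.snd_node, Tr.fst_node, hq, if_false]
      convert hy using 3
      constructor
      · rintro ⟨a, R, ⟨rfl, rfl⟩ | h, h'⟩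
        · exact absurd h' hq
        · exact ⟨a, R, h, h'⟩
      · rintro ⟨a, R, h, h'⟩
        exact ⟨a, R, .inr h, h'⟩

/-- A nondeterministic choice of an entry becomes a scan over all positions that stores only the
current split of the list. -/
theorem LinP.pick {Q : Tr → Prop} (hQ : LinP Q) {f g : Tr → Tr} (hf : Lin f) (hg : Lin g) :
    LinP fun x => ∃ a R, Pick (f x) a R ∧ Q (.node a (.node R (g x))) := by
  choose y hy using fun x : Tr => whileTo_pickStep Q (B := 20 * x.size) (seen := .nil) (l := x.fst)
    (x := x.snd) (by cases x <;> simp; omega)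
  have h := (Lin.while (i := fun x => .node .nil (.node (.node .nil x.fst) x.snd))
    (P := fun x => x.fst = .nil ∧ x.snd.fst.snd ≠ .nil) (f := pickStep Q)
    (by fun_prop) (by unfold pickStep; fun_prop) (by fun_prop) 20 hy).fst
  simp only [Tr.fst_node] at h
  exact (LinP.comp h (hf.node hg) :)

theorem LinP.exists_mem {Q : Tr → Prop} (hQ : LinP Q) {f g : Tr → Tr} (hf : Lin f) (hg : Lin g) :
    LinP fun x => ∃ a ∈ (f x).toList, Q (.node a (g x)) := by
  have h : LinP fun x => Q (.node x.fst x.snd.snd) := by fun_prop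
  refine (LinP.pick h hf hg).of_iff fun x => ⟨?_, ?_⟩
  · rintro ⟨a, ha, h⟩
    obtain ⟨R, hR⟩ := exists_pick ha
    exact ⟨a, R, hR, h⟩
  · rintro ⟨a, R, hR, h⟩
    refine ⟨a, ?_, h⟩
    have := hR.coe_eq
    rw [← Multiset.mem_coe, this]
    exact Multiset.mem_cons_self _ _

end LinSpace

/-! ### Arithmetic, bounded search, and numbers as names of trees. -/

namespace LinSpace

open Classical

/-! ### Natural numbers in bijective base two -/

/-- The digit two; the digit one is `nil`. -/
abbrev two : Tr := .node .nil .nil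

/-- Least significant digit first. In bijective base two there are no leading zeros, so equal
numbers have equal canonical trees, and every bit string is a numeral, so prefix codes can serve as
numbers. Any digit other than `nil` counts as two, which makes `val` total. -/
def val : Tr → ℕ
  | .nil => 0
  | .node .nil r => 1 + 2 * val r
  | .node (.node _ _) r => 2 + 2 * val r

def len (t : Tr) : ℕ := t.toList.length

@[simp] theorem val_nil : val .nil = 0 := rfl
@[simp] theorem val_one (r : Tr) : val (.node .nil r) = 1 + 2 * val r := rfl
@[simp] theorem val_two (a b r : Tr) : val (.node (.node a b) r) = 2 + 2 * val r := rfl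
@[simp] theorem len_nil : len .nil = 0 := rfl
@[simp] theorem len_node (a r : Tr) : len (.node a r) = len r + 1 := rfl

theorem val_eq_zero {t : Tr} : val t = 0 ↔ t = .nil := by
  rcases t with _ | ⟨_ | ⟨a, b⟩, r⟩ <;> simp

theorem two_pow_len_le (t : Tr) : 2 ^ len t ≤ val t + 1 := by
  induction t with
  | nil => simp
  | node d r _ ih => rcases d with _ | ⟨a, b⟩ <;> simp [pow_succ] <;> omega

theorem val_lt_two_pow (t : Tr) : val t + 2 ≤ 2 ^ (len t + 1) := by
  induction t with
  | nil => simp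
  | node d r _ ih => rcases d with _ | ⟨a, b⟩ <;> simp [pow_succ] at ih ⊢ <;> omega

noncomputable def succStep (x : Tr) : Tr :=
  if x.snd.fst = .nil then .node two x.snd.snd.fst else .node .nil x.snd.snd.snd

noncomputable def succ (t : Tr) : Tr := listRec succStep (fun _ => .node .nil .nil) .nil t

theorem succ_nil : succ .nil = .node .nil .nil := rfl
theorem succ_one (r : Tr) : succ (.node .nil r) = .node two r := by
  simp [succ, listRec, succStep]
theorem succ_two (a b r : Tr) : succ (.node (.node a b) r) = .node .nil (succ r) := by
  simp [succ, listRec, succStep]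

@[simp] theorem val_succ (t : Tr) : val (succ t) = val t + 1 := by
  induction t with
  | nil => simp [succ_nil]
  | node d r _ ih =>
    rcases d with _ | ⟨a, b⟩
    · simp [succ_one]; omega
    · simp [succ_two, ih]; omega

/-- For a leading digit one the rule is `(1 + 2 * r) - 1 = 2 + 2 * (r - 1)`, valid for `r ≠ 0`;
hence the separate case of an empty tail. -/
noncomputable def predStep (x : Tr) : Tr :=
  if x.snd.fst = .nil then
    if x.snd.snd.fst = .nil then .nil else .node two x.snd.snd.snd
  else .node .nil x.snd.snd.fst

noncomputable def pred (t : Tr) : Tr := listRec predStep (fun _ => .nil) .nil t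

theorem pred_nil : pred .nil = .nil := rfl
theorem pred_one (r : Tr) : pred (.node .nil r) = if r = .nil then .nil else .node two (pred r) := by
  by_cases h : r = .nil <;> simp [pred, listRec, predStep, h]
theorem pred_two (a b r : Tr) : pred (.node (.node a b) r) = .node .nil r := by
  simp [pred, listRec, predStep]

@[simp] theorem val_pred (t : Tr) : val (pred t) = val t - 1 := by
  induction t with
  | nil => simp [pred_nil]
  | node d r _ ih =>
    rcases d with _ | ⟨a, b⟩
    · rw [pred_one]
      split_ifs with h
      · simp [h]
      · have := mt val_eq_zero.1 h
        simp [ih]; omega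
    · simp [pred_two]

@[fun_prop]
theorem Lin.succ {f : Tr → Tr} (hf : Lin f) : Lin fun x => succ (f x) := by
  refine Lin.listRec (C := 2) (by unfold succStep; fun_prop) (by fun_prop) (fun c t => ?_)
    (Lin.const .nil) hf
  have h : (LinSpace.listRec succStep (fun _ => .node .nil .nil) c t).size ≤ t.size + 2 := by
    induction t with
    | nil => simp [LinSpace.listRec]
    | node d r _ ih =>
      rcases d with _ | ⟨a, b⟩ <;> simp [LinSpace.listRec, succStep] <;> omega
  have := t.size_pos
  have := c.size_pos
  omega

/-- A bound on the size of all numbers obtained from `t` by decrements. -/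
def bulk : Tr → ℕ
  | .nil => 1
  | .node d r => 1 + max d.size 3 + bulk r

theorem size_le_bulk (t : Tr) : t.size ≤ bulk t := by
  induction t with
  | nil => simp [bulk]
  | node d r _ ih => simp [bulk]; omega

theorem bulk_le (t : Tr) : bulk t ≤ 3 * t.size := by
  induction t with
  | nil => simp [bulk]
  | node d r _ ih => have := d.size_pos; simp [bulk]; omega

theorem bulk_pred (t : Tr) : bulk (pred t) ≤ bulk t := by
  induction t with
  | nil => simp [pred_nil]
  | node d r _ ih =>
    rcases d with _ | ⟨a, b⟩
    · rw [pred_one]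
      split_ifs with h
      · simp [bulk]; omega
      · simp [bulk]; omega
    · rw [pred_two]
      simp [bulk]
      omega

@[fun_prop]
theorem Lin.pred {f : Tr → Tr} (hf : Lin f) : Lin fun x => pred (f x) := by
  refine Lin.listRec (C := 2) (by unfold predStep; fun_prop) (by fun_prop) (fun c t => ?_)
    (Lin.const .nil) hf
  have h : (LinSpace.listRec predStep (fun _ => .nil) c t).size + 1 ≤ 2 * t.size := by
    induction t with
    | nil => simp [LinSpace.listRec]
    | node d r _ ih =>
      rcases d with _ | ⟨a, b⟩
      · by_cases h : r = .nil
        · subst h; simp [LinSpace.listRec, predStep]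
        · simp [LinSpace.listRec, predStep, h]; omega
      · simp [LinSpace.listRec, predStep]; omega
  omega

/-- Both numbers are counted down together until one is zero: exponentially many rounds, but linear
space, since `bulk` never grows. -/
theorem whileTo_pred {B : ℕ} (a b : Tr) (h : bulk a + bulk b + 1 ≤ B) :
    ∃ a' b', WhileTo (fun x => x.fst ≠ .nil ∧ x.snd ≠ .nil)
      (fun x => .node (pred x.fst) (pred x.snd)) B (.node a b) (.node a' b') ∧
      (a' = .nil ↔ val a ≤ val b) := by
  induction hn : val a generalizing a b with
  | zero =>
    rw [val_eq_zero] at hn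
    subst hn
    have := size_le_bulk b
    exact ⟨.nil, b, .done (by simp) (by simp [bulk] at h ⊢; omega), by simp⟩
  | succ n ih =>
    have h1 := size_le_bulk a
    have h2 := size_le_bulk b
    have ha : a ≠ .nil := by rintro rfl; simp at hn
    by_cases hb : b = .nil
    · subst hb
      exact ⟨a, .nil, .done (by simp) (by simp at h2 ⊢; omega), by simp [ha]⟩
    · have h3 := bulk_pred a
      have h4 := bulk_pred b
      have h5 := mt val_eq_zero.1 hb
      obtain ⟨a', b', h6, h7⟩ := ih (pred a) (pred b) (by omega) (by simp; omega)
      refine ⟨a', b', .step ⟨ha, hb⟩ (by simp; omega) h6, h7.trans ?_⟩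
      simp only [val_pred]
      omega

@[fun_prop]
theorem LinP.le {f g : Tr → Tr} (hf : Lin f) (hg : Lin g) :
    LinP fun x => val (f x) ≤ val (g x) := by
  choose a b h1 h2 using fun x : Tr => whileTo_pred (B := 8 * x.size) x.fst x.snd (by
    have := bulk_le x.fst
    have := bulk_le x.snd
    cases x <;> simp at * <;> omega)
  have h := (Lin.while (i := fun x => .node x.fst x.snd)
    (P := fun x => x.fst ≠ .nil ∧ x.snd ≠ .nil) (f := fun x => .node (_root_.LinSpace.pred x.fst)
      (_root_.LinSpace.pred x.snd)) (by fun_prop) (by fun_prop) (by fun_prop) 8 h1).fst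
  have h3 : LinP fun x => val x.fst ≤ val x.snd := (LinP.isNil h).of_iff fun x => (h2 x).symm
  exact LinP.comp h3 (hf.node hg)

@[fun_prop]
theorem LinP.lt {f g : Tr → Tr} (hf : Lin f) (hg : Lin g) :
    LinP fun x => val (f x) < val (g x) :=
  (LinP.le hg hf).not.of_iff fun _ => not_le.symm

/-- The canonical numeral. -/
noncomputable def num : ℕ → Tr
  | 0 => .nil
  | n + 1 => succ (num n)

@[simp] theorem num_zero : num 0 = .nil := rfl

theorem num_succ (n : ℕ) : num (n + 1) = succ (num n) := rfl

@[simp] theorem val_num (n : ℕ) : val (num n) = n := by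
  induction n with
  | zero => rfl
  | succ n ih => rw [num_succ, val_succ, ih]

theorem num_injective : Function.Injective num := fun a b h => by
  rw [← val_num a, h, val_num]

def IsDigit (t : Tr) : Prop := t = .nil ∨ t = two

/-- All digits are `nil` or `two`. -/
def Canon (t : Tr) : Prop := ∀ d ∈ t.toList, IsDigit d

theorem canon_nil : Canon .nil := by simp [Canon, Tr.toList]

theorem canon_node {d r : Tr} : Canon (.node d r) ↔ IsDigit d ∧ Canon r := by
  simp [Canon, Tr.toList]

theorem Canon.succ {t : Tr} (h : Canon t) : Canon (succ t) := by
  induction t with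
  | nil => simp [succ_nil, canon_node, IsDigit, canon_nil]
  | node d r _ ih =>
    rw [canon_node] at h
    rcases d with _ | ⟨a, b⟩
    · rw [succ_one]
      exact canon_node.2 ⟨.inr rfl, h.2⟩
    · rw [succ_two]
      exact canon_node.2 ⟨.inl rfl, ih h.2⟩

theorem canon_num (n : ℕ) : Canon (num n) := by
  induction n with
  | zero => exact canon_nil
  | succ n ih => exact ih.succ

theorem pred_succ {t : Tr} (h : Canon t) : pred (succ t) = t := by
  induction t with
  | nil => simp [succ_nil, pred_one]
  | node d r _ ih =>
    rw [canon_node] at h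
    rcases h.1 with rfl | rfl
    · rw [succ_one, pred_two]
    · rw [succ_two, pred_one, ih h.2, if_neg]
      intro h
      have := congrArg val h
      simp at this

theorem Canon.eq_num {t : Tr} (h : Canon t) : t = num (val t) := by
  have inj : ∀ s t, Canon s → Canon t → val s = val t → s = t := by
    intro s
    induction s with
    | nil =>
      intro t _ _ h
      exact (val_eq_zero.1 h.symm).symm
    | node d r _ ih =>
      intro t h1 h2 h
      rw [canon_node] at h1
      rcases t with _ | ⟨d', r'⟩
      · exact val_eq_zero.1 h
      · rw [canon_node] at h2
        rcases h1.1 with rfl | rfl <;> rcases h2.1 with rfl | rfl <;> simp only [val_one, val_two] at h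
        · rw [ih r' h1.2 h2.2 (by omega)]
        · omega
        · omega
        · rw [ih r' h1.2 h2.2 (by omega)]
  exact inj _ _ h (canon_num _) (by simp)

theorem pred_num (n : ℕ) : pred (num (n + 1)) = num n := pred_succ (canon_num n)

theorem Canon.size_le {t : Tr} (h : Canon t) : t.size ≤ 4 * len t + 1 := by
  induction t with
  | nil => simp
  | node d r _ ih =>
    rw [canon_node] at h
    have := ih h.2
    rcases h.1 with rfl | rfl <;> simp <;> omega

theorem len_le_size (t : Tr) : len t ≤ t.size := by
  induction t with
  | nil => simp
  | node d r _ ih => simp; omega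

theorem len_le_of_val_le {s t : Tr} (h : val s ≤ val t) : len s ≤ len t := by
  have h1 := two_pow_len_le s
  have h2 := val_lt_two_pow t
  have h3 : 2 ^ len s < 2 ^ (len t + 1) := by omega
  have := (Nat.pow_lt_pow_iff_right (by norm_num)).1 h3
  omega

/-- The length of a numeral is monotone in its value, so a counter bounded by `t` always fits into
linear space in `t`. -/
theorem size_num_le_of_le {n : ℕ} {t : Tr} (h : n ≤ val t) : (num n).size ≤ 4 * t.size + 1 := by
  have h1 := (canon_num n).size_le
  have h2 := len_le_of_val_le (s := num n) (t := t) (by simpa using h)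
  have h3 := len_le_size t
  omega

theorem size_num_le (n : ℕ) : (num n).size ≤ 4 * Nat.log 2 (n + 1) + 1 := by
  have h1 := (canon_num n).size_le
  have h2 := two_pow_len_le (num n)
  rw [val_num] at h2
  have := Nat.le_log_of_pow_le (by norm_num) h2
  omega

theorem Lin.add_const {f : Tr → Tr} (hf : Lin f) (n : ℕ) : Lin fun x => LinSpace.succ^[n] (f x) := by
  induction n with
  | zero => exact hf
  | succ n ih =>
    simp only [Function.iterate_succ_apply']
    exact ih.succ

theorem iterate_succ_num (n m : ℕ) : succ^[n] (num m) = num (m + n) := by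
  induction n with
  | zero => rfl
  | succ n ih => rw [Function.iterate_succ_apply', ih, ← add_assoc, num_succ]

theorem val_iterate_succ (n : ℕ) (t : Tr) : val (succ^[n] t) = val t + n := by
  induction n with
  | zero => rfl
  | succ n ih => rw [Function.iterate_succ_apply', val_succ, ih, add_assoc]

/-! ### Bounded search -/

theorem whileTo_search {Q : Tr → Prop} {M x : Tr} {B n : ℕ} (hn : n ≤ val M)
    (hB : 5 * M.size + x.size + 3 ≤ B) :
    ∃ m ≤ val M, WhileTo (fun y => val y.fst < val y.snd.fst ∧ ¬Q (.node y.fst y.snd.snd))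
      (fun y => .node (succ y.fst) y.snd) B (.node (num n) (.node M x))
      (.node (num m) (.node M x)) ∧
      (m < val M ↔ ∃ i, n ≤ i ∧ i < val M ∧ Q (.node (num i) x)) := by
  have hs : (Tr.node (num n) (.node M x)).size ≤ B := by
    have := size_num_le_of_le hn
    simp; omega
  induction hk : val M - n generalizing n with
  | zero =>
    have : n = val M := by omega
    refine ⟨n, hn, .done (by simp; omega) hs, ?_⟩
    constructor
    · omega
    · rintro ⟨i, h1, h2, -⟩; omega
  | succ k ih =>
    by_cases hQ : Q (.node (num n) x)
    · exact ⟨n, hn, .done (by simp [hQ]) hs, ⟨fun h => ⟨n, le_rfl, h, hQ⟩, by omega⟩⟩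
    · have hn' : n + 1 ≤ val M := by omega
      obtain ⟨m, h1, h2, h3⟩ := ih hn' (by
        have := size_num_le_of_le hn'
        simp; omega) (by omega)
      refine ⟨m, h1, .step (by simp [hQ]; omega) hs h2, h3.trans ?_⟩
      constructor
      · rintro ⟨i, h4, h5, h6⟩
        exact ⟨i, by omega, h5, h6⟩
      · rintro ⟨i, h4, h5, h6⟩
        refine ⟨i, ?_, h5, h6⟩
        rcases h4.eq_or_lt with rfl | h4
        · exact absurd h6 hQ
        · exact h4

/-- The bound is given as a numeral, so a search through exponentially many values needs only a
counter of linear size. -/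
theorem LinP.exists_lt {Q : Tr → Prop} (hQ : LinP Q) {f g : Tr → Tr} (hf : Lin f) (hg : Lin g) :
    LinP fun x => ∃ n < val (f x), Q (.node (num n) (g x)) := by
  choose m _ h1 h2 using fun x : Tr => whileTo_search (Q := Q) (M := x.fst) (x := x.snd)
    (B := 9 * x.size) (Nat.zero_le _) (by cases x <;> simp; omega)
  have h := Lin.while (i := fun x => .node .nil (.node x.fst x.snd))
    (P := fun y => val y.fst < val y.snd.fst ∧ ¬Q (.node y.fst y.snd.snd))
    (f := fun y => .node (_root_.LinSpace.succ y.fst) y.snd)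
    (by fun_prop) (by fun_prop) (by fun_prop) 9 h1
  have h3 : LinP fun x => ∃ n < val x.fst, Q (.node (num n) x.snd) := by
    have h4 : LinP fun y => val y.fst < val y.snd.fst := by fun_prop
    refine (LinP.comp h4 h).of_iff fun x => ?_
    have := h2 x
    simp only [Tr.fst_node, Tr.snd_node, val_num]
    rw [this]
    simp
  exact LinP.comp h3 (hf.node hg)

/-! ### Numbers as names of trees -/

/-- The code is read from its end: the digit one pushes a leaf, the digit two joins the two top
trees. Missing trees are read as `nil`, so every number names some tree. -/
noncomputable def parseStep (x : Tr) : Tr :=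
  if x.snd.fst = .nil then .node .nil x.snd.snd.snd
  else .node (.node x.snd.snd.snd.fst x.snd.snd.snd.snd.fst) x.snd.snd.snd.snd.snd

/-- The digits of a number, read as a prefix code: the stack of trees that they describe. -/
noncomputable def parseStack (t : Tr) : Tr := listRec parseStep (fun _ => .nil) .nil t

noncomputable def parse (t : Tr) : Tr := (parseStack t).fst

@[fun_prop]
theorem Lin.parse {f : Tr → Tr} (hf : Lin f) : Lin fun x => parse (f x) := by
  refine Lin.fst (Lin.listRec (C := 4) (by unfold parseStep; fun_prop) (by fun_prop)
    (fun c t => ?_) (Lin.const .nil) hf)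
  have h : (LinSpace.listRec parseStep (fun _ => .nil) c t).size ≤ 4 * t.size := by
    induction t with
    | nil => simp [LinSpace.listRec]
    | node d r _ ih =>
      simp only [LinSpace.listRec, parseStep, Tr.snd_node, Tr.fst_node]
      generalize LinSpace.listRec parseStep (fun _ => .nil) c r = S at ih ⊢
      rcases d with _ | ⟨d1, d2⟩
      · simp; omega
      · rcases S with _ | ⟨a, _ | ⟨b, S⟩⟩ <;> simp at ih ⊢ <;> omega
  omega

def digit (b : Bool) : Tr := if b then two else .nil

/-- The numeral whose digits are the prefix code of `t`. -/
def nameTr (t : Tr) : Tr := .ofList (t.code.map digit)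

theorem parseStack_nameTr (t : Tr) (l : List Bool) :
    parseStack (.ofList ((t.code ++ l).map digit)) =
      .node t (parseStack (.ofList (l.map digit))) := by
  induction t generalizing l with
  | nil => simp [Tr.code, Tr.ofList, parseStack, listRec, parseStep, digit]
  | node a b iha ihb =>
    have := iha (b.code ++ l)
    rw [ihb] at this
    simp only [Tr.code, List.cons_append, List.map_cons, Tr.ofList, List.append_assoc]
    rw [parseStack, listRec]
    change parseStep (.node .nil (.node (digit true) (.node _ (parseStack _)))) = _
    rw [this]
    simp [parseStep, digit]

theorem parse_nameTr (t : Tr) : parse (nameTr t) = t := by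
  have := parseStack_nameTr t []
  rw [List.append_nil] at this
  rw [parse, nameTr, this, Tr.fst_node]

theorem canon_nameTr (t : Tr) : Canon (nameTr t) := by
  intro d hd
  simp only [nameTr, Tr.toList_ofList, List.mem_map] at hd
  obtain ⟨b, -, rfl⟩ := hd
  cases b
  · exact .inl rfl
  · exact .inr rfl

theorem len_nameTr (t : Tr) : len (nameTr t) = t.size := by
  simp [len, nameTr, Tr.length_code]

/-- The index of a tree. -/
noncomputable def index (t : Tr) : ℕ := val (nameTr t)

theorem parse_index (t : Tr) : parse (num (index t)) = t := by
  rw [index, ← (canon_nameTr t).eq_num, parse_nameTr]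

/-- The numeral with `s` digits one, that is, `2 ^ s - 1`. -/
def ones : ℕ → Tr
  | 0 => .nil
  | s + 1 => .node .nil (ones s)

theorem val_ones (s : ℕ) : val (ones s) + 1 = 2 ^ s := by
  induction s with
  | zero => rfl
  | succ s ih => simp [ones, pow_succ, ← ih]; omega

@[simp] theorem len_ones (s : ℕ) : len (ones s) = s := by
  induction s with
  | zero => rfl
  | succ s ih => simp [ones, ih]

@[simp] theorem size_ones (s : ℕ) : (ones s).size = 2 * s + 1 := by
  induction s with
  | zero => rfl
  | succ s ih => simp [ones, ih]; omega

/-- The name of `t` has one digit per code symbol. Thus `ones s` bounds the names of all trees of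
size below `s` and itself has size only `2 * s + 1`. -/
theorem index_lt {t : Tr} {s : ℕ} (h : t.size < s) : index t < val (ones s) := by
  have h1 := val_lt_two_pow (nameTr t)
  rw [len_nameTr] at h1
  have h2 := val_ones s
  have h3 : 2 ^ (t.size + 1) ≤ 2 ^ s := Nat.pow_le_pow_right (by norm_num) h
  unfold index
  omega

end LinSpace

/-! ### Savitch's theorem for linear space relations. -/

namespace LinSpace

open Classical

/-! ### Reachability by bisection -/

/-- Reachability in at most `2 ^ i` steps through numbers below `M`. -/
def reach (R : ℕ → ℕ → Prop) (M : ℕ) : ℕ → ℕ → ℕ → Prop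
  | 0, a, b => a = b ∨ R a b
  | i + 1, a, b => ∃ c < M, reach R M i a c ∧ reach R M i c b

section

variable {R : ℕ → ℕ → Prop} {M : ℕ}

theorem reach_sound {i a b : ℕ} (hb : b < M) (h : reach R M i a b) :
    Relation.ReflTransGen (fun u v => v < M ∧ R u v) a b := by
  induction i generalizing a b with
  | zero =>
    rcases h with rfl | h
    · exact .refl
    · exact .single ⟨hb, h⟩
  | succ i ih =>
    obtain ⟨c, hc, h1, h2⟩ := h
    exact (ih hc h1).trans (ih hb h2)

/-- `f` is a path of length `n` below `M`. -/
def IsWalk (R : ℕ → ℕ → Prop) (M : ℕ) (n : ℕ) (f : ℕ → ℕ) : Prop :=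
  ∀ i < n, f (i + 1) < M ∧ R (f i) (f (i + 1))

theorem reach_of_walk {i n : ℕ} {f : ℕ → ℕ} (h0 : f 0 < M) (hf : IsWalk R M n f) (hn : n ≤ 2 ^ i) :
    reach R M i (f 0) (f n) := by
  induction i generalizing n f with
  | zero =>
    rcases n with _ | _ | n
    · exact .inl rfl
    · exact .inr (hf 0 (by omega)).2
    · simp at hn
  | succ i ih =>
    have hlt : ∀ j ≤ n, f j < M := fun j hj => by
      rcases j with _ | j
      · exact h0
      · exact (hf j (by omega)).1
    rcases le_total n (2 ^ i) with h | h
    · exact ⟨f n, hlt n le_rfl, ih h0 hf h,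
        ih (n := 0) (f := fun _ => f n) (hlt n le_rfl) (fun j hj => absurd hj (by omega)) (by omega)⟩
    · refine ⟨f (2 ^ i), hlt _ h, ih h0 (fun j hj => hf j (by omega)) le_rfl, ?_⟩
      have := ih (n := n - 2 ^ i) (f := fun j => f (2 ^ i + j)) (hlt _ (by omega))
        (fun j hj => hf (2 ^ i + j) (by omega)) (by rw [pow_succ] at hn; omega)
      simpa [Nat.add_sub_of_le h] using this

theorem exists_walk {a b : ℕ} (h : Relation.ReflTransGen (fun u v => v < M ∧ R u v) a b) :
    ∃ n f, IsWalk R M n f ∧ f 0 = a ∧ f n = b := by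
  induction h with
  | refl => exact ⟨0, fun _ => a, fun j hj => absurd hj (by omega), rfl, rfl⟩
  | @tail b c _ h2 ih =>
    obtain ⟨n, f, hf, h0, hn⟩ := ih
    refine ⟨n + 1, fun j => if j ≤ n then f j else c, fun j hj => ?_, by simpa using h0, by simp⟩
    rcases (Nat.lt_succ_iff.1 hj).eq_or_lt with rfl | hj
    · simpa [hn] using h2
    · have := hf j hj
      simpa [hj.le, Nat.succ_le_of_lt hj] using this

/-- A shortest walk repeats no vertex, and there are only `M` vertices. -/
theorem exists_short_walk {a b : ℕ} (ha : a < M)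
    (h : Relation.ReflTransGen (fun u v => v < M ∧ R u v) a b) :
    ∃ n < M, ∃ f, IsWalk R M n f ∧ f 0 = a ∧ f n = b := by
  have hex := exists_walk h
  obtain ⟨f, hf, h0, hn⟩ := Nat.find_spec hex
  set n := Nat.find hex with hdef
  refine ⟨n, ?_, f, hf, h0, hn⟩
  by_contra hM
  have hlt : ∀ j ∈ Finset.range (n + 1), f j ∈ Finset.range M := fun j hj => by
    rw [Finset.mem_range] at hj ⊢
    rcases j with _ | j
    · rwa [h0]
    · exact (hf j (by omega)).1
  obtain ⟨i, hi, j, hj, hij, e⟩ := Finset.exists_ne_map_eq_of_card_lt_of_maps_to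
    (by simp; omega) hlt
  wlog hlt' : i < j generalizing i j
  · exact this j hj i hi hij.symm e.symm (by omega)
  simp only [Finset.mem_range] at hi hj
  -- Removing the closed part between the times `i` and `j` gives a shorter walk.
  refine Nat.find_min hex (m := n - (j - i)) (by omega)
    ⟨fun t => if t ≤ i then f t else f (t + (j - i)), fun t ht => ?_, by simpa using h0, ?_⟩
  · rcases lt_trichotomy t i with h | rfl | h
    · have := hf t (by omega)
      simpa [h.le, Nat.succ_le_of_lt h] using this
    · have := hf j (by omega)
      simp only [le_refl, if_true, e]
      rw [if_neg (by omega)]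
      have e' : t + 1 + (j - t) = j + 1 := by omega
      rwa [e']
    · have := hf (t + (j - i)) (by omega)
      simp only [if_neg (by omega : ¬t ≤ i), if_neg (by omega : ¬t + 1 ≤ i)]
      have e' : t + 1 + (j - i) = t + (j - i) + 1 := by omega
      rwa [e']
  · simp only
    split_ifs with h
    · have h1 : n - (j - i) = i := by omega
      have h2 : n = j := by omega
      rw [h1, e, ← h2, hn]
    · rw [← hn]
      congr 1
      omega

theorem reach_iff {i a b : ℕ} (ha : a < M) (hb : b < M) (hM : M ≤ 2 ^ i) :
    reach R M i a b ↔ Relation.ReflTransGen (fun u v => v < M ∧ R u v) a b := by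
  refine ⟨reach_sound hb, fun h => ?_⟩
  obtain ⟨n, hn, f, hf, rfl, rfl⟩ := exists_short_walk ha h
  exact reach_of_walk ha hf (by omega)

end

/-! ### The bisection program -/

/-- The state of the program with `cur` still to be decided. -/
def callState (a b L K x : Tr) : Tr := .node two (.node (.node a (.node b L)) (.node K x))

/-- The state of the program with the result `v`. -/
def retState (v K x : Tr) : Tr := .node .nil (.node v (.node K x))

/-- The remaining work on the question whether `b` can be reached from `a` through `c`. -/
def frame (a b L c ph : Tr) : Tr := .node (.node a (.node b L)) (.node c ph)

variable (R : Tr → Prop)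

/-- The length of `L = cur.snd.snd` is the remaining depth; `K` is the stack of frames and `x` the
constant parameter. At depth zero the relation is tested directly, otherwise the midpoint 0 is tried
first. -/
noncomputable def callStep (cur K x : Tr) : Tr :=
  if cur.snd.snd = .nil then
    retState (tt (cur.fst = cur.snd.fst ∨ R (.node cur.fst (.node cur.snd.fst x)))) K x
  else callState cur.fst .nil cur.snd.snd.snd
    (.node (frame cur.fst cur.snd.fst cur.snd.snd.snd .nil .nil) K) x

/-- The phase `fr.snd.snd` is `nil` while the half from `a` to the midpoint is examined, and `two`
for the half from there to `b`. A failure in either phase moves on to the next midpoint or, after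
the last one, fails. -/
noncomputable def retStep (v fr K x : Tr) : Tr :=
  if v = .nil then
    if val (succ fr.snd.fst) < val x.fst then
      callState fr.fst.fst (succ fr.snd.fst) fr.fst.snd.snd (.node (frame fr.fst.fst fr.fst.snd.fst
        fr.fst.snd.snd (succ fr.snd.fst) .nil) K) x
    else retState .nil K x
  else if fr.snd.snd = .nil then
    callState fr.snd.fst fr.fst.snd.fst fr.fst.snd.snd (.node (frame fr.fst.fst fr.fst.snd.fst
      fr.fst.snd.snd fr.snd.fst two) K) x
  else retState two K x

noncomputable def bisectStep (s : Tr) : Tr :=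
  if s.fst = .nil then retStep s.snd.fst s.snd.snd.fst.fst s.snd.snd.fst.snd s.snd.snd.snd
  else callStep R s.snd.fst s.snd.snd.fst s.snd.snd.snd

def Unfinished (s : Tr) : Prop := ¬(s.fst = .nil ∧ s.snd.snd.fst = .nil)

theorem lin_bisectStep (hR : LinP R) : Lin (bisectStep R) := by
  unfold bisectStep retStep callStep callState retState frame
  fun_prop

theorem linP_unfinished : LinP Unfinished := by
  unfold Unfinished
  fun_prop

variable {R} {B N : ℕ} {x y : Tr}

theorem whileTo_ret_false (hN : ∀ n ≤ val x.fst, (num n).size ≤ N) {a b c : ℕ} {L ph K : Tr}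
    (ha : a < val x.fst) (hb : b < val x.fst) (hc : c < val x.fst) (hL : L.size ≤ N)
    (hp : ph.size ≤ 3) (hB : K.size + x.size + 10 * N + 30 ≤ B)
    (h : WhileTo Unfinished (bisectStep R) B (if c + 1 < val x.fst then
      callState (num a) (num (c + 1)) L (.node (frame (num a) (num b) L (num (c + 1)) .nil) K) x
      else retState .nil K x) y) :
    WhileTo Unfinished (bisectStep R) B
      (retState .nil (.node (frame (num a) (num b) L (num c) ph) K) x) y := by
  have h1 := hN a ha.le
  have h2 := hN b hb.le
  have h3 := hN c hc.le
  refine .step (by simp [Unfinished, retState]) (by simp [retState, frame]; omega) ?_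
  convert h using 1
  simp [bisectStep, retStep, retState, callState, frame, num_succ]

theorem whileTo_ret_true (hN : ∀ n ≤ val x.fst, (num n).size ≤ N) {a b c : ℕ} {L ph K : Tr}
    (ha : a < val x.fst) (hb : b < val x.fst) (hc : c < val x.fst) (hL : L.size ≤ N)
    (hp : ph.size ≤ 3) (hB : K.size + x.size + 10 * N + 30 ≤ B)
    (h : WhileTo Unfinished (bisectStep R) B (if ph = .nil then
      callState (num c) (num b) L (.node (frame (num a) (num b) L (num c) two) K) x
      else retState two K x) y) :
    WhileTo Unfinished (bisectStep R) B
      (retState two (.node (frame (num a) (num b) L (num c) ph) K) x) y := by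
  have h1 := hN a ha.le
  have h2 := hN b hb.le
  have h3 := hN c hc.le
  refine .step (by simp [Unfinished, retState]) (by simp [retState, frame]; omega) ?_
  convert h using 1
  by_cases hph : ph = .nil <;> simp [bisectStep, retStep, retState, callState, frame, hph]

/-- The relation on numbers given by the predicate `R`. -/
def relOf (R : Tr → Prop) (x : Tr) (a b : ℕ) : Prop := R (.node (num a) (.node (num b) x))

/-- At each level only one frame of size `O(N)` is present, and it is reused for all midpoints and
both halves; hence space `(i + 1) * (10 * N + 30)` beyond the data. -/
theorem whileTo_call (hN : ∀ n ≤ val x.fst, (num n).size ≤ N) (h0 : 0 < val x.fst) (i : ℕ) :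
    ∀ {a b : ℕ} {L K : Tr}, len L = i → a < val x.fst → b < val x.fst → L.size ≤ N →
      K.size + x.size + (i + 1) * (10 * N + 30) ≤ B →
      WhileTo Unfinished (bisectStep R) B
        (retState (tt (reach (relOf R x) (val x.fst) i a b)) K x) y →
      WhileTo Unfinished (bisectStep R) B (callState (num a) (num b) L K x) y := by
  induction i with
  | zero =>
    intro a b L K hi ha hb hL hB h
    have h1 := hN a ha.le
    have h2 := hN b hb.le
    rcases L with _ | ⟨d, L⟩
    · refine .step (by simp [Unfinished, callState]) (by simp [callState] at hL ⊢; omega) ?_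
      convert h using 1
      simp [bisectStep, callStep, callState, reach, relOf, num_injective.eq_iff]
    · simp at hi
  | succ i ih =>
    intro a b L K hi ha hb hL hB h
    have h1 := hN a ha.le
    have h2 := hN b hb.le
    rcases L with _ | ⟨d, L⟩
    · simp at hi
    simp only [len_node, add_left_inj] at hi
    simp only [Tr.size_node] at hL
    have hB' : K.size + x.size + (i + 1) * (10 * N + 30) + (10 * N + 30) ≤ B := by
      rw [add_assoc, ← Nat.succ_mul]; exact hB
    have hfr : ∀ {c : ℕ} {ph : Tr}, c < val x.fst → ph.size ≤ 3 →
        (Tr.node (frame (num a) (num b) L (num c) ph) K).size + x.size + (i + 1) * (10 * N + 30) ≤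
          B := fun hc hp => by
      have := hN _ hc.le
      simp [frame]; omega
    refine .step (by simp [Unfinished, callState]) (by simp [callState]; omega) ?_
    -- Inner induction on the number `k` of midpoints not yet rejected.
    have key : ∀ k c, c < val x.fst → val x.fst - c = k →
        WhileTo Unfinished (bisectStep R) B (retState (tt (∃ c', c ≤ c' ∧ c' < val x.fst ∧
          reach (relOf R x) (val x.fst) i a c' ∧ reach (relOf R x) (val x.fst) i c' b)) K x) y →
        WhileTo Unfinished (bisectStep R) B (callState (num a) (num c) L
          (.node (frame (num a) (num b) L (num c) .nil) K) x) y := by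
      intro k
      induction k with
      | zero => intro c hc hk; omega
      | succ k ihk =>
        intro c hc hk hgoal
        have hfalse : ∀ ph : Tr, ph.size ≤ 3 → ¬(reach (relOf R x) (val x.fst) i a c ∧
            reach (relOf R x) (val x.fst) i c b) → WhileTo Unfinished (bisectStep R) B
              (retState .nil (.node (frame (num a) (num b) L (num c) ph) K) x) y := by
          intro ph hp hneg
          have hiff : (∃ c', c ≤ c' ∧ c' < val x.fst ∧ reach (relOf R x) (val x.fst) i a c' ∧
              reach (relOf R x) (val x.fst) i c' b) ↔
              ∃ c', c + 1 ≤ c' ∧ c' < val x.fst ∧ reach (relOf R x) (val x.fst) i a c' ∧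
              reach (relOf R x) (val x.fst) i c' b := by
            constructor
            · rintro ⟨c', h1, h2, h3⟩
              rcases h1.eq_or_lt with rfl | h1
              · exact absurd h3 hneg
              · exact ⟨c', h1, h2, h3⟩
            · rintro ⟨c', h1, h2⟩
              exact ⟨c', by omega, h2⟩
          rw [hiff] at hgoal
          refine whileTo_ret_false hN ha hb hc (by omega) hp (by nlinarith) ?_
          split_ifs with hlt
          · exact ihk _ hlt (by rw [← Nat.sub_sub, hk]; rfl) hgoal
          · rwa [tt_false] at hgoal
            rintro ⟨c', h1, h2, -⟩
            omega
        refine ih hi ha hc (by omega) (hfr hc (by simp)) ?_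
        by_cases hr1 : reach (relOf R x) (val x.fst) i a c
        · rw [tt_true hr1]
          refine whileTo_ret_true hN ha hb hc (by omega) (by simp) (by nlinarith) ?_
          rw [if_pos rfl]
          refine ih hi hc hb (by omega) (hfr hc (by simp)) ?_
          by_cases hr2 : reach (relOf R x) (val x.fst) i c b
          · rw [tt_true hr2]
            refine whileTo_ret_true hN ha hb hc (by omega) (by simp) (by nlinarith) ?_
            rw [if_neg (by simp)]
            rwa [tt_true ⟨c, le_rfl, hc, hr1, hr2⟩] at hgoal
          · rw [tt_false hr2]
            exact hfalse _ (by simp) (by tauto)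
        · rw [tt_false hr1]
          exact hfalse _ (by simp) (by tauto)
    have h3 : bisectStep R (callState (num a) (num b) (.node d L) K x) =
        callState (num a) (num 0) L (.node (frame (num a) (num b) L (num 0) .nil) K) x := by
      simp [bisectStep, callStep, callState]
    rw [h3]
    refine key _ 0 h0 rfl ?_
    simpa [reach] using h

/-- Deterministic simulation of reachability from `0` to `1` among the numbers below `2 ^ s - 1`. -/
theorem exists_ev_reach {R : Tr → Prop} (hR : LinP R) :
    ∃ C : ℕ, ∀ I : Type, ∃ F : Frag I Unit, ∀ (s : ℕ) (x : Tr), 2 ≤ s → x.fst = ones s →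
      Ev F x (tt (Relation.ReflTransGen (fun a b => b < val (ones s) ∧ relOf R x a b) 0 1))
        (C * (x.size + (s + 1) ^ 2)) := by
  obtain ⟨C, hC⟩ := exists_ev_while linP_unfinished (lin_bisectStep R hR)
  obtain ⟨D, hD⟩ : Lin fun x => callState (num 0) (num 1) x.fst .nil x := by
    unfold callState
    fun_prop
  obtain ⟨E, hE⟩ : Lin fun x => x.snd.fst := by fun_prop
  refine ⟨D + C * 200 + E * 200, fun I => ?_⟩
  obtain ⟨F, hF⟩ := hC I
  obtain ⟨G, hG⟩ := hD I
  obtain ⟨H, hH⟩ := hE I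
  refine ⟨Frag.seq G (Frag.seq F H), fun s x hs hx => ?_⟩
  have hv : 3 ≤ val x.fst := by
    have := val_ones s
    have := Nat.pow_le_pow_right (n := 2) (by norm_num) hs
    rw [hx]; omega
  set p : Prop := Relation.ReflTransGen (fun a b => b < val (ones s) ∧ relOf R x a b) 0 1
  have hp : reach (relOf R x) (val x.fst) s 0 1 ↔ p := by
    rw [hx]
    rw [hx] at hv
    exact reach_iff (by omega) (by omega) (by have := val_ones s; omega)
  have hsize : (retState (tt p) .nil x).size ≤ 200 * (x.size + (s + 1) ^ 2) := by
    have := size_tt_le p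
    simp [retState]
    nlinarith [x.size_pos]
  have hw : WhileTo Unfinished (bisectStep R) (200 * (x.size + (s + 1) ^ 2))
      (callState (num 0) (num 1) x.fst .nil x) (retState (tt p) .nil x) := by
    -- `8 * s + 5 = 4 * (2 * s + 1) + 1` is the bound of `size_num_le_of_le` for numbers up to `val
    -- (ones s)`.
    refine whileTo_call (N := 8 * s + 5) (fun n hn => ?_) (by omega) s (by rw [hx, len_ones])
      (by omega) (by omega) (by rw [hx, size_ones]; omega) (by simp; nlinarith [x.size_pos]) ?_
    · have := size_num_le_of_le hn
      rw [hx, size_ones] at this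
      omega
    · rw [hp]
      exact .done (by simp [Unfinished, retState]) hsize
  refine Ev.seq ((hG x).mono ?_) (Ev.seq ((hF _ _ _ hw).mono ?_) ((hH _).mono ?_))
  · nlinarith [Nat.zero_le (D * (s + 1) ^ 2), Nat.zero_le ((C * 200 + E * 200) * (x.size + (s + 1) ^ 2))]
  · nlinarith [Nat.zero_le ((D + E * 200) * (x.size + (s + 1) ^ 2))]
  · have := Nat.mul_le_mul_left E hsize
    nlinarith [Nat.zero_le ((D + C * 200) * (x.size + (s + 1) ^ 2))]

end LinSpace

/-! ### Survivability as reachability, and the reduction to bounded timestamps. -/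

namespace TimedMSR

variable {Sg : Alphabet}

/-! ### Lazy reachability -/

def Applicable (A : System Sg) (S : Config Sg) : Prop := ∃ r ∈ A, ∃ S', r.Step S S'

def Config.tick (S : Config Sg) : Config Sg := ⟨S.time + 1, S.facts⟩

/-- One step under the lazy time sampling. -/
def LazyStep (A : System Sg) (S S' : Config Sg) : Prop :=
  (∃ r ∈ A, r.Step S S') ∨ (¬Applicable A S ∧ S' = S.tick)

def LazyReach (A : System Sg) : Config Sg → Config Sg → Prop := Relation.ReflTransGen (LazyStep A)

theorem Rule.Step.time_eq {r : Rule Sg} {S S' : Config Sg} (h : r.Step S S') :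
    S'.time = S.time := by
  obtain ⟨_, _, _, _, _, _, h, _⟩ := h
  exact h

/-- A tick is possible exactly when no rule is, so there are no dead ends and each finite lazy run
extends to an infinite trace. -/
theorem exists_lazyStep (A : System Sg) (S : Config Sg) : ∃ S', LazyStep A S S' := by
  by_cases h : Applicable A S
  · obtain ⟨r, hr, S', h⟩ := h
    exact ⟨S', .inl ⟨r, hr, h⟩⟩
  · exact ⟨_, .inr ⟨h, rfl⟩⟩

theorem lazyTrace_iff {A : System Sg} {S₀ : Config Sg} {P : ℕ → Config Sg} :
    LazyTrace A S₀ P ↔ P 0 = S₀ ∧ ∀ i, LazyStep A (P i) (P (i + 1)) := by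
  constructor
  · rintro ⟨h0, h1, h2⟩
    refine ⟨h0, fun i => ?_⟩
    rcases h1 i with h | h
    · exact .inr ⟨h2 i h, h⟩
    · exact .inl h
  · rintro ⟨h0, h⟩
    refine ⟨h0, fun i => ?_, fun i hi => ?_⟩
    · rcases h i with h | h
      · exact .inr h
      · exact .inl h.2
    · rcases h i with ⟨r, _, h⟩ | h
      · have h1 := h.time_eq
        rw [hi] at h1
        simp at h1
      · exact h.1

theorem exists_lazyTrace (A : System Sg) (S : Config Sg) : ∃ P, LazyTrace A S P := by
  choose f hf using exists_lazyStep A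
  refine ⟨fun n => f^[n] S, lazyTrace_iff.2 ⟨rfl, fun i => ?_⟩⟩
  rw [Function.iterate_succ_apply']
  exact hf _

theorem LazyTrace.lazyReach {A : System Sg} {S₀ : Config Sg} {P : ℕ → Config Sg}
    (h : LazyTrace A S₀ P) (i : ℕ) : LazyReach A S₀ (P i) := by
  rw [lazyTrace_iff] at h
  induction i with
  | zero => rw [h.1]; exact .refl
  | succ i ih => exact ih.tail (h.2 i)

theorem LazyReach.exists_lazyTrace {A : System Sg} {S₀ S : Config Sg} (h : LazyReach A S₀ S) :
    ∃ P i, LazyTrace A S₀ P ∧ P i = S := by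
  induction h using Relation.ReflTransGen.head_induction_on with
  | refl =>
    obtain ⟨P, hP⟩ := TimedMSR.exists_lazyTrace A S
    exact ⟨P, 0, hP, hP.1⟩
  | @head S₀ S₁ h1 _ ih =>
    obtain ⟨P, i, hP, rfl⟩ := ih
    rw [lazyTrace_iff] at hP
    refine ⟨fun n => n.casesOn S₀ P, i + 1, lazyTrace_iff.2 ⟨rfl, fun n => ?_⟩, rfl⟩
    rcases n with _ | n
    · change LazyStep A S₀ (P 0)
      rwa [hP.1]
    · exact hP.2 n

/-! ### Progress -/

theorem Rule.Step.card_eq {r : Rule Sg} (hr : r.created.length = r.consumed.length)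
    {S S' : Config Sg} (h : r.Step S S') : Multiset.card S'.facts = Multiset.card S.facts := by
  obtain ⟨σ, τ, rest, _, _, h1, _, h2⟩ := h
  rw [h1, h2]
  simp [instances, hr]

/-- The number of facts with a timestamp in the future. -/
def Config.numFuture (S : Config Sg) : ℕ := S.facts.countP fun F => S.time < F.2

/-- The guards `T ≥ T'` keep consumed facts out of the future, and some created fact has delay at
least 1. The side facts and the rest are unchanged. -/
theorem Rule.Step.numFuture_lt {A : System Sg} (hA : Progressive A) {r : Rule Sg} (hr : r ∈ A)
    {S S' : Config Sg} (h : r.Step S S') : S.numFuture < S'.numFuture := by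
  obtain ⟨σ, τ, rest, h0, hg, h1, ht, h2⟩ := h
  obtain ⟨⟨q, hq, hq1⟩, h4⟩ := hA.2 r hr
  unfold Config.numFuture
  rw [h1, h2, ht]
  simp only [Multiset.countP_add]
  have e1 : Multiset.countP (fun F => S.time < F.2) (instances σ τ r.consumed) = 0 := by
    rw [Multiset.countP_eq_zero]
    intro F hF
    simp only [instances, Multiset.mem_coe, List.mem_map] at hF
    obtain ⟨q, hq, rfl⟩ := hF
    have := hg _ (h4 q hq)
    simp only [Constraint.Holds, h0] at this
    simp only [not_lt]
    omega
  have e2 : 0 < Multiset.countP (fun F => S.time < F.2)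
      (↑(r.created.map fun q => (q.1.subst σ, S.time + q.2)) : Multiset (GroundFact Sg × ℕ)) := by
    rw [Multiset.countP_pos]
    refine ⟨(q.1.subst σ, S.time + q.2), ?_, ?_⟩
    · simp only [Multiset.mem_coe, List.mem_map]
      exact ⟨q, hq, rfl⟩
    · simp only
      omega
  omega

theorem LazyStep.card_eq {A : System Sg} (hA : Balanced A) {S S' : Config Sg}
    (h : LazyStep A S S') : Multiset.card S'.facts = Multiset.card S.facts := by
  rcases h with ⟨r, hr, h⟩ | ⟨-, rfl⟩
  · exact h.card_eq (hA r hr)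
  · rfl

theorem LazyReach.card_eq {A : System Sg} (hA : Balanced A) {S S' : Config Sg}
    (h : LazyReach A S S') : Multiset.card S'.facts = Multiset.card S.facts := by
  induction h with
  | refl => rfl
  | tail _ h ih => rw [h.card_eq hA, ih]

/-- If time stopped, all later steps would be instantaneous and the number of future facts would
grow forever, although the number of facts is constant. -/
theorem LazyTrace.timeDiverges {A : System Sg} (hA : Progressive A) {S₀ : Config Sg}
    {P : ℕ → Config Sg} (h : LazyTrace A S₀ P) : TimeDiverges P := by
  have hcard := fun i => (h.lazyReach i).card_eq hA.1
  rw [lazyTrace_iff] at h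
  have hmono : Monotone fun i => (P i).time := monotone_nat_of_le_succ fun i => by
    rcases h.2 i with ⟨r, _, h⟩ | h
    · exact h.time_eq.ge
    · simp [h.2, Config.tick]
  have hinc : ∀ i, ∃ j, (P i).time < (P j).time := by
    intro i
    by_contra hcon
    push Not at hcon
    have hconst : ∀ n, (P (i + n)).time = (P i).time := fun n =>
      le_antisymm (hcon _) (hmono (Nat.le_add_right _ _))
    have hgrow : ∀ n, n ≤ (P (i + n)).numFuture := by
      intro n
      induction n with
      | zero => exact Nat.zero_le _
      | succ n ih =>
        rcases h.2 (i + n) with ⟨r, hr, h⟩ | h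
        · exact ih.trans_lt (h.numFuture_lt hA hr)
        · have h1 := hconst (n + 1)
          rw [← add_assoc, h.2] at h1
          have h2 := hconst n
          simp only [Config.tick] at h1
          omega
    have h1 := hgrow (Multiset.card S₀.facts + 1)
    have h2 : (P (i + (Multiset.card S₀.facts + 1))).numFuture ≤ _ := Multiset.countP_le_card _ _
    rw [hcard] at h2
    omega
  refine Filter.tendsto_atTop_atTop_of_monotone hmono fun b => ?_
  induction b with
  | zero => exact ⟨0, Nat.zero_le _⟩
  | succ b ih =>
    obtain ⟨i, hi⟩ := ih
    obtain ⟨j, hj⟩ := hinc i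
    exact ⟨j, by omega⟩

/-- Divergence of time is automatic and lazy traces exist, so realizability and survivability reduce
to compliance of every lazy trace, that is, of every reachable configuration. -/
theorem survivable_iff {A : System Sg} (hA : Progressive A) (CS : CriticalSpec Sg)
    (S₀ : Config Sg) : Survivable A CS S₀ ↔ ∀ S, LazyReach A S₀ S → ¬Critical CS S := by
  constructor
  · rintro ⟨-, h⟩ S hS
    obtain ⟨P, i, hP, rfl⟩ := hS.exists_lazyTrace
    exact (h P hP).1 i
  · intro h
    have key : ∀ P, LazyTrace A S₀ P → Compliant CS P ∧ TimeDiverges P := fun P hP =>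
      ⟨fun i => h _ (hP.lazyReach i), hP.timeDiverges hA⟩
    obtain ⟨P, hP⟩ := exists_lazyTrace A S₀
    exact ⟨⟨P, hP, key P hP⟩, key⟩

theorem FactsBounded.size_le {A : System Sg} {S₀ : Config Sg} {k : ℕ} (h : FactsBounded A S₀ k)
    {S : Config Sg} (hS : LazyReach A S₀ S) {F : GroundFact Sg × ℕ} (hF : F ∈ S.facts) :
    F.1.size ≤ k := by
  obtain ⟨P, i, hP, rfl⟩ := hS.exists_lazyTrace
  exact h P hP i F hF

/-! ### Changes of the timestamps that no rule can notice -/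

def Config.mapTime (φ : ℕ → ℕ) (S : Config Sg) : Config Sg :=
  ⟨φ S.time, S.facts.map fun F => (F.1, φ F.2)⟩

/-- The timestamps that matter in `S` and in its successors. -/
def Config.Relevant (S : Config Sg) (t : ℕ) : Prop := S.time ≤ t ∨ ∃ F ∈ S.facts, F.2 = t

/-- `φ` changes differences of timestamps only if they are larger than `D`. -/
structure Faithful (D : ℕ) (φ : ℕ → ℕ) (S : Config Sg) : Prop where
  add : ∀ d, φ (S.time + d) = φ S.time + d
  le_iff : ∀ t u, S.Relevant t → S.Relevant u → ∀ N : ℤ, N.natAbs ≤ D →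
    ((u : ℤ) + N ≤ t ↔ (φ u : ℤ) + N ≤ φ t)

variable {D : ℕ} {φ ψ : ℕ → ℕ} {S S' : Config Sg}

theorem Faithful.le_iff_le (h : Faithful D φ S) {t u : ℕ} (ht : S.Relevant t) (hu : S.Relevant u) :
    u ≤ t ↔ φ u ≤ φ t := by
  have := h.le_iff t u ht hu 0 (Nat.zero_le _)
  simpa using this

theorem Faithful.eq_of_eq (h : Faithful D φ S) {t u : ℕ} (ht : S.Relevant t) (hu : S.Relevant u)
    (e : φ t = φ u) : t = u :=
  le_antisymm ((h.le_iff_le hu ht).2 e.le) ((h.le_iff_le ht hu).2 e.ge)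

theorem Config.relevant_time (S : Config Sg) : S.Relevant S.time := .inl le_rfl

theorem Faithful.id (D : ℕ) (S : Config Sg) : Faithful D id S :=
  ⟨fun _ => rfl, fun _ _ _ _ _ _ => Iff.rfl⟩

theorem Config.mapTime_id (S : Config Sg) : S.mapTime id = S := by
  simp [Config.mapTime]

theorem Config.mapTime_mapTime (S : Config Sg) : (S.mapTime φ).mapTime ψ = S.mapTime (ψ ∘ φ) := by
  simp [Config.mapTime]

theorem Config.mapTime_congr (h : ∀ t, S.Relevant t → φ t = ψ t) : S.mapTime φ = S.mapTime ψ := by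
  unfold Config.mapTime
  rw [h _ S.relevant_time, Multiset.map_congr rfl fun F hF => ?_]
  rw [h _ (.inr ⟨F, hF, rfl⟩)]

theorem Faithful.relevant (h : Faithful D φ S) {t : ℕ} (ht : S.Relevant t) :
    (S.mapTime φ).Relevant (φ t) := by
  rcases ht with ht | ⟨F, hF, rfl⟩
  · exact .inl ((h.le_iff_le (.inl ht) S.relevant_time).1 ht)
  · exact .inr ⟨(F.1, φ F.2), Multiset.mem_map_of_mem _ hF, rfl⟩

theorem Faithful.exists_relevant (h : Faithful D φ S) {t : ℕ} (ht : (S.mapTime φ).Relevant t) :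
    ∃ u, S.Relevant u ∧ φ u = t := by
  rcases ht with ht | ⟨F, hF, rfl⟩
  · refine ⟨S.time + (t - φ S.time), .inl (Nat.le_add_right _ _), ?_⟩
    rw [h.add]
    exact Nat.add_sub_of_le ht
  · obtain ⟨G, hG, rfl⟩ := Multiset.mem_map.1 hF
    exact ⟨G.2, .inr ⟨G, hG, rfl⟩, rfl⟩

theorem Faithful.comp (h : Faithful D φ S) (h' : Faithful D ψ (S.mapTime φ)) :
    Faithful D (ψ ∘ φ) S := by
  refine ⟨fun d => ?_, fun t u ht hu N hN => ?_⟩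
  · simp only [Function.comp_apply, h.add]
    exact h'.add d
  · exact (h.le_iff t u ht hu N hN).trans
      (h'.le_iff _ _ (h.relevant ht) (h.relevant hu) N hN)

theorem Faithful.of_relevant (h : Faithful D φ S) (hS : ∀ t, S'.Relevant t → S.Relevant t)
    (ht : S.time ≤ S'.time) : Faithful D φ S' := by
  refine ⟨fun d => ?_, fun t u ht hu => h.le_iff t u (hS _ ht) (hS _ hu)⟩
  obtain ⟨e, he⟩ := Nat.exists_eq_add_of_le ht
  rw [he, add_assoc, h.add, h.add, add_assoc]

/-- A faithful map is injective on relevant timestamps (take `N = 0`). Its inverse is faithful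
again, and this turns simulation into bisimulation. -/
theorem Faithful.exists_inverse (h : Faithful D φ S) :
    ∃ ψ, Faithful D ψ (S.mapTime φ) ∧ (∀ t, S.Relevant t → ψ (φ t) = t) ∧
      ∀ t, (S.mapTime φ).Relevant t → φ (ψ t) = t := by
  classical
  obtain ⟨ψ, hψ⟩ : ∃ ψ : ℕ → ℕ, ∀ t, S.Relevant t → ψ (φ t) = t := by
    refine ⟨fun t => if h : ∃ u, S.Relevant u ∧ φ u = t then h.choose else 0, fun t ht => ?_⟩
    have hex : ∃ u, S.Relevant u ∧ φ u = φ t := ⟨t, ht, rfl⟩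
    simp only [hex, dif_pos]
    exact h.eq_of_eq hex.choose_spec.1 ht hex.choose_spec.2
  refine ⟨ψ, ⟨fun d => ?_, fun t u ht hu N hN => ?_⟩, hψ, fun t ht => ?_⟩
  · change ψ (φ S.time + d) = ψ (φ S.time) + d
    rw [← h.add, hψ _ (.inl (Nat.le_add_right _ _)), hψ _ S.relevant_time]
  · obtain ⟨t, ht', rfl⟩ := h.exists_relevant ht
    obtain ⟨u, hu', rfl⟩ := h.exists_relevant hu
    rw [hψ _ ‹_›, hψ _ ‹_›]
    exact (h.le_iff t u ht' hu' N hN).symm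
  · obtain ⟨t, ht', rfl⟩ := h.exists_relevant ht
    rw [hψ t ht']

theorem Faithful.holds_iff (h : Faithful D φ S) {τ : TimeVar → ℕ} {c : Constraint}
    (hc : c.offset.natAbs ≤ D) (hl : S.Relevant (τ c.left)) (hr : S.Relevant (τ c.right)) :
    c.Holds (φ ∘ τ) ↔ c.Holds τ := by
  have h1 := h.le_iff _ _ hl hr c.offset hc
  have h2 := h.le_iff _ _ hr hl (-c.offset) (by rwa [Int.natAbs_neg])
  unfold Constraint.Holds
  rcases c.rel <;> simp only [Function.comp_apply] <;> omega

theorem map_instances {n : Sg.Srt → ℕ} (σ : GroundSubst Sg (Vars Sg n)) (τ : TimeVar → ℕ)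
    (L : List (TimedPattern Sg n)) (φ : ℕ → ℕ) :
    (instances σ τ L).map (fun F => (F.1, φ F.2)) = instances σ (φ ∘ τ) L := by
  simp [instances, Function.comp_def]

theorem mem_instances {n : Sg.Srt → ℕ} (σ : GroundSubst Sg (Vars Sg n)) (τ : TimeVar → ℕ)
    {L : List (TimedPattern Sg n)} {q : TimedPattern Sg n} (hq : q ∈ L) :
    (q.1.subst σ, τ q.2) ∈ instances σ τ L := by
  simp only [instances, Multiset.mem_coe, List.mem_map]
  exact ⟨q, hq, rfl⟩

theorem Rule.Step.relevant {r : Rule Sg} (h : r.Step S S') {t : ℕ} (ht : S'.Relevant t) :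
    S.Relevant t := by
  obtain ⟨σ, τ, rest, _, _, h1, h3, h2⟩ := h
  rcases ht with ht | ⟨F, hF, rfl⟩
  · exact .inl (h3 ▸ ht)
  · rw [h2] at hF
    simp only [Multiset.mem_add, Multiset.mem_coe, List.mem_map] at hF
    rcases hF with (hF | ⟨q, _, rfl⟩) | hF
    · exact .inr ⟨F, by simp [h1, hF], rfl⟩
    · exact .inl (Nat.le_add_right _ _)
    · exact .inr ⟨F, by simp [h1, hF], rfl⟩

/-- By `guard_vars` the guard speaks only of timestamps present in `S`, where `φ` preserves all
comparisons with offset at most `D`; created timestamps are shifted correctly because `φ` is a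
translation from the current time on. -/
theorem Rule.Step.mapTime {r : Rule Sg} (hr : ∀ c ∈ r.guard, c.offset.natAbs ≤ D)
    (h : r.Step S S') (hφ : Faithful D φ S) : r.Step (S.mapTime φ) (S'.mapTime φ) := by
  obtain ⟨σ, τ, rest, h0, hg, h1, ht, h2⟩ := h
  refine ⟨σ, φ ∘ τ, rest.map fun F => (F.1, φ F.2), congrArg φ h0, fun c hc => ?_, ?_,
    congrArg φ ht, ?_⟩
  · have hrel : ∀ x ∈ [c.left, c.right], S.Relevant (τ x) := by
      intro x hx
      rcases r.guard_vars c hc x hx with rfl | ⟨q, hq, rfl⟩ | ⟨q, hq, rfl⟩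
      · exact h0 ▸ S.relevant_time
      · exact .inr ⟨_, by rw [h1, Multiset.mem_add, Multiset.mem_add]
                          exact .inl (.inl (mem_instances σ τ hq)), rfl⟩
      · exact .inr ⟨_, by rw [h1, Multiset.mem_add, Multiset.mem_add]
                          exact .inl (.inr (mem_instances σ τ hq)), rfl⟩
    exact (hφ.holds_iff (hr c hc) (hrel _ (by simp)) (hrel _ (by simp))).2 (hg c hc)
  · simp only [Config.mapTime, h1, Multiset.map_add, map_instances]
  · simp only [Config.mapTime, h2, Multiset.map_add, map_instances, Multiset.map_coe,
      List.map_map, Function.comp_def, hφ.add]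

theorem Faithful.mapTime_inverse (h : ∀ t, S.Relevant t → ψ (φ t) = t) :
    (S.mapTime φ).mapTime ψ = S := by
  rw [Config.mapTime_mapTime, Config.mapTime_congr (φ := ψ ∘ φ) (ψ := _root_.id) h, Config.mapTime_id]

theorem Rule.Step.of_mapTime {r : Rule Sg} (hr : ∀ c ∈ r.guard, c.offset.natAbs ≤ D)
    (hφ : Faithful D φ S) {X : Config Sg} (h : r.Step (S.mapTime φ) X) :
    ∃ S', r.Step S S' ∧ X = S'.mapTime φ := by
  obtain ⟨ψ, hψ, h1, h2⟩ := hφ.exists_inverse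
  have := h.mapTime hr hψ
  rw [Faithful.mapTime_inverse h1] at this
  exact ⟨_, this, (Faithful.mapTime_inverse fun t ht => h2 t (h.relevant ht)).symm⟩

theorem applicable_mapTime {A : System Sg} (hA : ∀ r ∈ A, ∀ c ∈ r.guard, c.offset.natAbs ≤ D)
    (hφ : Faithful D φ S) : Applicable A (S.mapTime φ) ↔ Applicable A S := by
  constructor
  · rintro ⟨r, hr, X, h⟩
    obtain ⟨S', h, -⟩ := h.of_mapTime (hA r hr) hφ
    exact ⟨r, hr, S', h⟩
  · rintro ⟨r, hr, X, h⟩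
    exact ⟨r, hr, _, h.mapTime (hA r hr) hφ⟩

theorem CriticalPair.Matches.mapTime {P : CriticalPair Sg}
    (hP : ∀ c ∈ P.constraints, c.offset.natAbs ≤ D) (hφ : Faithful D φ S) (h : P.Matches S) :
    P.Matches (S.mapTime φ) := by
  obtain ⟨σ, τ, h0, h1, h2⟩ := h
  refine ⟨σ, φ ∘ τ, fun x hx => congrArg φ (h0 x hx), ?_, fun c hc => ?_⟩
  · rw [← map_instances]
    exact Multiset.map_le_map h1
  · have hrel : ∀ x ∈ [c.left, c.right], S.Relevant (τ x) := by
      intro x hx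
      rcases P.constraint_vars c hc x hx with hx | ⟨q, hq, rfl⟩
      · exact h0 x hx ▸ S.relevant_time
      · exact .inr ⟨_, Multiset.mem_of_le h1 (mem_instances σ τ hq), rfl⟩
    exact (hφ.holds_iff (hP c hc) (hrel _ (by simp)) (hrel _ (by simp))).2 (h2 c hc)

theorem critical_mapTime {CS : CriticalSpec Sg}
    (hC : ∀ P ∈ CS, ∀ c ∈ P.constraints, c.offset.natAbs ≤ D) (hφ : Faithful D φ S) :
    Critical CS (S.mapTime φ) ↔ Critical CS S := by
  constructor
  · rintro ⟨P, hP, h⟩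
    obtain ⟨ψ, hψ, h1, -⟩ := hφ.exists_inverse
    have := h.mapTime (hC P hP) hψ
    rw [Faithful.mapTime_inverse h1] at this
    exact ⟨P, hP, this⟩
  · rintro ⟨P, hP, h⟩
    exact ⟨P, hP, h.mapTime (hC P hP) hφ⟩

/-! ### Runs in which unused intervals of time are cut out -/

/-- Removes the instant after `v`. -/
def dec (v t : ℕ) : ℕ := if t ≤ v then t else t - 1

/-- No timestamp lies in the interval `(v, v + D + 1]` of the past. -/
def Gap (D : ℕ) (S : Config Sg) (v : ℕ) : Prop :=
  (v = 0 ∨ ∃ F ∈ S.facts, F.2 = v) ∧ v + D + 1 < S.time ∧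
    ∀ F ∈ S.facts, F.2 ≤ v ∨ v + D + 1 < F.2

/-- Timestamps on opposite sides of the gap differ by at least `D + 2`, and by at least `D + 1`
after the cut, so no offset of absolute value at most `D` can tell. Pairs on the same side keep
their difference. -/
theorem Gap.faithful {v : ℕ} (h : Gap D S v) : Faithful D (dec v) S := by
  obtain ⟨-, h1, h2⟩ := h
  have hrel : ∀ t, S.Relevant t → t ≤ v ∨ v + D + 1 < t := by
    rintro t (ht | ⟨F, hF, rfl⟩)
    · exact .inr (h1.trans_le ht)
    · exact h2 F hF
  refine ⟨fun d => ?_, fun t u ht hu N hN => ?_⟩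
  · unfold dec
    split_ifs <;> omega
  · have ht := hrel t ht
    have hu := hrel u hu
    unfold dec
    split_ifs <;> omega

open Finset in
-- Without gaps, the intervals of length `D + 1` that start at 0 or at a timestamp cover all
-- instants before the current time. There are at most `S.numFacts` of them, 0 taking the place of
-- `Time`.
theorem time_le_of_not_gap (h : ¬∃ v, Gap D S v) : S.time ≤ S.numFacts * (D + 1) := by
  classical
  set X : Finset ℕ := insert 0 (S.facts.map Prod.snd).toFinset with hX
  have hcard : #X ≤ S.numFacts := by
    refine (card_insert_le _ _).trans ?_
    have := Multiset.toFinset_card_le (S.facts.map Prod.snd)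
    simp only [Multiset.card_map] at this
    unfold Config.numFacts
    omega
  have hcover : range S.time ⊆ X.biUnion fun v => Ico v (v + (D + 1)) := by
    intro t ht
    rw [mem_range] at ht
    have hne : (X.filter (· ≤ t)).Nonempty := ⟨0, by simp [hX]⟩
    obtain ⟨v, hv, hmax⟩ := (X.filter (· ≤ t)).exists_max_image _root_.id hne
    simp only [mem_filter, id_eq] at hv hmax
    -- The last starting point `v ≤ t` covers `t`; otherwise `v` would be a gap.
    refine mem_biUnion.2 ⟨v, hv.1, mem_Ico.2 ⟨hv.2, ?_⟩⟩
    by_contra hcon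
    apply h
    refine ⟨v, ?_, by omega, fun F hF => ?_⟩
    · have := hv.1
      simp only [hX, mem_insert, Multiset.mem_toFinset, Multiset.mem_map] at this
      exact this
    · by_contra hF2
      have := hmax F.2 ⟨?_, by omega⟩
      · omega
      · simp only [hX, mem_insert, Multiset.mem_toFinset, Multiset.mem_map]
        exact .inr ⟨F, hF, rfl⟩
  have := (card_le_card hcover).trans card_biUnion_le
  simp only [card_range, Nat.card_Ico, Nat.add_sub_cancel_left, sum_const, smul_eq_mul] at this
  exact this.trans (Nat.mul_le_mul_right _ hcard)

/-- A lazy step, where a tick is followed by cutting out one instant if this goes unnoticed. -/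
def CutStep (A : System Sg) (D : ℕ) (S S' : Config Sg) : Prop :=
  (∃ r ∈ A, r.Step S S') ∨ (¬Applicable A S ∧
    ((∃ v, Gap D S.tick v ∧ S' = S.tick.mapTime (dec v)) ∨
      ((¬∃ v, Gap D S.tick v) ∧ S' = S.tick)))

def CutReach (A : System Sg) (D : ℕ) : Config Sg → Config Sg → Prop :=
  Relation.ReflTransGen (CutStep A D)

theorem Faithful.tick (h : Faithful D φ S) : Faithful D φ S.tick :=
  h.of_relevant (fun _ ht => ht.imp_left fun ht => (Nat.le_succ _).trans ht) (Nat.le_succ _)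

theorem Faithful.tick_mapTime (h : Faithful D φ S) : (S.mapTime φ).tick = S.tick.mapTime φ := by
  simp only [Config.tick, Config.mapTime, h.add]

/-- Invariant: the cut configuration is the image of a lazily reachable one under a faithful map,
and each cut is composed onto that map. -/
theorem CutReach.exists_lazyReach {A : System Sg} {S₀ : Config Sg}
    (hA : ∀ r ∈ A, ∀ c ∈ r.guard, c.offset.natAbs ≤ D) (h : CutReach A D S₀ S) :
    ∃ S' φ, LazyReach A S₀ S' ∧ Faithful D φ S' ∧ S = S'.mapTime φ := by
  induction h with
  | refl => exact ⟨S₀, _, .refl, .id D S₀, S₀.mapTime_id.symm⟩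
  | tail _ h ih =>
    obtain ⟨S', φ, h1, hφ, rfl⟩ := ih
    rcases h with ⟨r, hr, h⟩ | ⟨hna, h⟩
    · obtain ⟨S'', h2, rfl⟩ := h.of_mapTime (hA r hr) hφ
      exact ⟨S'', φ, h1.tail (.inl ⟨r, hr, h2⟩),
        hφ.of_relevant (fun _ => h2.relevant) h2.time_eq.ge, rfl⟩
    · rw [applicable_mapTime hA hφ] at hna
      have h2 : LazyReach A S₀ S'.tick := h1.tail (.inr ⟨hna, rfl⟩)
      rw [hφ.tick_mapTime] at h
      rcases h with ⟨v, hv, rfl⟩ | ⟨-, rfl⟩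
      · exact ⟨_, _, h2, hφ.tick.comp hv.faithful, Config.mapTime_mapTime _⟩
      · exact ⟨_, _, h2, hφ.tick, rfl⟩

theorem LazyReach.exists_cutReach {A : System Sg} {S₀ : Config Sg}
    (hA : ∀ r ∈ A, ∀ c ∈ r.guard, c.offset.natAbs ≤ D) (h : LazyReach A S₀ S) :
    ∃ φ, Faithful D φ S ∧ CutReach A D S₀ (S.mapTime φ) := by
  induction h with
  | refl => exact ⟨_, .id D S₀, by rw [S₀.mapTime_id]; exact .refl⟩
  | @tail S S' _ h ih =>
    obtain ⟨φ, hφ, h1⟩ := ih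
    rcases h with ⟨r, hr, h⟩ | ⟨hna, rfl⟩
    · exact ⟨φ, hφ.of_relevant (fun _ => h.relevant) h.time_eq.ge,
        h1.tail (.inl ⟨r, hr, h.mapTime (hA r hr) hφ⟩)⟩
    · rw [← applicable_mapTime hA hφ] at hna
      by_cases hv : ∃ v, Gap D (S.mapTime φ).tick v
      · obtain ⟨v, hv⟩ := hv
        have h2 := h1.tail (.inr ⟨hna, .inl ⟨v, hv, rfl⟩⟩)
        rw [hφ.tick_mapTime] at h2 hv
        rw [Config.mapTime_mapTime] at h2
        exact ⟨_, hφ.tick.comp hv.faithful, h2⟩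
      · have h2 := h1.tail (.inr ⟨hna, .inr ⟨hv, rfl⟩⟩)
        rw [hφ.tick_mapTime] at h2
        exact ⟨φ, hφ.tick, h2⟩

theorem survivable_iff_cutReach {A : System Sg} (hA : Progressive A) {CS : CriticalSpec Sg}
    (hA' : ∀ r ∈ A, ∀ c ∈ r.guard, c.offset.natAbs ≤ D)
    (hC : ∀ P ∈ CS, ∀ c ∈ P.constraints, c.offset.natAbs ≤ D) (S₀ : Config Sg) :
    Survivable A CS S₀ ↔ ∀ S, CutReach A D S₀ S → ¬Critical CS S := by
  rw [survivable_iff hA]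
  constructor
  · intro h S hS
    obtain ⟨S', φ, h1, hφ, rfl⟩ := hS.exists_lazyReach hA'
    rw [critical_mapTime hC hφ]
    exact h S' h1
  · intro h S hS
    obtain ⟨φ, hφ, h1⟩ := hS.exists_cutReach hA'
    rw [← critical_mapTime hC hφ]
    exact h _ h1

theorem CutReach.card_eq {A : System Sg} (hA : Balanced A) {S₀ : Config Sg}
    (h : CutReach A D S₀ S) : Multiset.card S.facts = Multiset.card S₀.facts := by
  induction h with
  | refl => rfl
  | tail _ h ih =>
    rcases h with ⟨r, hr, h⟩ | ⟨-, ⟨v, -, rfl⟩ | ⟨-, rfl⟩⟩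
    · rw [h.card_eq (hA r hr), ih]
    · simpa [Config.mapTime, Config.tick] using ih
    · exact ih

theorem CutReach.size_le {A : System Sg} {S₀ : Config Sg} {k : ℕ}
    (hA : ∀ r ∈ A, ∀ c ∈ r.guard, c.offset.natAbs ≤ D) (hk : FactsBounded A S₀ k)
    (h : CutReach A D S₀ S) {F : GroundFact Sg × ℕ} (hF : F ∈ S.facts) : F.1.size ≤ k := by
  obtain ⟨S', φ, h1, -, rfl⟩ := h.exists_lazyReach hA
  obtain ⟨G, hG, rfl⟩ := Multiset.mem_map.1 hF
  exact hk.size_le (F := G) h1 hG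

/-- A tick followed by a cut restores the old time, and a tick without a cut leaves a configuration
without gaps, to which `time_le_of_not_gap` applies. Created facts lie at most `D` ahead of the
clock. -/
theorem CutReach.time_le {A : System Sg} (hA : Balanced A)
    (hA' : ∀ r ∈ A, ∀ q ∈ r.created, q.2 ≤ D) {S₀ : Config Sg} {B : ℕ}
    (hB : S₀.numFacts * (D + 1) ≤ B) (h0 : S₀.time ≤ B) (h1 : ∀ F ∈ S₀.facts, F.2 ≤ B + D)
    (h : CutReach A D S₀ S) : S.time ≤ B ∧ ∀ F ∈ S.facts, F.2 ≤ B + D := by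
  induction h with
  | refl => exact ⟨h0, h1⟩
  | @tail S S' hr h ih =>
    obtain ⟨ih0, ih1⟩ := ih
    rcases h with ⟨r, hr, σ, τ, rest, _, _, h2, h3, h4⟩ | ⟨-, ⟨v, hv, rfl⟩ | ⟨hv, rfl⟩⟩
    · refine ⟨h3 ▸ ih0, fun F hF => ?_⟩
      rw [h4] at hF
      simp only [Multiset.mem_add, Multiset.mem_coe, List.mem_map] at hF
      rcases hF with (hF | ⟨q, hq, rfl⟩) | hF
      · exact ih1 F (by simp [h2, hF])
      · exact Nat.add_le_add ih0 (hA' r hr q hq)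
      · exact ih1 F (by simp [h2, hF])
    · have h2 := hv.2.1
      refine ⟨?_, fun F hF => ?_⟩
      · have e : S.tick.time = S.time + 1 := rfl
        change dec v S.tick.time ≤ B
        unfold dec
        split_ifs <;> omega
      · obtain ⟨G, hG, rfl⟩ := Multiset.mem_map.1 hF
        have := ih1 G hG
        simp only [dec]
        split_ifs <;> omega
    · refine ⟨(time_le_of_not_gap hv).trans ?_, ih1⟩
      have e : S.tick.numFacts = S₀.numFacts := by
        have := CutReach.card_eq hA hr
        simp [Config.numFacts, Config.tick, this]
      rwa [e]

end TimedMSR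

/-! ### Guessing environments and sub-multisets in linear space. -/

namespace LinSpace

open Classical

/-! ### More functions computable in linear space -/

/-- The bound on `g` must not involve `c`: paying for `c` at every entry would make the result
quadratic. -/
theorem size_mapTr_le {g : Tr → Tr} {C : ℕ} (hC : ∀ c a, (g (.node c a)).size ≤ C * a.size)
    (c t : Tr) : (mapTr g c t).size ≤ (C + 1) * t.size := by
  induction t with
  | nil => simp [mapTr]
  | node a r _ ih =>
    have := hC c a
    simp only [mapTr, Tr.size_node]
    nlinarith

theorem Lin.mapTr {g : Tr → Tr} (hg : Lin g) {C : ℕ}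
    (hC : ∀ c a, (g (.node c a)).size ≤ C * a.size) {f h : Tr → Tr} (hf : Lin f) (hh : Lin h) :
    Lin fun x => mapTr g (f x) (h x) := by
  have e : ∀ c t, LinSpace.mapTr g c t = LinSpace.listRec
      (fun x => .node (g (.node x.fst x.snd.fst)) x.snd.snd.snd) (fun _ => .nil) c t := by
    intro c t
    induction t with
    | nil => rfl
    | node a r _ ih => simp [LinSpace.mapTr, LinSpace.listRec, ih]
  simp only [e]
  refine Lin.listRec (C := C + 1) (by fun_prop) (by fun_prop) (fun c t => ?_) hf hh
  rw [← e]
  exact (size_mapTr_le hC c t).trans (Nat.mul_le_mul_left _ (Nat.le_add_left _ _))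

theorem ones_succ (n : ℕ) : Tr.node .nil (ones n) = ones (n + 1) := rfl

/-- The state is a stack of trees with a unary counter; every leaf or node taken from the stack adds
one, and these are exactly the symbols of the prefix code. -/
theorem whileTo_weigh {B : ℕ} {t S y : Tr} {n : ℕ} (h : 2 * t.size + S.size + 2 * n + 3 ≤ B)
    (hw : WhileTo (fun x => x.fst ≠ .nil) (fun x => .node (if x.fst.fst = .nil then x.fst.snd
      else .node x.fst.fst.fst (.node x.fst.fst.snd x.fst.snd)) (.node .nil x.snd)) B
      (.node S (ones (n + t.size))) y) :
    WhileTo (fun x => x.fst ≠ .nil) (fun x => .node (if x.fst.fst = .nil then x.fst.snd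
      else .node x.fst.fst.fst (.node x.fst.fst.snd x.fst.snd)) (.node .nil x.snd)) B
      (.node (.node t S) (ones n)) y := by
  have hsize : (Tr.node (.node t S) (ones n)).size ≤ B := by
    have := t.size_pos
    simp only [Tr.size_node, size_ones]
    omega
  induction t generalizing S n with
  | nil => exact .step (by simp) hsize (by simpa [ones_succ] using hw)
  | node a b iha ihb =>
    have := a.size_pos
    have := b.size_pos
    simp only [Tr.size_node, size_ones] at h hsize
    refine .step (by simp) (by simpa using hsize) ?_
    simp only [Tr.fst_node, Tr.snd_node, reduceCtorEq, if_false, ones_succ]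
    refine iha (by simp only [Tr.size_node]; omega) (ihb (by omega) ?_ (by simp; omega)) (by simp; omega)
    have e : n + 1 + a.size + b.size = n + (Tr.node a b).size := by simp; omega
    rwa [e]

@[fun_prop]
theorem Lin.onesSize {f : Tr → Tr} (hf : Lin f) : Lin fun x => ones (f x).size := by
  have h := Lin.while (i := fun x => .node (.node x .nil) .nil)
    (g := fun x => .node .nil (ones x.size)) (P := fun x => x.fst ≠ .nil)
    (f := fun x => .node (if x.fst.fst = .nil then x.fst.snd
      else .node x.fst.fst.fst (.node x.fst.fst.snd x.fst.snd)) (.node .nil x.snd))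
    (by fun_prop) (by fun_prop) (by fun_prop) 6 fun x => ?_
  · exact (h.snd.comp hf :)
  · have := x.size_pos
    refine whileTo_weigh (t := x) (S := .nil) (n := 0) (by simp; omega) ?_
    rw [Nat.zero_add]
    exact .done (by simp) (by simp; omega)

theorem ones_lt_iff {n s : ℕ} : val (ones n) < val (ones s) ↔ n < s := by
  have h1 := val_ones n
  have h2 := val_ones s
  have := Nat.pow_lt_pow_iff_right (a := 2) (n := n) (m := s) (by norm_num)
  omega

def get (i : ℕ) (t : Tr) : Tr := (Tr.snd^[i] t).fst

@[fun_prop]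
theorem Lin.get {f : Tr → Tr} (hf : Lin f) (i : ℕ) : Lin fun x => get i (f x) := by
  refine Lin.fst ?_
  induction i with
  | zero => exact hf
  | succ i ih =>
    simp only [Function.iterate_succ_apply']
    exact ih.snd

/-- The list of the values `e 0, …, e (N - 1)`. -/
def envTr (N : ℕ) (e : ℕ → Tr) : Tr := .ofList ((List.range N).map e)

theorem envTr_succ (N : ℕ) (e : ℕ → Tr) :
    envTr (N + 1) e = .node (e 0) (envTr N fun i => e (i + 1)) := by
  simp [envTr, List.range_succ_eq_map, Tr.ofList, Function.comp_def]

theorem get_envTr {N i : ℕ} (e : ℕ → Tr) (h : i < N) : get i (envTr N e) = e i := by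
  induction N generalizing e i with
  | zero => omega
  | succ N ih =>
    rw [envTr_succ]
    rcases i with _ | i
    · rfl
    · exact ih (fun i => e (i + 1)) (by omega)

/-- `t` has a name below `val M`. -/
def Small (M t : Tr) : Prop := ∃ n < val M, parse (num n) = t

theorem small_ones {t : Tr} {s : ℕ} (h : t.size < s) : Small (ones s) t :=
  ⟨index t, index_lt h, parse_index t⟩

theorem LinP.exists_small {Q : Tr → Prop} (hQ : LinP Q) {f g : Tr → Tr} (hf : Lin f) (hg : Lin g) :
    LinP fun x => ∃ t, Small (f x) t ∧ Q (.node t (g x)) := by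
  have h : LinP fun x => Q (.node (parse x.fst) x.snd) := by fun_prop
  refine (LinP.exists_lt h hf hg).of_iff fun x => ⟨?_, ?_⟩
  · rintro ⟨_, ⟨n, hn, rfl⟩, h⟩
    exact ⟨n, hn, h⟩
  · rintro ⟨n, hn, h⟩
    exact ⟨_, ⟨n, hn, rfl⟩, h⟩

/-- The number `N` of guessed trees is fixed in advance by the rule, so nesting `N` searches still
takes linear space. -/
theorem LinP.exists_env (N : ℕ) {Q : Tr → Prop} (hQ : LinP Q) {f g : Tr → Tr} (hf : Lin f)
    (hg : Lin g) :
    LinP fun x => ∃ e : ℕ → Tr, (∀ i < N, Small (f x) (e i)) ∧ Q (.node (envTr N e) (g x)) := by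
  induction N generalizing Q f g with
  | zero =>
    have h : LinP fun x => Q (.node .nil (g x)) := by fun_prop
    refine h.of_iff fun x => ⟨fun ⟨_, _, h⟩ => h, fun h => ⟨fun _ => .nil, by simp, h⟩⟩
  | succ N ih =>
    have h1 : LinP fun y => Q (.node (.node y.snd.fst y.fst) y.snd.snd.snd) := by fun_prop
    have h2 := ih h1 (f := fun z => z.snd.fst) (g := fun z => z) (by fun_prop) (by fun_prop)
    refine (LinP.exists_small h2 hf (hf.node hg)).of_iff fun x => ⟨?_, ?_⟩
    · rintro ⟨e, he, h⟩
      rw [envTr_succ] at h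
      exact ⟨e 0, he 0 (Nat.succ_pos _), fun i => e (i + 1),
        fun i hi => he _ (Nat.succ_lt_succ hi), h⟩
    · rintro ⟨t, ht, e, he, h⟩
      refine ⟨fun i => i.casesOn t e, ?_, ?_⟩
      · rintro (_ | i) hi
        · exact ht
        · exact he i (Nat.lt_of_succ_lt_succ hi)
      · rw [envTr_succ]
        exact h

/-- `R` is what remains of the list `l` when the entries of `L` are taken away. -/
def PickAll : List Tr → Tr → Tr → Prop
  | [], l, R => R = l
  | a :: L, l, R => ∃ R', Pick l a R' ∧ PickAll L R' R

theorem PickAll.coe_eq {L : List Tr} {l R : Tr} (h : PickAll L l R) :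
    (l.toList : Multiset Tr) = ↑L + (R.toList : Multiset Tr) := by
  induction L generalizing l with
  | nil => rw [show R = l from h]; simp
  | cons a L ih =>
    obtain ⟨R', h1, h2⟩ := h
    rw [h1.coe_eq, ih h2, ← Multiset.cons_coe, Multiset.cons_add]

theorem exists_pickAll {L : List Tr} {l : Tr} (h : (L : Multiset Tr) ≤ l.toList) :
    ∃ R, PickAll L l R := by
  induction L generalizing l with
  | nil => exact ⟨l, rfl⟩
  | cons a L ih =>
    rw [← Multiset.cons_coe] at h
    obtain ⟨R', h1⟩ := exists_pick (l := l) (a := a)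
      (Multiset.mem_coe.1 (Multiset.mem_of_le h (Multiset.mem_cons_self _ _)))
    rw [h1.coe_eq, Multiset.cons_le_cons_iff] at h
    obtain ⟨R, h2⟩ := ih h
    exact ⟨R, R', h1, h2⟩

theorem LinP.pickAll (as : List (Tr → Tr)) (has : ∀ a ∈ as, Lin a) {Q : Tr → Prop} (hQ : LinP Q)
    {f g : Tr → Tr} (hf : Lin f) (hg : Lin g) :
    LinP fun x => ∃ R, PickAll (as.map fun a => a (g x)) (f x) R ∧ Q (.node R (g x)) := by
  induction as generalizing f g Q with
  | nil =>
    have h : LinP fun x => Q (.node (f x) (g x)) := by fun_prop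
    exact h.of_iff fun x => ⟨fun ⟨_, h1, h2⟩ => h1 ▸ h2, fun h => ⟨_, rfl, h⟩⟩
  | cons a as ih =>
    have ha : Lin a := has a (by simp)
    have h1 := ih (fun a ha => has a (by simp [ha])) hQ (f := fun z => z.snd.fst)
      (g := fun z => z.snd.snd) (by fun_prop) (by fun_prop)
    have h2 : LinP fun z => z.fst = a z.snd.snd ∧ ∃ R, PickAll (as.map fun a => a z.snd.snd)
      z.snd.fst R ∧ Q (.node R z.snd.snd) := LinP.and (by fun_prop) h1
    refine (LinP.pick h2 hf hg).of_iff fun x => ⟨?_, ?_⟩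
    · rintro ⟨R, ⟨R', h3, h4⟩, h5⟩
      exact ⟨_, R', h3, rfl, R, h4, h5⟩
    · rintro ⟨b, R', h3, h6, R, h4, h5⟩
      obtain rfl : b = a (g x) := h6
      exact ⟨R, ⟨R', h3, h4⟩, h5⟩

def consAll (l : List Tr) (R : Tr) : Tr := l.foldr .node R

theorem toList_consAll (l : List Tr) (R : Tr) : (consAll l R).toList = l ++ R.toList := by
  induction l with
  | nil => rfl
  | cons a l ih => simpa [consAll, Tr.toList] using ih

theorem Lin.consAll {α : Type*} (l : List α) {a : α → Tr → Tr} (ha : ∀ i ∈ l, Lin (a i))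
    {f : Tr → Tr} (hf : Lin f) : Lin fun x => consAll (l.map fun i => a i x) (f x) := by
  induction l with
  | nil => exact hf
  | cons i l ih =>
    exact (ha i (by simp)).node (ih fun j hj => ha j (by simp [hj]))

theorem Lin.ofList {α : Type*} (l : List α) {a : α → Tr → Tr} (ha : ∀ i ∈ l, Lin (a i)) :
    Lin fun x => Tr.ofList (l.map fun i => a i x) := by
  induction l with
  | nil => exact Lin.const _
  | cons i l ih =>
    exact (ha i (by simp)).node (ih fun j hj => ha j (by simp [hj]))

theorem LinP.exists_finite {α : Type*} [Finite α] {P : α → Tr → Prop} (h : ∀ i, LinP (P i)) :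
    LinP fun x => ∃ i, P i x := by
  cases nonempty_fintype α
  refine (LinP.exists_list (Finset.univ : Finset α).toList (P := P) fun i _ => h i).of_iff fun x => ?_
  simp

end LinSpace

/-! ### Configurations as trees, and pattern matching. -/

namespace TimedMSR

open LinSpace Classical

variable {Sg : Alphabet} {V : Sg.Srt → Type}

/-! ### Occurrences of variables -/

def Term.Occurs (x : Σ s, V s) : {s : Sg.Srt} → Term Sg V s → Prop
  | s, .var y => x = ⟨s, y⟩
  | _, .app _ args => ∃ i, (args i).Occurs x

def Fact.Occurs (x : Σ s, V s) (F : Fact Sg V) : Prop := ∃ i, (F.args i).Occurs x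

theorem Term.subst_congr {σ σ' : GroundSubst Sg V} {s : Sg.Srt} (t : Term Sg V s)
    (h : ∀ s x, t.Occurs ⟨s, x⟩ → σ s x = σ' s x) : t.subst σ = t.subst σ' := by
  induction t with
  | var x => exact h _ x rfl
  | app f args ih =>
    simp only [Term.subst]
    congr 1
    funext i
    exact ih i fun s x hx => h s x ⟨i, hx⟩

theorem Fact.subst_congr {σ σ' : GroundSubst Sg V} (F : Fact Sg V)
    (h : ∀ s x, F.Occurs ⟨s, x⟩ → σ s x = σ' s x) : F.subst σ = F.subst σ' := by
  unfold Fact.subst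
  congr 1
  funext i
  exact (F.args i).subst_congr fun s x hx => h s x ⟨i, hx⟩

theorem Term.size_le_subst (σ : GroundSubst Sg V) {s s' : Sg.Srt} {x : V s} (t : Term Sg V s')
    (h : t.Occurs ⟨s, x⟩) : (σ s x).size ≤ (t.subst σ).size := by
  induction t with
  | var y => cases h; exact le_rfl
  | app f args ih =>
    obtain ⟨i, hi⟩ := h
    refine (ih i hi).trans ?_
    simp only [Term.subst, Term.size]
    exact (Finset.single_le_sum (f := fun i => ((args i).subst σ).size) (fun _ _ => Nat.zero_le _)
      (Finset.mem_univ i)).trans (Nat.le_add_left _ _)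

theorem Fact.size_le_subst (σ : GroundSubst Sg V) {s : Sg.Srt} {x : V s} (F : Fact Sg V)
    (h : F.Occurs ⟨s, x⟩) : (σ s x).size ≤ (F.subst σ).size := by
  obtain ⟨i, hi⟩ := h
  refine ((F.args i).size_le_subst σ hi).trans ?_
  simp only [Fact.subst, Fact.size]
  exact (Finset.single_le_sum (f := fun i => ((F.args i).subst σ).size) (fun _ _ => Nat.zero_le _)
    (Finset.mem_univ i)).trans (Nat.le_add_left _ _)

/-! ### Terms, facts and configurations as trees -/

noncomputable def fnTag (f : Sg.Fn) : Tr := num (Fintype.equivFin Sg.Fn f)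

noncomputable def predTag (p : Sg.Pred) : Tr := num (Fintype.equivFin Sg.Pred p)

theorem fnTag_injective : Function.Injective (fnTag (Sg := Sg)) := fun _ _ h =>
  (Fintype.equivFin Sg.Fn).injective (Fin.ext (num_injective h))

theorem predTag_injective : Function.Injective (predTag (Sg := Sg)) := fun _ _ h =>
  (Fintype.equivFin Sg.Pred).injective (Fin.ext (num_injective h))

/-- The tree of a term whose variables stand for the trees `h`. -/
noncomputable def Term.enc (h : (s : Sg.Srt) → V s → Tr) : {s : Sg.Srt} → Term Sg V s → Tr
  | s, .var x => h s x
  | _, .app f args => .node (fnTag f) (.ofList (List.ofFn fun i => (args i).enc h))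

noncomputable def Fact.enc (h : (s : Sg.Srt) → V s → Tr) (F : Fact Sg V) : Tr :=
  .node (predTag F.pred) (.ofList (List.ofFn fun i => (F.args i).enc h))

noncomputable def Term.tree {s : Sg.Srt} (t : GroundTerm Sg s) : Tr := t.enc fun _ x => x.elim

noncomputable def Fact.tree (F : GroundFact Sg) : Tr := F.enc fun _ x => x.elim

theorem Term.tree_subst (σ : GroundSubst Sg V) {s : Sg.Srt} (t : Term Sg V s) :
    (t.subst σ).tree = t.enc fun s x => (σ s x).tree := by
  induction t with
  | var x => rfl
  | app f args ih =>
    simp only [Term.tree] at ih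
    simp only [Term.tree, Term.subst, Term.enc, ih]

theorem Fact.tree_subst (σ : GroundSubst Sg V) (F : Fact Sg V) :
    (F.subst σ).tree = F.enc fun s x => (σ s x).tree := by
  have := fun i => (F.args i).tree_subst σ
  simp only [Term.tree] at this
  simp only [Fact.tree, Fact.subst, Fact.enc, Term.tree, this]

theorem ofList_ofFn_inj {n : ℕ} {f g : Fin n → Tr}
    (h : Tr.ofList (List.ofFn f) = Tr.ofList (List.ofFn g)) (i : Fin n) : f i = g i := by
  have h := congrArg Tr.toList h
  rw [Tr.toList_ofList, Tr.toList_ofList] at h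
  exact congrFun (List.ofFn_injective h) i

/-- A function tag determines the sorts of the arguments. So whenever a pattern filled with
arbitrary trees happens to equal the tree of a ground term, the fillings are themselves trees of
ground terms of the right sorts, and the program never has to check sorts. -/
theorem Term.exists_tree_of_enc {h : (s : Sg.Srt) → V s → Tr} {s : Sg.Srt} (p : Term Sg V s) :
    ∀ {s' : Sg.Srt} (t : GroundTerm Sg s'), s = s' → p.enc h = t.tree → ∀ {s x}, p.Occurs ⟨s, x⟩ →
      ∃ u : GroundTerm Sg s, h s x = u.tree := by
  induction p with
  | var y =>
    rintro s' t rfl e s x ⟨⟩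
    exact ⟨t, e⟩
  | app f args ih =>
    intro s' t _ e s x ⟨i, hi⟩
    cases t with
    | var x => exact x.elim
    | app g args' =>
      simp only [Term.tree, Term.enc, Tr.node.injEq] at e
      obtain ⟨e1, e2⟩ := e
      obtain rfl := fnTag_injective e1
      exact ih i (args' i) rfl (ofList_ofFn_inj e2 i) hi

theorem Fact.exists_tree_of_enc {h : (s : Sg.Srt) → V s → Tr} {F : Fact Sg V} {G : GroundFact Sg}
    (e : F.enc h = G.tree) {s : Sg.Srt} {x : V s} (hx : F.Occurs ⟨s, x⟩) :
    ∃ u : GroundTerm Sg s, h s x = u.tree := by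
  obtain ⟨p, args⟩ := F
  obtain ⟨q, args'⟩ := G
  simp only [Fact.tree, Fact.enc, Tr.node.injEq] at e
  obtain ⟨e1, e2⟩ := e
  obtain rfl := predTag_injective e1
  obtain ⟨i, hi⟩ := hx
  exact (args i).exists_tree_of_enc (args' i) rfl (ofList_ofFn_inj e2 i) hi

/-- The sort is not stored, but the tag at the root fixes it; heterogeneous equality lets the
induction pass through different sorts. -/
theorem Term.heq_of_tree {s : Sg.Srt} (t : GroundTerm Sg s) :
    ∀ {s' : Sg.Srt} (t' : GroundTerm Sg s'), t.tree = t'.tree → s = s' ∧ t ≍ t' := by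
  induction t with
  | var x => exact x.elim
  | app f args ih =>
    intro s' t' e
    cases t' with
    | var x => exact x.elim
    | app g args' =>
      simp only [Term.tree, Term.enc, Tr.node.injEq] at e
      obtain ⟨e1, e2⟩ := e
      obtain rfl := fnTag_injective e1
      have : args = args' := funext fun i => eq_of_heq (ih i _ (ofList_ofFn_inj e2 i)).2
      exact ⟨rfl, by rw [this]⟩

theorem Term.tree_injective {s : Sg.Srt} :
    Function.Injective (Term.tree : GroundTerm Sg s → Tr) := fun t t' h =>
  eq_of_heq (t.heq_of_tree t' h).2

theorem Fact.tree_injective : Function.Injective (Fact.tree : GroundFact Sg → Tr) := by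
  rintro ⟨p, args⟩ ⟨q, args'⟩ e
  simp only [Fact.tree, Fact.enc, Tr.node.injEq] at e
  obtain ⟨e1, e2⟩ := e
  obtain rfl := predTag_injective e1
  have : args = args' := funext fun i => Term.tree_injective (ofList_ofFn_inj e2 i)
  rw [this]

theorem size_le_ofList_ofFn {n : ℕ} (f : Fin n → Tr) (i : Fin n) :
    (f i).size ≤ (Tr.ofList (List.ofFn f)).size := by
  rw [Tr.size_ofList, List.map_ofFn, List.sum_ofFn]
  have := Finset.single_le_sum (f := fun i => (f i).size + 1) (fun _ _ => Nat.zero_le _)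
    (Finset.mem_univ i)
  simp only [Function.comp_apply]
  omega

theorem Term.size_le_enc {h : (s : Sg.Srt) → V s → Tr} {s s' : Sg.Srt} {x : V s} (t : Term Sg V s')
    (hx : t.Occurs ⟨s, x⟩) : (h s x).size ≤ (t.enc h).size := by
  induction t with
  | var y => cases hx; exact le_rfl
  | app f args ih =>
    obtain ⟨i, hi⟩ := hx
    have := size_le_ofList_ofFn (fun i => (args i).enc h) i
    have := ih i hi
    simp only [Term.enc, Tr.size_node]
    omega

theorem Fact.size_le_enc {h : (s : Sg.Srt) → V s → Tr} {s : Sg.Srt} {x : V s} (F : Fact Sg V)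
    (hx : F.Occurs ⟨s, x⟩) : (h s x).size ≤ (F.enc h).size := by
  obtain ⟨i, hi⟩ := hx
  have := size_le_ofList_ofFn (fun i => (F.args i).enc h) i
  have := (F.args i).size_le_enc (h := h) hi
  simp only [Fact.enc, Tr.size_node]
  omega

theorem exists_size_tag_le (Sg : Alphabet) :
    ∃ C, (∀ f : Sg.Fn, (fnTag f).size ≤ C) ∧ ∀ p : Sg.Pred, (predTag p).size ≤ C := by
  refine ⟨∑ f : Sg.Fn, (fnTag f).size + ∑ p : Sg.Pred, (predTag p).size, fun f => ?_, fun p => ?_⟩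
  · exact (Finset.single_le_sum (f := fun f : Sg.Fn => (fnTag f).size) (fun _ _ => Nat.zero_le _)
      (Finset.mem_univ f)).trans (Nat.le_add_right _ _)
  · exact (Finset.single_le_sum (f := fun f : Sg.Pred => (predTag f).size)
      (fun _ _ => Nat.zero_le _) (Finset.mem_univ p)).trans (Nat.le_add_left _ _)

theorem size_ofList_ofFn_le {n C : ℕ} {f : Fin n → Tr} {k : Fin n → ℕ}
    (h : ∀ i, (f i).size + 1 ≤ C * k i) :
    (Tr.ofList (List.ofFn f)).size ≤ 1 + C * ∑ i, k i := by
  rw [Tr.size_ofList, List.map_ofFn, List.sum_ofFn, Finset.mul_sum]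
  exact Nat.add_le_add_left (Finset.sum_le_sum fun i _ => h i) _

theorem exists_size_tree_le (Sg : Alphabet) :
    ∃ C, (∀ (s : Sg.Srt) (t : GroundTerm Sg s), t.tree.size ≤ C * t.size) ∧
      ∀ F : GroundFact Sg, F.tree.size ≤ C * F.size := by
  obtain ⟨C, h1, h2⟩ := exists_size_tag_le Sg
  -- The extra 1 pays for the list cell that holds the term as an argument.
  have key : ∀ (s : Sg.Srt) (t : GroundTerm Sg s), t.tree.size + 1 ≤ (C + 3) * t.size := by
    intro s t
    induction t with
    | var x => exact x.elim
    | app f args ih =>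
      have := size_ofList_ofFn_le ih
      have := h1 f
      simp only [Term.tree] at *
      simp only [Term.enc, Term.size, Tr.size_node, mul_add]
      omega
  refine ⟨C + 3, fun s t => (Nat.le_succ _).trans (key s t), fun F => ?_⟩
  have := size_ofList_ofFn_le fun i => key _ (F.args i)
  have := h2 F.pred
  simp only [Fact.tree, Fact.enc, Fact.size, Tr.size_node, mul_add, Term.tree] at *
  omega

noncomputable def entry (F : GroundFact Sg × ℕ) : Tr := .node F.1.tree (num F.2)

theorem entry_injective : Function.Injective (entry (Sg := Sg)) := by
  rintro ⟨F, t⟩ ⟨G, u⟩ h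
  simp only [entry, Tr.node.injEq] at h
  rw [Fact.tree_injective h.1, num_injective h.2]

/-- The tree `c` describes the configuration `S`. -/
def Rep (c : Tr) (S : Config Sg) : Prop :=
  ∃ l, c = .node (num S.time) l ∧ (l.toList : Multiset Tr) = S.facts.map entry

theorem Lin.termEnc {h : (s : Sg.Srt) → V s → Tr → Tr} (hh : ∀ s x, Lin (h s x)) {s : Sg.Srt}
    (p : Term Sg V s) : Lin fun y => p.enc fun s x => h s x y := by
  induction p with
  | var x => exact hh _ x
  | app f args ih =>
    simp only [Term.enc, List.ofFn_eq_map]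
    exact (Lin.const _).node (Lin.ofList _ (a := fun i y => (args i).enc fun s x => h s x y)
      fun i _ => ih i)

theorem Lin.factEnc {h : (s : Sg.Srt) → V s → Tr → Tr} (hh : ∀ s x, Lin (h s x)) (F : Fact Sg V) :
    Lin fun y => F.enc fun s x => h s x y := by
  simp only [Fact.enc, List.ofFn_eq_map]
  exact (Lin.const _).node (Lin.ofList _
    (a := fun i y => (F.args i).enc fun s x => h s x y) fun i _ => Lin.termEnc hh (F.args i))

/-- The integer offset is split into its positive and negative parts, which are added on opposite
sides, so the comparison takes place in `ℕ`. -/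
theorem LinP.holds {t : TimeVar → Tr → Tr} (ht : ∀ x, Lin (t x)) (c : Constraint) :
    LinP fun z => c.Holds fun x => val (t x z) := by
  have ha := (ht c.left).add_const (-c.offset).toNat
  have hb := (ht c.right).add_const c.offset.toNat
  have h1 := LinP.lt hb ha
  have h2 := LinP.le hb ha
  have h3 := LinP.le ha hb
  rcases c with ⟨_ | _ | _, l, r, o⟩ <;>
    simp only [Constraint.Holds] at *
  · refine h1.of_iff fun z => ?_
    rw [val_iterate_succ, val_iterate_succ]
    omega
  · refine (h2.and h3).of_iff fun z => ?_
    rw [val_iterate_succ, val_iterate_succ]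
    omega
  · refine h2.of_iff fun z => ?_
    rw [val_iterate_succ, val_iterate_succ]
    omega

/-! ### Matching patterns against the tree of a configuration -/

variable {n : Sg.Srt → ℕ}

/-- The unknowns of a matching problem. -/
abbrev Slot (n : Sg.Srt → ℕ) : Type := (Σ s : Sg.Srt, Fin (n s)) ⊕ TimeVar

/-- Time variables range over all of `ℕ`, so slots are numbered by some injection; only those that
occur matter, and `numSlots` lies above them. -/
noncomputable def slot : Slot n → ℕ := (exists_injective_nat (Slot n)).choose

theorem slot_injective : Function.Injective (slot (n := n)) :=
  (exists_injective_nat (Slot n)).choose_spec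

def InPats (pats : List (TimedPattern Sg n)) (x : Σ s : Sg.Srt, Fin (n s)) : Prop :=
  ∃ q ∈ pats, q.1.Occurs (V := Vars Sg n) x

def TimeIn (clk : List TimeVar) (pats : List (TimedPattern Sg n)) (x : TimeVar) : Prop :=
  x ∈ clk ∨ ∃ q ∈ pats, q.2 = x

theorem exists_slot_lt (clk : List TimeVar) (pats : List (TimedPattern Sg n)) :
    ∃ N, (∀ x : Σ s : Sg.Srt, Fin (n s), slot (n := n) (.inl x) < N) ∧
      ∀ x, TimeIn clk pats x → slot (n := n) (.inr x) < N := by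
  have h1 : (Set.range fun x : Σ s : Sg.Srt, Fin (n s) => slot (n := n) (.inl x)).Finite :=
    Set.finite_range _
  have h2 : ((fun x => slot (n := n) (.inr x)) '' {x | TimeIn clk pats x}).Finite := by
    refine Set.Finite.image _ (((clk ++ pats.map Prod.snd).toFinset.finite_toSet).subset ?_)
    rintro x (hx | ⟨q, hq, rfl⟩)
    · simp [hx]
    · simp only [List.coe_toFinset, List.mem_append, List.mem_map, Set.mem_ofPred_eq]
      exact .inr ⟨q, hq, rfl⟩
  obtain ⟨N, hN⟩ := (h1.union h2).bddAbove
  exact ⟨N + 1, fun x => Nat.lt_succ_of_le (hN (.inl ⟨x, rfl⟩)),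
    fun x hx => Nat.lt_succ_of_le (hN (.inr ⟨x, hx, rfl⟩))⟩

noncomputable def numSlots (clk : List TimeVar) (pats : List (TimedPattern Sg n)) : ℕ :=
  (exists_slot_lt clk pats).choose

/-- The trees of the variables: those of the patterns are found in `E`, the other ones in `ρ`. -/
noncomputable def look (pats : List (TimedPattern Sg n)) (ρ : GroundSubst Sg (Vars Sg n)) (E : Tr)
    (s : Sg.Srt) (x : Fin (n s)) : Tr :=
  if InPats pats ⟨s, x⟩ then get (slot (n := n) (.inl ⟨s, x⟩)) E else (ρ s x).tree

noncomputable def timeLook (n : Sg.Srt → ℕ) (E : Tr) (x : TimeVar) : Tr :=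
  get (slot (n := n) (.inr x)) E

noncomputable def entryPat (h : (s : Sg.Srt) → Fin (n s) → Tr) (τ : TimeVar → Tr)
    (q : TimedPattern Sg n) : Tr := .node (q.1.enc (V := Vars Sg n) h) (τ q.2)

section

variable (clk : List TimeVar) (pats : List (TimedPattern Sg n)) (guard : List Constraint)
  (ρ : GroundSubst Sg (Vars Sg n)) (Q : Tr → Prop)

/-- For `z = node E (node c y)`: the values in `E` solve the matching problem for `c`, and the
remaining entries `R` satisfy `Q (node R z)`. -/
def MatchAt (z : Tr) : Prop :=
  (∀ x ∈ clk, timeLook n z.fst x = z.snd.fst.fst) ∧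
  (∀ g ∈ guard, g.Holds fun x => val (timeLook n z.fst x)) ∧
  ∃ R, PickAll (pats.map fun q => entryPat (look pats ρ z.fst) (timeLook n z.fst) q)
    z.snd.fst.snd R ∧ Q (.node R z)

/-- For `x = node c (node M y)`: the matching problem has a solution in trees that are small
with respect to `M`. -/
def MatchPred (x : Tr) : Prop :=
  ∃ e : ℕ → Tr, (∀ i < numSlots clk pats, Small x.snd.fst (e i)) ∧
    MatchAt clk pats guard ρ Q (.node (envTr (numSlots clk pats) e) x)

variable {Q}

theorem lin_look (s : Sg.Srt) (x : Fin (n s)) {f : Tr → Tr} (hf : Lin f) :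
    Lin fun z => look pats ρ (f z) s x := by
  unfold look
  split_ifs <;> fun_prop

theorem lin_timeLook (x : TimeVar) {f : Tr → Tr} (hf : Lin f) : Lin fun z => timeLook n (f z) x :=
  hf.get _

theorem lin_entryPat (q : TimedPattern Sg n) {f : Tr → Tr} (hf : Lin f) :
    Lin fun z => entryPat (look pats ρ (f z)) (timeLook n (f z)) q :=
  (Lin.factEnc (V := Vars Sg n) (fun s x => lin_look pats ρ s x hf) q.1).node (lin_timeLook _ hf)

theorem linP_matchPred (hQ : LinP Q) : LinP (MatchPred clk pats guard ρ Q) := by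
  refine LinP.exists_env _ (Q := MatchAt clk pats guard ρ Q) ?_ (by fun_prop) (by fun_prop)
  refine LinP.and (LinP.forall_list _ fun x _ => ?_) (LinP.and (LinP.forall_list _ fun g _ => ?_) ?_)
  · exact LinP.eq (lin_timeLook _ (by fun_prop)) (by fun_prop)
  · exact LinP.holds (fun x => lin_timeLook x (by fun_prop)) g
  · have := LinP.pickAll (pats.map fun q z => entryPat (look pats ρ z.fst) (timeLook n z.fst) q)
      (fun a ha => ?_) hQ (f := fun z => z.snd.fst.snd) (g := fun z => z) (by fun_prop) (by fun_prop)
    · simpa only [List.map_map, Function.comp_def] using this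
    · obtain ⟨q, -, rfl⟩ := List.mem_map.1 ha
      exact lin_entryPat pats ρ q (by fun_prop)

variable {clk pats guard ρ}

theorem map_entry_instances (σ : GroundSubst Sg (Vars Sg n)) {τ : TimeVar → ℕ} {τ' : TimeVar → Tr}
    {L : List (TimedPattern Sg n)} (h : ∀ q ∈ L, τ' q.2 = num (τ q.2)) :
    (instances σ τ L).map entry =
      (↑(L.map fun q => entryPat (fun s x => (σ s x).tree) τ' q) : Multiset Tr) := by
  simp only [instances, Multiset.map_coe, List.map_map]
  congr 1
  refine List.map_congr_left fun q hq => ?_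
  simp only [Function.comp_apply, entry, entryPat, Fact.tree_subst, h q hq]

/-- The guessed values are arbitrary trees, but the pattern instances are found among genuine
entries of `c`. This forces the values of pattern variables to be trees of ground terms and
canonical numerals. -/
theorem MatchAt.exists_instance {E c y : Tr} {S : Config Sg} (hc : Rep c S)
    (h : MatchAt clk pats guard ρ Q (.node E (.node c y))) :
    ∃ (σ : GroundSubst Sg (Vars Sg n)) (τ : TimeVar → ℕ) (rest : Multiset (GroundFact Sg × ℕ))
      (R : Tr), (look pats ρ E = fun s x => (σ s x).tree) ∧
      (∀ q ∈ pats, timeLook n E q.2 = num (τ q.2)) ∧ (∀ x ∈ clk, τ x = S.time) ∧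
      (∀ g ∈ guard, g.Holds τ) ∧ S.facts = instances σ τ pats + rest ∧
      (R.toList : Multiset Tr) = rest.map entry ∧ Q (.node R (.node E (.node c y))) := by
  obtain ⟨l, rfl, hl⟩ := hc
  obtain ⟨h1, h2, R, h3, h4⟩ := h
  simp only [Tr.fst_node, Tr.snd_node] at h1 h2 h3
  have h5 := h3.coe_eq
  rw [hl] at h5
  have h6 : ∀ q ∈ pats, ∃ F : GroundFact Sg × ℕ,
      entry F = entryPat (look pats ρ E) (timeLook n E) q := by
    intro q hq
    have : entryPat (look pats ρ E) (timeLook n E) q ∈ S.facts.map entry := by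
      rw [h5, Multiset.mem_add, Multiset.mem_coe]
      exact .inl (List.mem_map_of_mem hq)
    obtain ⟨F, -, hF⟩ := Multiset.mem_map.1 this
    exact ⟨F, hF⟩
  have h7 : ∀ s x, ∃ u : GroundTerm Sg s, look pats ρ E s x = u.tree := by
    intro s x
    by_cases hx : InPats pats ⟨s, x⟩
    · obtain ⟨q, hq, hx⟩ := hx
      obtain ⟨F, hF⟩ := h6 q hq
      simp only [entry, entryPat, Tr.node.injEq] at hF
      exact Fact.exists_tree_of_enc hF.1.symm hx
    · exact ⟨ρ s x, if_neg hx⟩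
  choose σ hσ using h7
  have hσ' : look pats ρ E = fun s x => (σ s x).tree := funext fun s => funext fun x => hσ s x
  have h8 : ∀ q ∈ pats, timeLook n E q.2 = num (val (timeLook n E q.2)) := by
    intro q hq
    obtain ⟨F, hF⟩ := h6 q hq
    simp only [entry, entryPat, Tr.node.injEq] at hF
    rw [← hF.2, val_num]
  rw [hσ', ← map_entry_instances σ (τ := fun x => val (timeLook n E x)) h8] at h5
  have h9 : instances σ (fun x => val (timeLook n E x)) pats ≤ S.facts := by
    rw [← Multiset.map_le_map_iff entry_injective, h5]
    exact Multiset.le_add_right _ _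
  obtain ⟨rest, hrest⟩ := Multiset.le_iff_exists_add.1 h9
  refine ⟨σ, _, rest, R, hσ', h8, fun x hx => ?_, h2, hrest, ?_, h4⟩
  · rw [h1 x hx, val_num]
  · rw [hrest, Multiset.map_add] at h5
    exact (add_left_cancel h5).symm

theorem size_le_of_mem {S : Config Sg} {c : Tr} (hc : Rep c S) {F : GroundFact Sg × ℕ}
    (hF : F ∈ S.facts) : (entry F).size ≤ c.size := by
  obtain ⟨l, rfl, hl⟩ := hc
  have h : entry F ∈ l.toList := by
    rw [← Multiset.mem_coe, hl]
    exact Multiset.mem_map_of_mem _ hF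
  have h2 : (entry F).size ≤ (Tr.ofList l.toList).size := by
    rw [Tr.size_ofList]
    have := List.single_le_sum (l := l.toList.map fun t => t.size + 1) (fun _ _ => Nat.zero_le _) _
      (List.mem_map_of_mem h)
    omega
  rw [Tr.ofList_toList] at h2
  simp only [Tr.size_node]
  omega

/-- The value of a variable in the patterns is part of an entry of `c`, hence no larger than `c` and
within the range of the search. The other term variables are supplied by `ρ`. The witnesses `E` and
`R` do not depend on `Q`. -/
theorem exists_matchPred {c M : Tr} {S : Config Sg} (hc : Rep c S)
    (hM : ∀ t : Tr, t.size ≤ c.size → Small M t) {σ : GroundSubst Sg (Vars Sg n)} {τ : TimeVar → ℕ}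
    {rest : Multiset (GroundFact Sg × ℕ)} (h1 : ∀ x ∈ clk, τ x = S.time)
    (h2 : ∀ g ∈ guard, g.Holds τ) (h2' : ∀ g ∈ guard, ∀ x ∈ [g.left, g.right], TimeIn clk pats x)
    (h3 : S.facts = instances σ τ pats + rest)
    (hρ : ∀ s x, ¬InPats pats ⟨s, x⟩ → ρ s x = σ s x) :
    ∃ E R, (look pats ρ E = fun s x => (σ s x).tree) ∧
      (∀ q ∈ pats, timeLook n E q.2 = num (τ q.2)) ∧ (R.toList : Multiset Tr) = rest.map entry ∧
      ∀ (Q : Tr → Prop) (y : Tr), Q (.node R (.node E (.node c (.node M y)))) →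
        MatchPred clk pats guard ρ Q (.node c (.node M y)) := by
  -- Unused slots get `nil`, so that every slot has a small value.
  let e : Slot n → Tr := fun a => match a with
    | .inl x => if InPats pats x then (σ x.1 x.2).tree else .nil
    | .inr x => if TimeIn clk pats x then num (τ x) else .nil
  have hsize : ∀ a, (e a).size ≤ c.size := by
    have hmem : ∀ q ∈ pats, (entry (q.1.subst σ, τ q.2)).size ≤ c.size := fun q hq =>
      size_le_of_mem hc (by rw [h3, Multiset.mem_add]; exact .inl (mem_instances σ τ hq))
    rintro (⟨s, x⟩ | x)
    · simp only [e]
      split_ifs with hx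
      · obtain ⟨q, hq, hx⟩ := hx
        have h4 := hmem q hq
        have h5 := q.1.size_le_enc (V := Vars Sg n) (h := fun s x => (σ s x).tree) hx
        rw [← Fact.tree_subst] at h5
        simp only [entry, Tr.size_node] at h4
        omega
      · exact c.size_pos
    · simp only [e]
      split_ifs with hx
      · rcases hx with hx | ⟨q, hq, rfl⟩
        · rw [h1 x hx]
          obtain ⟨l, rfl, -⟩ := hc
          simp only [Tr.size_node]
          omega
        · have h4 := hmem q hq
          simp only [entry, Tr.size_node] at h4
          omega
      · exact c.size_pos
  obtain ⟨hN1, hN2⟩ := (exists_slot_lt clk pats).choose_spec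
  set E := envTr (numSlots clk pats) fun i => e (Function.invFun slot i)
  have hE : ∀ a, slot a < numSlots clk pats → get (slot a) E = e a := by
    intro a ha
    rw [get_envTr _ ha, Function.leftInverse_invFun slot_injective]
  have hE1 : look pats ρ E = fun s x => (σ s x).tree := by
    funext s x
    unfold look
    split_ifs with hx
    · rw [hE _ (hN1 _)]
      simp only [e, if_pos hx]
    · rw [hρ s x hx]
  have hE2 : ∀ x, TimeIn clk pats x → timeLook n E x = num (τ x) := by
    intro x hx
    rw [timeLook, hE _ (hN2 x hx)]
    simp only [e, if_pos hx]
  obtain ⟨l, rfl, hl⟩ := hc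
  have hpick : (↑(pats.map fun q => entryPat (fun s x => (σ s x).tree) (timeLook n E) q) :
      Multiset Tr) ≤ l.toList := by
    rw [hl, h3, Multiset.map_add, map_entry_instances σ fun q hq => hE2 q.2 (.inr ⟨q, hq, rfl⟩)]
    exact Multiset.le_add_right _ _
  obtain ⟨R, hR⟩ := exists_pickAll hpick
  refine ⟨E, R, hE1, fun q hq => hE2 q.2 (.inr ⟨q, hq, rfl⟩), ?_, fun Q y hQ =>
    ⟨_, fun i _ => hM _ (hsize _), fun x hx => ?_, fun g hg => ?_, R, ?_, hQ⟩⟩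
  · have := hR.coe_eq
    rw [hl, h3, Multiset.map_add,
      map_entry_instances σ fun q hq => hE2 q.2 (.inr ⟨q, hq, rfl⟩)] at this
    exact (add_left_cancel this).symm
  · simp only [Tr.fst_node, Tr.snd_node]
    rw [hE2 x (.inl hx), h1 x hx]
  · have hl := hE2 _ (h2' g hg g.left (by simp))
    have hr := hE2 _ (h2' g hg g.right (by simp))
    have := h2 g hg
    simp only [Constraint.Holds, Tr.fst_node] at this ⊢
    change match g.rel with
      | .gt => (val (timeLook n E g.left) : ℤ) > val (timeLook n E g.right) + g.offset
      | .eq => (val (timeLook n E g.left) : ℤ) = val (timeLook n E g.right) + g.offset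
      | .ge => (val (timeLook n E g.left) : ℤ) ≥ val (timeLook n E g.right) + g.offset
    rwa [hl, hr, val_num, val_num]
  · simp only [Tr.fst_node, Tr.snd_node]
    rw [hE1]
    exact hR

end

end TimedMSR

/-! ### Rules, ticks and critical pairs as linear space predicates. -/

namespace TimedMSR

open LinSpace Classical

variable {Sg : Alphabet}

/-! ### Values of the variables that do not occur in the pre-condition of a rule -/

theorem finite_size_le (s : Sg.Srt) (K : ℕ) : Finite {t : GroundTerm Sg s // t.size ≤ K} := by
  obtain ⟨C, hC, -⟩ := exists_size_tree_le Sg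
  refine Finite.of_injective (β := Fin (val (ones (C * K + 1))))
    (fun t => ⟨index t.1.tree, index_lt ?_⟩) fun t t' h => ?_
  · exact Nat.lt_succ_of_le ((hC s t.1).trans (Nat.mul_le_mul_left _ t.2))
  · have h1 : index t.1.tree = index t'.1.tree := congrArg Fin.val h
    have h2 := parse_index t.1.tree
    rw [h1, parse_index] at h2
    exact Subtype.ext (Term.tree_injective h2.symm)

/-- Either a sort has arbitrarily large terms or all of its terms are bounded; there are finitely
many sorts, so one `K` serves all of them. The second clause gives small default values for
inhabited sorts. -/
theorem exists_term_bound (Sg : Alphabet) : ∃ K, ∀ s,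
    ((∀ B, ∃ t : GroundTerm Sg s, B < t.size) ∨ ∀ t : GroundTerm Sg s, t.size ≤ K) ∧
      (Nonempty (GroundTerm Sg s) → ∃ t : GroundTerm Sg s, t.size ≤ K) := by
  have h : ∀ s, ∃ K, ((∀ B, ∃ t : GroundTerm Sg s, B < t.size) ∨
      ∀ t : GroundTerm Sg s, t.size ≤ K) ∧
      (Nonempty (GroundTerm Sg s) → ∃ t : GroundTerm Sg s, t.size ≤ K) := by
    intro s
    by_cases hs : ∀ B, ∃ t : GroundTerm Sg s, B < t.size
    · obtain ⟨t, -⟩ := hs 0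
      exact ⟨t.size, .inl hs, fun _ => ⟨t, le_rfl⟩⟩
    · push Not at hs
      obtain ⟨K, hK⟩ := hs
      exact ⟨K, .inr hK, fun ⟨t⟩ => ⟨t, hK t⟩⟩
  choose K hK using h
  have hle : ∀ s, K s ≤ ∑ s, K s := fun s =>
    Finset.single_le_sum (f := K) (fun _ _ => Nat.zero_le _) (Finset.mem_univ s)
  refine ⟨∑ s, K s, fun s => ⟨(hK s).1.imp_right fun h t => (h t).trans (hle s), fun h => ?_⟩⟩
  obtain ⟨t, ht⟩ := (hK s).2 h
  exact ⟨t, ht.trans (hle s)⟩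

noncomputable def termBound (Sg : Alphabet) : ℕ := (exists_term_bound Sg).choose

/-- Substitutions by terms of bounded size. -/
abbrev SmallSubst (Sg : Alphabet) (n : Sg.Srt → ℕ) : Type :=
  (s : Sg.Srt) → Fin (n s) → {t : GroundTerm Sg s // t.size ≤ termBound Sg}

instance (n : Sg.Srt → ℕ) : Finite (SmallSubst Sg n) := by
  have := fun s => finite_size_le (Sg := Sg) s (termBound Sg)
  infer_instance

theorem instances_congr {n : Sg.Srt → ℕ} {σ σ' : GroundSubst Sg (Vars Sg n)} {τ : TimeVar → ℕ}
    {L : List (TimedPattern Sg n)} (h : ∀ s x, InPats L ⟨s, x⟩ → σ s x = σ' s x) :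
    instances σ τ L = instances σ' τ L := by
  unfold instances
  congr 1
  refine List.map_congr_left fun q hq => ?_
  rw [q.1.subst_congr fun s x hx => h s x ⟨q, hq, hx⟩]

def Rule.pre (r : Rule Sg) : List (TimedPattern Sg r.numVars) := r.side ++ r.consumed

/-- The instance of a rule by `σ` and `τ`, with the facts `rest` untouched. -/
def Rule.StepBy (r : Rule Sg) (S : Config Sg) (σ : GroundSubst Sg (Vars Sg r.numVars))
    (τ : TimeVar → ℕ) (rest : Multiset (GroundFact Sg × ℕ)) : Prop :=
  τ 0 = S.time ∧ (∀ c ∈ r.guard, c.Holds τ) ∧ S.facts = instances σ τ r.pre + rest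

/-- The result of such an instance. -/
def Rule.next (r : Rule Sg) (S : Config Sg) (σ : GroundSubst Sg (Vars Sg r.numVars))
    (τ : TimeVar → ℕ) (rest : Multiset (GroundFact Sg × ℕ)) : Config Sg :=
  ⟨S.time, instances σ τ r.side +
    ↑(r.created.map fun q => (q.1.subst σ, S.time + q.2)) + rest⟩

theorem Rule.step_iff {r : Rule Sg} {S S' : Config Sg} :
    r.Step S S' ↔ ∃ σ τ rest, r.StepBy S σ τ rest ∧ S' = r.next S σ τ rest := by
  have h : ∀ σ τ, instances σ τ r.pre = instances σ τ r.side + instances σ τ r.consumed := by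
    intro σ τ
    simp [instances, Rule.pre]
  constructor
  · rintro ⟨σ, τ, rest, h1, h2, h3, h4, h5⟩
    refine ⟨σ, τ, rest, ⟨h1, h2, by rw [h, h3]⟩, ?_⟩
    cases S'
    simp only [Rule.next, Config.mk.injEq]
    exact ⟨h4, h5⟩
  · rintro ⟨σ, τ, rest, ⟨h1, h2, h3⟩, rfl⟩
    exact ⟨σ, τ, rest, h1, h2, by rw [h3, h], rfl, rfl⟩

/-- If the facts in the successors of `S` are bounded, fresh variables need only small values. -/
theorem Rule.Step.exists_small {r : Rule Sg} {S S' : Config Sg} {k : ℕ}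
    (hk : ∀ S'', r.Step S S'' → ∀ F ∈ S''.facts, F.1.size ≤ k) (h : r.Step S S') :
    ∃ σ τ rest, r.StepBy S σ τ rest ∧ S' = r.next S σ τ rest ∧ ∃ ρ : SmallSubst Sg r.numVars,
      ∀ s x, ¬InPats r.pre ⟨s, x⟩ → (ρ s x : GroundTerm Sg s) = σ s x := by
  obtain ⟨σ, τ, rest, ⟨h1, h2, h3⟩, rfl⟩ := Rule.step_iff.1 h
  have hK := (exists_term_bound Sg).choose_spec
  choose small hsmall using fun s => (hK s).2
  change ∀ s h, (small s h).size ≤ termBound Sg at hsmall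
  have hcreated : ∀ s x, ¬InPats r.pre ⟨s, x⟩ → (∃ q ∈ r.created, q.1.Occurs ⟨s, x⟩) →
      (σ s x).size ≤ termBound Sg := by
    rintro s x hx ⟨q, hq, hqx⟩
    rcases (hK s).1 with hs | hs
    · exfalso
      obtain ⟨t, ht⟩ := hs k
      -- A term larger than `k` for the unbound variable `x` leaves the pre-condition intact and
      -- gives another successor, with a created fact larger than `k`.
      set σ' : GroundSubst Sg (Vars Sg r.numVars) := fun s' x' =>
        Function.update (fun p : Σ s, Fin (r.numVars s) => σ p.1 p.2) ⟨s, x⟩ t ⟨s', x'⟩ with hσ'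
      have h4 : r.StepBy S σ' τ rest := by
        refine ⟨h1, h2, ?_⟩
        rw [h3, instances_congr fun s' x' hx' => ?_]
        rw [hσ']
        simp only
        rw [Function.update_of_ne]
        rintro e
        exact hx (e ▸ hx')
      have h5 := hk _ (Rule.step_iff.2 ⟨σ', τ, rest, h4, rfl⟩) (q.1.subst σ', S.time + q.2) (by
        simp only [Rule.next, Multiset.mem_add, Multiset.mem_coe, List.mem_map]
        exact .inl (.inr ⟨q, hq, rfl⟩))
      have h6 := q.1.size_le_subst σ' hqx
      have h7 : σ' s x = t := by
        rw [hσ']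
        exact Function.update_self ..
      rw [h7] at h6
      exact absurd (h6.trans h5) (not_le.2 ht)
    · exact hs _
  -- Variables that occur neither in the pre-condition nor in a created fact do not influence the
  -- step and may take the small default; `σ s x` shows that their sort is inhabited.
  set σ' : GroundSubst Sg (Vars Sg r.numVars) := fun s x =>
    if InPats r.pre ⟨s, x⟩ ∨ ∃ q ∈ r.created, q.1.Occurs ⟨s, x⟩ then σ s x else small s ⟨σ s x⟩
    with hσ'
  have hpre : ∀ s x, InPats r.pre ⟨s, x⟩ → σ s x = σ' s x := fun s x hx => (if_pos (.inl hx)).symm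
  have hside : ∀ s x, InPats r.side ⟨s, x⟩ → σ s x = σ' s x := fun s x ⟨q, hq, hx⟩ =>
    hpre s x ⟨q, List.mem_append_left _ hq, hx⟩
  refine ⟨σ', τ, rest, ⟨h1, h2, by rw [h3, instances_congr hpre]⟩, ?_,
    fun s x => if hx : InPats r.pre ⟨s, x⟩ then ⟨small s ⟨σ s x⟩, hsmall _ _⟩ else ⟨σ' s x, ?_⟩,
    fun s x hx => ?_⟩
  · unfold Rule.next
    rw [instances_congr hside]
    congr 4
    refine List.map_congr_left fun q hq => ?_
    rw [q.1.subst_congr (σ' := σ') fun s x hx => (if_pos (Or.inr ⟨q, hq, hx⟩)).symm]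
  · simp only [hσ', hx, false_or]
    split_ifs with hx'
    · exact hcreated s x hx hx'
    · exact hsmall _ _
  · simp only [hx, dite_false]

/-! ### Rules as predicates on trees -/

noncomputable def newEntry {n : Sg.Srt → ℕ} (h : (s : Sg.Srt) → Fin (n s) → Tr) (T : Tr)
    (q : Fact Sg (Vars Sg n) × ℕ) : Tr :=
  .node (q.1.enc (V := Vars Sg n) h) (succ^[q.2] T)

section

variable (r : Rule Sg) (ρ : GroundSubst Sg (Vars Sg r.numVars)) (Q : Tr → Prop)

noncomputable def ruleNext (w : Tr) : Tr :=
  .node w.snd.snd.fst.fst (consAll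
    (r.side.map fun q => entryPat (look r.pre ρ w.snd.fst) (timeLook r.numVars w.snd.fst) q)
    (consAll (r.created.map fun q => newEntry (look r.pre ρ w.snd.fst) w.snd.snd.fst.fst q) w.fst))

/-- For `x = node c y`: some instance of `r` leads from `c` to a `c'` with `Q (node c' y)`. -/
def RulePred (x : Tr) : Prop :=
  MatchPred [0] r.pre r.guard ρ (fun w => Q (.node (ruleNext r ρ w) w.snd.snd.snd)) x

theorem lin_ruleNext : Lin (ruleNext r ρ) := by
  refine Lin.node (by fun_prop) (Lin.consAll r.side (fun q _ => lin_entryPat _ ρ q (by fun_prop))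
    (Lin.consAll r.created (fun q _ => ?_) (by fun_prop)))
  exact (Lin.factEnc (V := Vars Sg r.numVars) (fun s x => lin_look r.pre ρ s x (by fun_prop))
    q.1).node (Lin.add_const (by fun_prop) _)

variable {Q}

theorem linP_rulePred (hQ : LinP Q) : LinP (RulePred r ρ Q) :=
  linP_matchPred _ _ _ _ (hQ.comp ((lin_ruleNext r ρ).node (by fun_prop)))

variable {r ρ}

theorem rep_ruleNext {S : Config Sg} {c y E R : Tr} {σ : GroundSubst Sg (Vars Sg r.numVars)}
    {τ : TimeVar → ℕ} {rest : Multiset (GroundFact Sg × ℕ)} (hc : Rep c S)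
    (hσ : look r.pre ρ E = fun s x => (σ s x).tree)
    (hτ : ∀ q ∈ r.pre, timeLook r.numVars E q.2 = num (τ q.2))
    (hR : (R.toList : Multiset Tr) = rest.map entry) :
    Rep (ruleNext r ρ (.node R (.node E (.node c y)))) (r.next S σ τ rest) := by
  obtain ⟨l, rfl, -⟩ := hc
  refine ⟨_, rfl, ?_⟩
  simp only [Tr.fst_node, Tr.snd_node, toList_consAll, Rule.next]
  rw [← Multiset.coe_add, ← Multiset.coe_add, hR, hσ, Multiset.map_add, Multiset.map_add,
    map_entry_instances σ fun q hq => hτ q (List.mem_append_left _ hq), ← add_assoc]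
  simp only [Multiset.map_coe, List.map_map]
  congr 3
  refine List.map_congr_left fun q _ => ?_
  simp only [Function.comp_apply, newEntry, entry, Fact.tree_subst, iterate_succ_num]

theorem RulePred.exists_step {S : Config Sg} {c y : Tr} (hc : Rep c S)
    (h : RulePred r ρ Q (.node c y)) : ∃ S' c', r.Step S S' ∧ Rep c' S' ∧ Q (.node c' y) := by
  obtain ⟨e, -, h⟩ := h
  obtain ⟨σ, τ, rest, R, h1, h2, h3, h4, h5, h6, h7⟩ := h.exists_instance hc
  exact ⟨_, _, Rule.step_iff.2 ⟨σ, τ, rest, ⟨h3 0 (by simp), h4, h5⟩, rfl⟩,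
    rep_ruleNext hc h1 h2 h6, h7⟩

theorem Rule.Step.exists_rulePred {S S' : Config Sg} {c M : Tr} {k : ℕ} (hc : Rep c S)
    (hM : ∀ t : Tr, t.size ≤ c.size → Small M t)
    (hk : ∀ S'', r.Step S S'' → ∀ F ∈ S''.facts, F.1.size ≤ k) (h : r.Step S S') :
    ∃ c', Rep c' S' ∧ ∀ (Q : Tr → Prop) (y : Tr), Q (.node c' (.node M y)) →
      ∃ ρ : SmallSubst Sg r.numVars, RulePred r (fun s x => ρ s x) Q (.node c (.node M y)) := by
  obtain ⟨σ, τ, rest, ⟨h1, h2, h3⟩, rfl, ρ, hρ⟩ := h.exists_small hk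
  have hvars : ∀ g ∈ r.guard, ∀ x ∈ [g.left, g.right], TimeIn [0] r.pre x := by
    intro g hg x hx
    rcases r.guard_vars g hg x hx with rfl | ⟨q, hq, rfl⟩ | ⟨q, hq, rfl⟩
    · exact .inl (by simp)
    · exact .inr ⟨q, List.mem_append_left _ hq, rfl⟩
    · exact .inr ⟨q, List.mem_append_right _ hq, rfl⟩
  obtain ⟨E, R, h4, h5, h6, h7⟩ := exists_matchPred (clk := [0]) hc hM (by simpa using h1)
    h2 hvars h3 hρ
  exact ⟨_, rep_ruleNext (y := M) hc h4 h5 h6, fun Q y hQ => ⟨ρ, h7 _ y hQ⟩⟩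

end

/-- For `x = node c y`: some instance of an instantaneous rule leads from `c` to a `c'` with
`Q (node c' y)`. -/
def InstPred (A : System Sg) (Q : Tr → Prop) (x : Tr) : Prop :=
  ∃ r ∈ A, ∃ ρ : SmallSubst Sg r.numVars, RulePred r (fun s x => ρ s x) Q x

theorem linP_instPred (A : System Sg) {Q : Tr → Prop} (hQ : LinP Q) : LinP (InstPred A Q) := by
  have := LinP.exists_list A.toList (P := fun r x => ∃ ρ : SmallSubst Sg r.numVars,
    RulePred r (fun s x => ρ s x) Q x) fun r _ =>
      LinP.exists_finite fun ρ => linP_rulePred r (fun s x => ρ s x) hQ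
  simp only [Finset.mem_toList] at this
  exact this

/-! ### Ticks as predicates on trees -/

/-- For `x = node v t`. -/
noncomputable def decTr (x : Tr) : Tr := if val x.snd ≤ val x.fst then x.snd else pred x.snd

/-- For `x = node v a`. -/
noncomputable def decEntry (x : Tr) : Tr := .node x.snd.fst (decTr (.node x.fst x.snd.snd))

/-- For `x = node v c`. -/
noncomputable def cutTr (x : Tr) : Tr :=
  .node (decTr (.node x.fst x.snd.fst)) (mapTr decEntry x.fst x.snd.snd)

@[fun_prop]
theorem lin_decTr : Lin decTr := by
  unfold decTr
  fun_prop

theorem lin_cutTr : Lin cutTr := by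
  refine Lin.node (by fun_prop) (Lin.mapTr (by unfold decEntry; fun_prop) (C := 3)
    (fun c a => ?_) (by fun_prop) (by fun_prop))
  have h : ∀ t, (decTr (.node c t)).size ≤ 3 * t.size := fun t => by
    unfold decTr
    split_ifs
    · simp only [Tr.snd_node]
      omega
    · exact (size_le_bulk _).trans ((bulk_pred _).trans (bulk_le _))
  rcases a with _ | ⟨F, t⟩
  · simp [decEntry, decTr]
  · have := h t
    simp only [decEntry, Tr.fst_node, Tr.snd_node, Tr.size_node]
    omega

theorem decTr_num (v t : ℕ) : decTr (.node (num v) (num t)) = num (dec v t) := by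
  unfold decTr dec
  simp only [Tr.fst_node, Tr.snd_node, val_num]
  split_ifs with h
  · rfl
  · obtain ⟨t, rfl⟩ : ∃ u, t = u + 1 := ⟨t - 1, by omega⟩
    rw [pred_num, Nat.add_sub_cancel]

theorem rep_cutTr {S : Config Sg} {c : Tr} (hc : Rep c S) (v : ℕ) :
    Rep (cutTr (.node (num v) c)) (S.mapTime (dec v)) := by
  obtain ⟨l, rfl, hl⟩ := hc
  refine ⟨mapTr decEntry (num v) l, by simp [cutTr, decTr_num, Config.mapTime], ?_⟩
  rw [toList_mapTr, ← Multiset.map_coe, hl]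
  simp [Config.mapTime, entry, decEntry, decTr_num, Function.comp_def]

/-- For `x = node v c`. -/
def GapPred (D : ℕ) (x : Tr) : Prop :=
  val (succ^[D + 1] x.fst) < val x.snd.fst ∧
    ¬∃ a ∈ x.snd.snd.toList, ¬(val a.snd ≤ val x.fst ∨ val (succ^[D + 1] x.fst) < val a.snd)

theorem linP_gapPred (D : ℕ) : LinP (GapPred D) := by
  have h : ∀ {f : Tr → Tr}, Lin f → Lin fun x => succ^[D + 1] (f x) := fun hf => hf.add_const _
  refine LinP.and (LinP.lt (h (by fun_prop)) (by fun_prop)) (LinP.not ?_)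
  exact LinP.exists_mem (Q := fun z => ¬(val z.fst.snd ≤ val z.snd.fst ∨
    val (succ^[D + 1] z.snd.fst) < val z.fst.snd))
    (LinP.not (LinP.or (by fun_prop) (LinP.lt (h (by fun_prop)) (by fun_prop))))
    (by fun_prop) (by fun_prop : Lin fun x => x)

/-- For `x = node c y`: an instant can be cut out of `c`, and the result `c'` satisfies
`Q (node c' y)`. -/
def CutPred (D : ℕ) (Q : Tr → Prop) (x : Tr) : Prop :=
  (GapPred D (.node .nil x.fst) ∧ Q (.node (cutTr (.node .nil x.fst)) x.snd)) ∨
    ∃ a ∈ x.fst.snd.toList, GapPred D (.node a.snd x.fst) ∧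
      Q (.node (cutTr (.node a.snd x.fst)) x.snd)

theorem linP_cutPred (D : ℕ) {Q : Tr → Prop} (hQ : LinP Q) : LinP (CutPred D Q) := by
  have h1 := fun {f : Tr → Tr} (hf : Lin f) => (linP_gapPred D).comp hf
  have h2 := fun {f g : Tr → Tr} (hf : Lin f) (hg : Lin g) =>
    LinP.comp hQ ((lin_cutTr.comp hf).node hg)
  refine ((h1 (by fun_prop)).and (h2 (by fun_prop) (by fun_prop))).or ?_
  exact LinP.exists_mem (Q := fun z => GapPred D (.node z.fst.snd z.snd.fst) ∧
    Q (.node (cutTr (.node z.fst.snd z.snd.fst)) z.snd.snd))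
    ((h1 (by fun_prop)).and (h2 (by fun_prop) (by fun_prop))) (by fun_prop)
    (by fun_prop : Lin fun x => x)

/-- `Gap` requires the cut point to be 0 or a timestamp, so trying 0 and the timestamps of the
entries is exhaustive. -/
theorem cutPred_iff {D : ℕ} {Q : Tr → Prop} {S : Config Sg} {c y : Tr} (hc : Rep c S) :
    CutPred D Q (.node c y) ↔ ∃ v, Gap D S v ∧ Q (.node (cutTr (.node (num v) c)) y) := by
  obtain ⟨l, rfl, hl⟩ := hc
  have hmem : ∀ {a : Tr}, a ∈ l.toList ↔ ∃ F ∈ S.facts, entry F = a := by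
    intro a
    rw [← Multiset.mem_coe, hl, Multiset.mem_map]
  have hgap : ∀ v, GapPred D (.node (num v) (.node (num S.time) l)) ↔ v + D + 1 < S.time ∧
      ∀ F ∈ S.facts, F.2 ≤ v ∨ v + D + 1 < F.2 := by
    intro v
    unfold GapPred
    simp only [Tr.fst_node, Tr.snd_node, val_iterate_succ, val_num, ← add_assoc]
    refine and_congr_right fun _ => ?_
    push Not
    constructor
    · intro h F hF
      have := h _ (hmem.2 ⟨F, hF, rfl⟩)
      simp only [entry, Tr.snd_node, val_num] at this
      omega
    · intro h a ha
      obtain ⟨F, hF, rfl⟩ := hmem.1 ha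
      have := h F hF
      simp only [entry, Tr.snd_node, val_num]
      omega
  unfold CutPred
  simp only [Tr.fst_node, Tr.snd_node]
  constructor
  · rintro (⟨h1, h2⟩ | ⟨a, ha, h1, h2⟩)
    · exact ⟨0, ⟨.inl rfl, (hgap 0).1 h1⟩, h2⟩
    · obtain ⟨F, hF, rfl⟩ := hmem.1 ha
      exact ⟨F.2, ⟨.inr ⟨F, hF, rfl⟩, (hgap _).1 h1⟩, h2⟩
  · rintro ⟨v, ⟨rfl | ⟨F, hF, rfl⟩, h1⟩, h2⟩
    · exact .inl ⟨(hgap 0).2 h1, h2⟩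
    · exact .inr ⟨_, hmem.2 ⟨F, hF, rfl⟩, (hgap _).2 h1, h2⟩

noncomputable def tickTr (c : Tr) : Tr := .node (succ c.fst) c.snd

theorem rep_tickTr {S : Config Sg} {c : Tr} (hc : Rep c S) : Rep (tickTr c) S.tick := by
  obtain ⟨l, rfl, hl⟩ := hc
  exact ⟨l, rfl, hl⟩

/-- For `x = node c y`: a tick, with an instant cut out if possible, leads from `c` to a `c'` with
`Q (node c' y)`. -/
def TickPred (D : ℕ) (Q : Tr → Prop) (x : Tr) : Prop :=
  CutPred D Q (.node (tickTr x.fst) x.snd) ∨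
    (¬CutPred D (fun _ => True) (.node (tickTr x.fst) x.snd) ∧ Q (.node (tickTr x.fst) x.snd))

theorem linP_tickPred (D : ℕ) {Q : Tr → Prop} (hQ : LinP Q) : LinP (TickPred D Q) := by
  have h : Lin fun x => Tr.node (tickTr x.fst) x.snd := by
    unfold tickTr
    fun_prop
  exact ((linP_cutPred D hQ).comp h).or
    (((linP_cutPred D (LinP.const True)).comp h).not.and (hQ.comp h))

/-! ### Steps as predicates on trees -/

/-- For `x = node c y`: a step leads from `c` to a `c'` with `Q (node c' y)`. -/
def StepPred (A : System Sg) (D : ℕ) (Q : Tr → Prop) (x : Tr) : Prop :=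
  InstPred A Q x ∨ (¬InstPred A (fun _ => True) x ∧ TickPred D Q x)

/-- The successor is handed to a predicate `Q` instead of being guessed. It needs no name below the
current bound, so even an oversized successor can be tested. -/
theorem linP_stepPred (A : System Sg) (D : ℕ) {Q : Tr → Prop} (hQ : LinP Q) :
    LinP (StepPred A D Q) :=
  (linP_instPred A hQ).or ((linP_instPred A (LinP.const True)).not.and (linP_tickPred D hQ))

section

variable {A : System Sg} {D k : ℕ} {S S' : Config Sg} {c M y : Tr}

/-- Only finitely many values of unbound variables are tried, so finding an existing instance relies
on the bound `hk` for all successors. -/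
theorem instPred_true_iff (hc : Rep c S) (hM : ∀ t : Tr, t.size ≤ c.size → Small M t)
    (hk : ∀ r ∈ A, ∀ S', r.Step S S' → ∀ F ∈ S'.facts, F.1.size ≤ k) :
    InstPred A (fun _ => True) (.node c (.node M y)) ↔ Applicable A S := by
  constructor
  · rintro ⟨r, hr, ρ, h⟩
    obtain ⟨S', _, h, -⟩ := h.exists_step hc
    exact ⟨r, hr, S', h⟩
  · rintro ⟨r, hr, S', h⟩
    obtain ⟨c', -, h⟩ := h.exists_rulePred hc hM (hk r hr)
    obtain ⟨ρ, h⟩ := h (fun _ => True) y trivial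
    exact ⟨r, hr, ρ, h⟩

theorem StepPred.exists_cutStep {Q : Tr → Prop} (hc : Rep c S)
    (hM : ∀ t : Tr, t.size ≤ c.size → Small M t)
    (hk : ∀ r ∈ A, ∀ S', r.Step S S' → ∀ F ∈ S'.facts, F.1.size ≤ k)
    (h : StepPred A D Q (.node c (.node M y))) :
    ∃ S' c', CutStep A D S S' ∧ Rep c' S' ∧ Q (.node c' (.node M y)) := by
  rcases h with ⟨r, hr, ρ, h⟩ | ⟨hna, h⟩
  · obtain ⟨S', c', h1, h2⟩ := h.exists_step hc
    exact ⟨S', c', .inl ⟨r, hr, h1⟩, h2⟩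
  · rw [instPred_true_iff hc hM hk] at hna
    have hc' := rep_tickTr hc
    rcases h with h | ⟨h1, h2⟩
    · obtain ⟨v, hv, h⟩ := (cutPred_iff hc').1 h
      exact ⟨_, _, .inr ⟨hna, .inl ⟨v, hv, rfl⟩⟩, rep_cutTr hc' v, h⟩
    · rw [Tr.fst_node, cutPred_iff hc'] at h1
      exact ⟨_, _, .inr ⟨hna, .inr ⟨by simpa using h1, rfl⟩⟩, hc', h2⟩

theorem CutStep.exists_stepPred (hc : Rep c S) (hM : ∀ t : Tr, t.size ≤ c.size → Small M t)
    (hk : ∀ r ∈ A, ∀ S', r.Step S S' → ∀ F ∈ S'.facts, F.1.size ≤ k) (h : CutStep A D S S') :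
    ∃ c', Rep c' S' ∧ ∀ (Q : Tr → Prop) y, Q (.node c' (.node M y)) →
      StepPred A D Q (.node c (.node M y)) := by
  rcases h with ⟨r, hr, h⟩ | ⟨hna, h⟩
  · obtain ⟨c', h1, h2⟩ := h.exists_rulePred hc hM (hk r hr)
    exact ⟨c', h1, fun Q y hQ => .inl ⟨r, hr, h2 Q y hQ⟩⟩
  · have hna' := fun y => (instPred_true_iff (y := y) hc hM hk).not.2 hna
    have hc' := rep_tickTr hc
    rcases h with ⟨v, hv, rfl⟩ | ⟨h1, rfl⟩
    · exact ⟨_, rep_cutTr hc' v, fun Q y hQ => .inr ⟨hna' y, .inl ((cutPred_iff hc').2 ⟨v, hv, hQ⟩)⟩⟩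
    · refine ⟨_, hc', fun Q y hQ => .inr ⟨hna' y, .inr ⟨?_, hQ⟩⟩⟩
      rw [Tr.fst_node, cutPred_iff hc']
      simpa using h1

end

/-! ### Critical configurations -/

/-- For `x = node c y`: the configuration `c` is critical. -/
def CritPred (CS : CriticalSpec Sg) (x : Tr) : Prop :=
  ∃ P ∈ CS, ∃ h : Nonempty (GroundSubst Sg (Vars Sg P.numVars)),
    MatchPred P.clock.toList P.pattern P.constraints h.some (fun _ => True) x

theorem linP_critPred (CS : CriticalSpec Sg) : LinP (CritPred CS) := by
  have := LinP.exists_list CS.toList (P := fun P x =>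
    ∃ h : Nonempty (GroundSubst Sg (Vars Sg P.numVars)),
      MatchPred P.clock.toList P.pattern P.constraints h.some (fun _ => True) x) fun P _ => ?_
  · simp only [Finset.mem_toList] at this
    exact this
  · by_cases h : Nonempty (GroundSubst Sg (Vars Sg P.numVars))
    · simpa only [h, exists_true_left] using linP_matchPred _ _ _ _ (LinP.const True)
    · simpa only [h, IsEmpty.exists_iff] using LinP.const False

theorem critPred_iff {CS : CriticalSpec Sg} {S : Config Sg} {c M y : Tr} (hc : Rep c S)
    (hM : ∀ t : Tr, t.size ≤ c.size → Small M t) :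
    CritPred CS (.node c (.node M y)) ↔ Critical CS S := by
  constructor
  · rintro ⟨P, hP, h, e, -, h1⟩
    obtain ⟨σ, τ, rest, R, -, -, h3, h4, h5, -⟩ := h1.exists_instance hc
    exact ⟨P, hP, σ, τ, fun x hx => h3 x (by simp [hx]), h5 ▸ Multiset.le_add_right _ _, h4⟩
  · rintro ⟨P, hP, σ, τ, h1, h2, h3⟩
    have h : Nonempty (GroundSubst Sg (Vars Sg P.numVars)) := ⟨σ⟩
    obtain ⟨rest, hrest⟩ := Multiset.le_iff_exists_add.1 h2
    -- Nothing is created here, so variables outside the pattern may take any default value.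
    set σ' : GroundSubst Sg (Vars Sg P.numVars) := fun s x =>
      if InPats P.pattern ⟨s, x⟩ then σ s x else h.some s x
    rw [instances_congr (σ' := σ') fun s x hx => (if_pos hx).symm] at hrest
    obtain ⟨E, R, -, -, -, h5⟩ := exists_matchPred (clk := P.clock.toList) (ρ := h.some)
      hc hM (fun x hx => h1 x (by simpa using hx)) h3
      (fun g hg x hx => (P.constraint_vars g hg x hx).imp_left fun h => by simp [h]) hrest
      fun s x hx => (if_neg hx).symm
    exact ⟨P, hP, h, h5 _ y trivial⟩

end TimedMSR

/-! ### The graph of names and the search for the right size limit. -/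

namespace TimedMSR

open LinSpace Classical

variable {Sg : Alphabet}

/-! ### The graph of configurations, named by numbers -/

/-- The size of the trees of a configuration. -/
noncomputable def Config.treeSize (S : Config Sg) : ℕ :=
  2 + (num S.time).size + (S.facts.map fun F => (entry F).size + 1).sum

theorem Rep.size_eq {c : Tr} {S : Config Sg} (h : Rep c S) : c.size = S.treeSize := by
  obtain ⟨l, rfl, hl⟩ := h
  have h1 := Tr.size_ofList l.toList
  rw [Tr.ofList_toList] at h1
  have h2 : (l.toList.map fun t => t.size + 1).sum =
      ((l.toList : Multiset Tr).map fun t => t.size + 1).sum := by simp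
  rw [hl, Multiset.map_map] at h2
  rw [Tr.size_node, h1, h2, Config.treeSize]
  simp only [Function.comp_def]
  omega

/-- The numbers 0 and 1 both parse to `nil` and hence name no configuration; they are free to serve
as start and goal. -/
theorem Rep.ne_nil {c : Tr} {S : Config Sg} (h : Rep c S) : c ≠ .nil := by
  obtain ⟨l, rfl, -⟩ := h
  exact Tr.noConfusion

/-- For `x = node c (node M b)`: the size of `c` is below the length of `M`. -/
def FitPred (x : Tr) : Prop := val (ones x.fst.size) < val x.snd.fst

/-- For `x = node c (node M b)`: either `c` fits and `b` names it, or `b` is one and `c` satisfies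
`Bad`. -/
def NamePred (Bad : Tr → Prop) (x : Tr) : Prop :=
  (FitPred x ∧ parse x.snd.snd = x.fst) ∨ (x.snd.snd = num 1 ∧ Bad x)

/-- For `z = node a (node b (node M c₀))`: an edge of the graph, where zero is the start, one is the
goal, and the other numbers name configurations. -/
def EdgePred (A : System Sg) (D : ℕ) (Bad : Tr → Prop) (z : Tr) : Prop :=
  (z.fst = .nil ∧ NamePred Bad (.node z.snd.snd.snd (.node z.snd.snd.fst z.snd.fst))) ∨
    (z.fst ≠ .nil ∧
      StepPred A D (NamePred Bad) (.node (parse z.fst) (.node z.snd.snd.fst z.snd.fst)))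

theorem linP_fitPred : LinP FitPred := by
  unfold FitPred
  fun_prop

theorem linP_edgePred (A : System Sg) (D : ℕ) {Bad : Tr → Prop} (hBad : LinP Bad) :
    LinP (EdgePred A D Bad) := by
  have h : LinP (NamePred Bad) := (linP_fitPred.and (by fun_prop)).or
    (LinP.and (by fun_prop) hBad)
  refine LinP.or (LinP.and (by fun_prop) (h.comp (by fun_prop)))
    (LinP.and (by fun_prop) ((linP_stepPred A D h).comp (by fun_prop)))

section

variable {A : System Sg} {D k s : ℕ} {S₀ : Config Sg} {c₀ : Tr} {Bad : Tr → Prop}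

theorem fitPred_iff {c b : Tr} : FitPred (.node c (.node (ones s) b)) ↔ c.size < s := ones_lt_iff

/-- Reachability in the graph. -/
def NameReach (A : System Sg) (D : ℕ) (Bad : Tr → Prop) (s : ℕ) (c₀ : Tr) : ℕ → ℕ → Prop :=
  Relation.ReflTransGen fun a b => b < val (ones s) ∧ relOf (EdgePred A D Bad) (.node (ones s) c₀) a b

theorem CutReach.step_size_le {S : Config Sg} (hA : ∀ r ∈ A, ∀ c ∈ r.guard, c.offset.natAbs ≤ D)
    (hk : FactsBounded A S₀ k) (h : CutReach A D S₀ S) :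
    ∀ r ∈ A, ∀ S', r.Step S S' → ∀ F ∈ S'.facts, F.1.size ≤ k := fun r hr _ h1 _ hF =>
  CutReach.size_le hA hk (h.tail (.inl ⟨r, hr, h1⟩)) hF

/-- Invariant: a reached number is 0, or a reachable configuration with `Bad` has been found, or the
number names a reachable configuration of size below `s`. -/
theorem NameReach.sound (hA : ∀ r ∈ A, ∀ c ∈ r.guard, c.offset.natAbs ≤ D)
    (hk : FactsBounded A S₀ k) (hc : Rep c₀ S₀) (h : NameReach A D Bad s c₀ 0 1) :
    ∃ S c, CutReach A D S₀ S ∧ Rep c S ∧ Bad (.node c (.node (ones s) (num 1))) := by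
  have hname : ∀ {S c b}, CutReach A D S₀ S → Rep c S →
      NamePred Bad (.node c (.node (ones s) (num b))) →
      (∃ S c, CutReach A D S₀ S ∧ Rep c S ∧ Bad (.node c (.node (ones s) (num 1)))) ∨
        ∃ S, CutReach A D S₀ S ∧ Rep (parse (num b)) S ∧ (parse (num b)).size < s := by
    rintro S c b hS hc (⟨h1, h2⟩ | ⟨h1, h2⟩)
    · simp only [Tr.snd_node, Tr.fst_node] at h2
      rw [fitPred_iff] at h1
      exact .inr ⟨S, hS, h2 ▸ hc, h2 ▸ h1⟩
    · simp only [Tr.snd_node] at h1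
      exact .inl ⟨S, c, hS, hc, h1 ▸ h2⟩
  have key : ∀ b, NameReach A D Bad s c₀ 0 b → b = 0 ∨
      (∃ S c, CutReach A D S₀ S ∧ Rep c S ∧ Bad (.node c (.node (ones s) (num 1)))) ∨
        ∃ S, CutReach A D S₀ S ∧ Rep (parse (num b)) S ∧ (parse (num b)).size < s := by
    intro b hb
    induction hb with
    | refl => exact .inl rfl
    | @tail a b _ h ih =>
      obtain ⟨-, h⟩ := h
      right
      rcases h with ⟨h1, h2⟩ | ⟨h1, h2⟩
      · exact hname .refl hc h2
      · simp only [Tr.fst_node, Tr.snd_node] at h1 h2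
        rcases ih with rfl | ih | ⟨S, hS, h3, h4⟩
        · exact absurd rfl h1
        · exact .inl ih
        · obtain ⟨S', c', h5, h6, h7⟩ := h2.exists_cutStep h3
            (fun t ht => small_ones (ht.trans_lt h4)) (hS.step_size_le hA hk)
          exact hname (hS.tail h5) h6 h7
  rcases key 1 h with h | h | ⟨S, -, h, -⟩
  · exact absurd h one_ne_zero
  · exact h
  · exact absurd (by simp [num, succ_nil, parse, parseStack, listRec, parseStep]) h.ne_nil

/-- The run is followed through names. By `hfit` a configuration without a name is already `Bad`,
and then the goal is reached at once. -/
theorem NameReach.complete (hA : ∀ r ∈ A, ∀ c ∈ r.guard, c.offset.natAbs ≤ D)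
    (hk : FactsBounded A S₀ k) (hc : Rep c₀ S₀) (hs : 2 ≤ s)
    (hfit : ∀ S c, CutReach A D S₀ S → Rep c S →
      c.size < s ∨ Bad (.node c (.node (ones s) (num 1)))) {S : Config Sg} (hS : CutReach A D S₀ S)
    (hbad : ∀ c, Rep c S → Bad (.node c (.node (ones s) (num 1)))) :
    NameReach A D Bad s c₀ 0 1 := by
  have h1 : 1 < val (ones s) := by
    have := val_ones s
    have := Nat.pow_le_pow_right (n := 2) (by norm_num) hs
    omega
  have key : NameReach A D Bad s c₀ 0 1 ∨ ∃ c, Rep c S ∧ ∀ b < val (ones s),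
      NamePred Bad (.node c (.node (ones s) (num b))) → NameReach A D Bad s c₀ 0 b := by
    clear hbad
    induction hS with
    | refl => exact .inr ⟨c₀, hc, fun b hb h => .single ⟨hb, .inl ⟨rfl, h⟩⟩⟩
    | @tail S S' hS h ih =>
      rcases ih with ih | ⟨c, hc, ih⟩
      · exact .inl ih
      by_cases hb : Bad (.node c (.node (ones s) (num 1)))
      · exact .inl (ih 1 h1 (.inr ⟨rfl, hb⟩))
      have hcs := (hfit S c hS hc).resolve_right hb
      have h2 := ih (index c) (index_lt hcs) (.inl ⟨fitPred_iff.2 hcs, parse_index c⟩)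
      obtain ⟨c', h3, h4⟩ := h.exists_stepPred hc (fun t ht => small_ones (ht.trans_lt hcs))
        (CutReach.step_size_le hA hk hS)
      refine .inr ⟨c', h3, fun b hb h5 => h2.tail ⟨hb, .inr ⟨fun h6 => hc.ne_nil ?_, ?_⟩⟩⟩
      · simp only [Tr.fst_node] at h6
        rw [← parse_index c, h6]
        simp [parse, parseStack, listRec]
      · simp only [Tr.fst_node, Tr.snd_node, parse_index]
        exact h4 _ _ h5
  rcases key with h | ⟨c, hc, h⟩
  · exact h
  · exact h 1 h1 (.inr ⟨rfl, hbad c hc⟩)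

/-- With `Bad` meaning "too large", `hfit` holds trivially, so overflow can be detected without any
prior size bound. -/
theorem nameReach_overflow_iff (hA : ∀ r ∈ A, ∀ c ∈ r.guard, c.offset.natAbs ≤ D)
    (hk : FactsBounded A S₀ k) (hc : Rep c₀ S₀) (hs : 2 ≤ s) :
    NameReach A D (fun x => ¬FitPred x) s c₀ 0 1 ↔ ∃ S, CutReach A D S₀ S ∧ s ≤ S.treeSize := by
  constructor
  · intro h
    obtain ⟨S, c, h1, h2, h3⟩ := h.sound hA hk hc
    rw [fitPred_iff, h2.size_eq, not_lt] at h3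
    exact ⟨S, h1, h3⟩
  · rintro ⟨S, h1, h2⟩
    refine NameReach.complete hA hk hc hs (fun S c _ _ => ?_) h1 fun c hc => ?_
    · rw [fitPred_iff]
      exact lt_or_ge _ _ |>.imp_right not_lt.2
    · rw [fitPred_iff, hc.size_eq, not_lt]
      exact h2

/-- Once overflow is excluded every reachable configuration has a name, and matching critical pairs
within the limit is exact. -/
theorem nameReach_critical_iff {CS : CriticalSpec Sg}
    (hA : ∀ r ∈ A, ∀ c ∈ r.guard, c.offset.natAbs ≤ D)
    (hk : FactsBounded A S₀ k) (hc : Rep c₀ S₀) (hs : 2 ≤ s)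
    (hfit : ∀ S, CutReach A D S₀ S → S.treeSize < s) :
    NameReach A D (CritPred CS) s c₀ 0 1 ↔ ∃ S, CutReach A D S₀ S ∧ Critical CS S := by
  have hcrit : ∀ {S c}, CutReach A D S₀ S → Rep c S →
      (CritPred CS (.node c (.node (ones s) (num 1))) ↔ Critical CS S) := fun hS hc =>
    critPred_iff hc fun t ht => small_ones (ht.trans_lt (hc.size_eq ▸ hfit _ hS))
  constructor
  · intro h
    obtain ⟨S, c, h1, h2, h3⟩ := h.sound hA hk hc
    exact ⟨S, h1, (hcrit h1 h2).1 h3⟩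
  · rintro ⟨S, h1, h2⟩
    exact NameReach.complete hA hk hc hs (fun S c hS hc => .inl (hc.size_eq ▸ hfit _ hS)) h1
      fun c hc => (hcrit h1 hc).2 h2

end

/-- From a tree of the initial configuration it is decided whether a critical configuration is
reachable, in space quadratic in the size of the trees of the reachable configurations. -/
theorem exists_ev_critical {A : System Sg} {D : ℕ} (CS : CriticalSpec Sg)
    (hA : ∀ r ∈ A, ∀ c ∈ r.guard, c.offset.natAbs ≤ D) :
    ∃ C : ℕ, ∀ I : Type, ∃ F : Frag I Unit, ∀ (S₀ : Config Sg) (k : ℕ) (c₀ : Tr) (Z : ℕ),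
      Rep c₀ S₀ → FactsBounded A S₀ k → (∀ S, CutReach A D S₀ S → S.treeSize < Z) →
      Ev F c₀ (tt (¬∃ S, CutReach A D S₀ S ∧ Critical CS S)) (C * Z ^ 2) := by
  obtain ⟨C₁, hC₁⟩ := exists_ev_reach (linP_edgePred A D linP_fitPred.not)
  obtain ⟨C₂, hC₂⟩ := exists_ev_reach (linP_edgePred A D (linP_critPred CS))
  obtain ⟨C₃, hC₃⟩ : Lin fun x => Tr.node (.node .nil x.fst) x.snd := by fun_prop
  obtain ⟨C₄, hC₄⟩ : Lin fun x => Tr.node (ones 2) x := by fun_prop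
  obtain ⟨C₅, hC₅⟩ : Lin fun x => tt (x = .nil) := by fun_prop
  refine ⟨100 * (C₁ + C₂ + C₃ + C₄ + C₅ + 1), fun I => ?_⟩
  obtain ⟨F₁, hF₁⟩ := hC₁ I
  obtain ⟨F₂, hF₂⟩ := hC₂ I
  obtain ⟨F₃, hF₃⟩ := hC₃ I
  obtain ⟨F₄, hF₄⟩ := hC₄ I
  obtain ⟨F₅, hF₅⟩ := hC₅ I
  -- The limit starts at 2 and is raised by one while an overflow is reachable. Then the critical
  -- search runs with the final limit, and its result is negated. `Z` occurs only in the analysis.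
  refine ⟨Frag.seq F₄ (Frag.seq (Frag.whileDo F₁ F₃) (Frag.seq F₂ F₅)), fun S₀ k c₀ Z hc hk hZ => ?_⟩
  set B := 100 * (C₁ + C₂ + C₃ + C₄ + C₅ + 1) * Z ^ 2 with hB
  have hsize : c₀.size < Z := hc.size_eq ▸ hZ S₀ .refl
  have hZ3 : 3 ≤ Z := by
    obtain ⟨l, rfl, -⟩ := hc
    have := (num S₀.time).size_pos
    have := l.size_pos
    simp only [Tr.size_node] at hsize
    omega
  have hx : ∀ s ≤ Z, (Tr.node (ones s) c₀).size + (s + 1) ^ 2 ≤ 6 * Z ^ 2 := fun s hs => by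
    simp only [Tr.size_node, size_ones]
    nlinarith
  have hB' : B = 100 * (C₁ * Z ^ 2 + C₂ * Z ^ 2 + C₃ * Z ^ 2 + C₄ * Z ^ 2 + C₅ * Z ^ 2 + Z ^ 2) := by
    rw [hB]
    ring
  have hmul : ∀ C a, a ≤ 6 * Z ^ 2 → C * a ≤ 6 * (C * Z ^ 2) := fun C a h =>
    (Nat.mul_le_mul_left C h).trans_eq (by ring)
  have hZ2 : Z ≤ Z ^ 2 := Nat.le_self_pow two_ne_zero Z
  have hb₁ : ∀ s ≤ Z, 3 * (C₁ * ((Tr.node (ones s) c₀).size + (s + 1) ^ 2)) + 1 ≤ B := fun s hs => by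
    have := hmul C₁ _ (hx s hs)
    omega
  have hb₃ : ∀ s ≤ Z, C₃ * (Tr.node (ones s) c₀).size ≤ B := fun s hs => by
    have := hmul C₃ _ ((Nat.le_add_right _ _).trans (hx s hs))
    omega
  -- No configuration reaches size `Z`, so the loop stops at some `s' ≤ Z` and never uses more than
  -- `B`.
  have hloop : ∀ n s, 2 ≤ s → s + n = Z → ∃ s', 2 ≤ s' ∧ s' ≤ Z ∧
      (∀ S, CutReach A D S₀ S → S.treeSize < s') ∧
      Ev (Frag.whileDo F₁ F₃) (.node (ones s) c₀) (.node (ones s') c₀) B := by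
    intro n
    induction n with
    | zero =>
      intro s hs hsn
      obtain rfl : s = Z := by omega
      have h1 := hF₁ s (.node (ones s) c₀) hs rfl
      change Ev F₁ _ (tt (NameReach A D (fun x => ¬FitPred x) s c₀ 0 1)) _ at h1
      rw [nameReach_overflow_iff hA hk hc hs, tt_false] at h1
      · exact ⟨s, hs, le_rfl, hZ, Ev.while_nil h1 (by have := hb₁ s le_rfl; omega)⟩
      · rintro ⟨S, h2, h3⟩
        have := hZ S h2
        omega
    | succ n ih =>
      intro s hs hsn
      have h1 := hF₁ s (.node (ones s) c₀) hs rfl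
      change Ev F₁ _ (tt (NameReach A D (fun x => ¬FitPred x) s c₀ 0 1)) _ at h1
      rw [nameReach_overflow_iff hA hk hc hs] at h1
      have hB₁ := hb₁ s (by omega)
      by_cases h : ∃ S, CutReach A D S₀ S ∧ s ≤ S.treeSize
      · obtain ⟨s', h2, h3, h4, h5⟩ := ih (s + 1) (by omega) (by omega)
        rw [tt_true h] at h1
        refine ⟨s', h2, h3, h4, Ev.while_node h1 (by omega) ((hF₃ _).mono ?_) h5⟩
        exact hb₃ s (by omega)
      · rw [tt_false h] at h1
        push Not at h
        exact ⟨s, hs, by omega, h, Ev.while_nil h1 (by omega)⟩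
  obtain ⟨s, hs, hsZ, hfit, hev⟩ := hloop (Z - 2) 2 le_rfl (by omega)
  have h2 := hF₂ s (.node (ones s) c₀) hs rfl
  change Ev F₂ _ (tt (NameReach A D (CritPred CS) s c₀ 0 1)) _ at h2
  rw [nameReach_critical_iff hA hk hc hs hfit] at h2
  have h5 := hF₅ (tt (∃ S, CutReach A D S₀ S ∧ Critical CS S))
  simp only [tt_eq_nil] at h5
  refine Ev.seq ((hF₄ c₀).mono ?_) (Ev.seq hev (Ev.seq (h2.mono ?_) (h5.mono ?_)))
  · have := hmul C₄ c₀.size (by omega)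
    omega
  · have := hmul C₂ _ (hx s hsZ)
    omega
  · have := hmul C₅ (tt (∃ S, CutReach A D S₀ S ∧ Critical CS S)).size
      ((size_tt_le _).trans (by omega))
    omega

end TimedMSR

/-! ### Reading the input, producing the output, and dispatching on symbols. -/

namespace LinSpace

open Classical

/-! ### Input and output -/

section

variable {I : Type} [Finite I] (tag : I → Tr)

/-- Read the whole input; it becomes a list of trees in reverse order. -/
noncomputable def readAll : Frag I Unit :=
  .bind (.act (.push 0 false ())) fun _ => .loop (.bind (.act (.read id)) fun o => match o with
    | none => .act (.nop (some ()))
    | some i => .bind (pushList (true :: (tag i).code)) fun _ => .act (.nop none))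

theorem runs_readAll (w : List I) :
    (readAll tag).Runs (Tr.ofList (w.reverse.map tag)).size (st w [] [] [] []) ()
      (items (Tr.ofList (w.reverse.map tag)).code) := by
  have key : ∀ (w : List I) (t : Tr) (B : ℕ),
      ((w.map fun i => (tag i).size + 1).sum + t.size ≤ B) →
      (Frag.loop (.bind (.act (.read id)) fun o => match o with
        | none => .act (.nop (some ()))
        | some i => .bind (pushList (true :: (tag i).code)) fun _ => .act (.nop none)) :
          Frag I Unit).Runs B (st w t.code [] [] []) ()
        (items (Tr.ofList (w.reverse.map tag ++ t.toList)).code) := by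
    intro w
    induction w with
    | nil =>
      intro t B h
      simp only [List.map_nil, List.sum_nil, zero_add] at h
      simp only [List.reverse_nil, List.map_nil, List.nil_append, Tr.ofList_toList]
      refine Frag.runs_loop_exit (Frag.runs_bind (Frag.runs_act_of (run_read _ _ _ _ _ _) ?_ ?_)
        (Frag.runs_act_of (run_nop _ _) ?_ ?_)) <;> simpa [Tr.length_code] using h
    | cons i w ih =>
      intro t B h
      simp only [List.map_cons, List.sum_cons] at h
      have h1 := ih (.node (tag i) t) B (by simp only [Tr.size_node]; omega)
      have e : w.reverse.map tag ++ (Tr.node (tag i) t).toList =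
          (i :: w).reverse.map tag ++ t.toList := by simp [Tr.toList]
      rw [e] at h1
      have h2 := runs_pushList (B := B) (w := w) (true :: (tag i).code) (a := t.code)
        (by simp only [List.length_cons, Tr.length_code]; omega)
      refine Frag.runs_loop_again (Frag.runs_bind (Frag.runs_act_of (run_read _ _ _ _ _ _) ?_ ?_)
        (Frag.runs_bind h2 (Frag.runs_act_of (run_nop _ _) ?_ ?_))) h1 <;>
        simp [Tr.length_code] <;> omega
  have h1 := (Tr.ofList (w.reverse.map tag)).size_pos
  refine Frag.runs_bind (Frag.runs_act_of (run_push0 _ _ _ _ _ _ _) (Nat.zero_le _)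
    (by simpa using h1)) ?_
  have h2 := key w .nil (Tr.ofList (w.reverse.map tag)).size (by
    rw [Tr.size_ofList]
    simp [Function.comp_def, add_comm])
  rwa [Tr.toList, List.append_nil] at h2

/-- Read the input, run `G` and output whether the result is not `nil`. -/
noncomputable def decideBy (G : Frag I Unit) : Frag I Bool :=
  .bind (readAll tag) fun _ => .bind G fun _ => .bind (.act (.pop 0 id)) fun o => match o with
    | some true => .bind (.act (.pop 0 fun _ => ())) fun _ => .act (.pop 0 fun _ => true)
    | _ => .act (.nop false)

theorem runs_decideBy {G : Frag I Unit} {w : List I} {p : Prop} {B : ℕ}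
    (h : Ev G (.ofList (w.reverse.map tag)) (tt p) B) :
    (decideBy tag G).Runs B ⟨w, fun _ => []⟩ (decide p) ⟨[], fun _ => []⟩ := by
  have h1 := h []
  simp only [List.append_nil, List.length_nil, Nat.add_zero] at h1
  have h0 := runs_readAll tag w
  have hl := h1.size_left
  have hr := h1.size_right
  simp only [size_st, Tr.length_code, List.length_nil, Nat.add_zero] at hl hr
  have e : ∀ w : List I, (⟨w, fun _ => []⟩ : Store I) = st w [] [] [] [] := fun w =>
    st_eq rfl rfl rfl rfl
  rw [e, e]
  refine Frag.runs_bind (h0.mono hl) (Frag.runs_bind h1 ?_)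
  -- The code of the answer has three symbols or one; all are popped, since the store must be empty
  -- at the exit.
  by_cases hp : p
  · rw [tt_true hp] at hr ⊢
    rw [decide_eq_true hp]
    refine Frag.runs_bind (Frag.runs_act_of (run_pop0 _ _ _ _ _ _) ?_ ?_)
      (Frag.runs_bind (Frag.runs_act_of (run_pop0 _ _ _ _ _ _) ?_ ?_)
        (Frag.runs_act_of (run_pop0 _ _ _ _ _ _) ?_ ?_)) <;>
      simp [Tr.code] at hr ⊢ <;> omega
  · rw [tt_false hp] at hr ⊢
    rw [decide_eq_false hp]
    refine Frag.runs_bind (Frag.runs_act_of (run_pop0 _ _ _ _ _ _) ?_ ?_)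
      (Frag.runs_act_of (run_nop _ _) ?_ ?_) <;>
      (simp [Tr.code] at hr ⊢; try omega)

end

/-! ### Case distinctions -/

/-- The last clause controls `G` on inputs that start with no tag, so that size bounds can be proved
for junk input as well. -/
theorem Lin.exists_case {α : Type*} [Finite α] {tag : α → Tr} (htag : Function.Injective tag)
    {h : α → Tr → Tr} (hh : ∀ a, Lin (h a)) :
    ∃ G, Lin G ∧ (∀ a x, G (.node (tag a) x) = h a x) ∧
      ∀ x, G x = .nil ∨ ∃ a, G x = h a x.snd := by
  have key : ∀ l : List α, ∃ G, Lin G ∧ (∀ a ∈ l, ∀ x, G (.node (tag a) x) = h a x) ∧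
      ∀ x, G x = .nil ∨ ∃ a, G x = h a x.snd := by
    intro l
    induction l with
    | nil => exact ⟨fun _ => .nil, Lin.const _, by simp, fun _ => .inl rfl⟩
    | cons a l ih =>
      obtain ⟨G, h1, h2, h3⟩ := ih
      have ha := hh a
      refine ⟨fun x => if x.fst = tag a then h a x.snd else G x, by fun_prop, fun b hb x => ?_,
        fun x => ?_⟩
      · by_cases hab : tag b = tag a
        · exact (if_pos hab).trans (by rw [htag hab, Tr.snd_node])
        · refine (if_neg hab).trans ?_
          rcases List.mem_cons.1 hb with rfl | hb
          · exact absurd rfl hab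
          · exact h2 b hb x
      · by_cases hx : x.fst = tag a
        · exact .inr ⟨a, if_pos hx⟩
        · simp only [hx, if_false]
          exact h3 x
  cases nonempty_fintype α
  obtain ⟨G, h1, h2, h3⟩ := key Finset.univ.toList
  exact ⟨G, h1, fun a => h2 a (by simp), h3⟩

/-! ### Binary numbers and stacks of trees -/

/-- Based on `2 * n = 2 + 2 * (n - 1)`, since there is no digit zero. -/
noncomputable def double (t : Tr) : Tr := if t = .nil then .nil else .node two (pred t)

theorem double_num (n : ℕ) : double (num n) = num (2 * n) := by
  unfold double
  rcases n with _ | n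
  · exact if_pos rfl
  · rw [if_neg, pred_num]
    · have h : Canon (.node two (num n)) := canon_node.2 ⟨.inr rfl, canon_num n⟩
      rw [h.eq_num, val_two, val_num]
      congr 1
      omega
    · intro h
      have := congrArg val h
      simp at this

theorem double_add_one_num (n : ℕ) : Tr.node .nil (num n) = num (2 * n + 1) := by
  have h : Canon (.node .nil (num n)) := canon_node.2 ⟨.inl rfl, canon_num n⟩
  rw [h.eq_num, val_one, val_num, add_comm]

theorem bulk_double_le (t : Tr) : bulk (double t) ≤ bulk t + 4 := by
  unfold double
  split_ifs
  · simp [bulk]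
  · have := bulk_pred t
    simp [bulk]
    omega

/-- The list of the first `n` entries of `T`. -/
def take (n : ℕ) (T : Tr) : Tr := envTr n fun i => get i T

def drop' (n : ℕ) (T : Tr) : Tr := Tr.snd^[n] T

theorem take_succ (n : ℕ) (T : Tr) : take (n + 1) T = .node T.fst (take n T.snd) := envTr_succ _ _

theorem size_take_add_le (n : ℕ) (T : Tr) :
    (take n T).size + (drop' n T).size ≤ T.size + 3 * n + 1 := by
  induction n generalizing T with
  | zero =>
    have : (take 0 T).size = 1 := rfl
    simp only [this, drop', Function.iterate_zero, id_eq]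
    omega
  | succ n ih =>
    have := ih T.snd
    rw [take_succ]
    unfold drop' at this ⊢
    rw [Function.iterate_succ_apply, Tr.size_node]
    rcases T with _ | ⟨a, r⟩ <;> simp at this ⊢ <;> omega

@[fun_prop]
theorem Lin.take (n : ℕ) {f : Tr → Tr} (hf : Lin f) : Lin fun x => take n (f x) := by
  unfold LinSpace.take envTr
  exact Lin.ofList _ (a := fun i x => LinSpace.get i (f x)) fun i _ => hf.get i

@[fun_prop]
theorem Lin.drop' (n : ℕ) {f : Tr → Tr} (hf : Lin f) : Lin fun x => drop' n (f x) := by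
  unfold LinSpace.drop'
  induction n with
  | zero => exact hf
  | succ n ih =>
    simp only [Function.iterate_succ_apply']
    exact ih.snd

theorem take_consAll {n : ℕ} (f : Fin n → Tr) (T : Tr) :
    take n (consAll (List.ofFn f) T) = .ofList (List.ofFn f) := by
  induction n with
  | zero => rfl
  | succ n ih =>
    rw [take_succ, List.ofFn_succ]
    simp only [consAll, List.foldr_cons, Tr.fst_node, Tr.snd_node, Tr.ofList]
    rw [← ih fun i => f i.succ]
    rfl

theorem drop'_consAll {n : ℕ} (f : Fin n → Tr) (T : Tr) :
    drop' n (consAll (List.ofFn f) T) = T := by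
  induction n with
  | zero => rfl
  | succ n ih =>
    unfold drop' at ih ⊢
    rw [Function.iterate_succ_apply, List.ofFn_succ]
    exact ih fun i => f i.succ

end LinSpace

/-! ### Parsing the input string into the tree of a configuration. -/

namespace TimedMSR

open LinSpace Classical

variable {Sg : Alphabet}

/-! ### Reading configurations -/

noncomputable def symTag (a : InputSymbol Sg) : Tr := num (Fintype.equivFin (InputSymbol Sg) a)

theorem symTag_injective : Function.Injective (symTag (Sg := Sg)) := fun _ _ h =>
  (Fintype.equivFin (InputSymbol Sg)).injective (Fin.ext (num_injective h))

/-- Words are scanned from right to left. The state `node b (node T F)` consists of the number `b`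
that is being read, the stack `T` of the terms read, and the list `F` of the timed facts read. -/
noncomputable def scanCase : InputSymbol Sg → Tr → Tr
  | .inl p, s => .node .nil (.node (drop' (Sg.predArity p) s.snd.fst)
      (.node (.node (.node (predTag p) (take (Sg.predArity p) s.snd.fst)) s.fst) s.snd.snd))
  | .inr (.inl f), s => .node s.fst (.node (.node (.node (fnTag f)
      (take (Sg.fnArity f) s.snd.fst)) (drop' (Sg.fnArity f) s.snd.fst)) s.snd.snd)
  | .inr (.inr (some false)), s => .node (double s.fst) s.snd
  | .inr (.inr (some true)), s => .node (.node .nil s.fst) s.snd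
  | .inr (.inr none), s => s

theorem lin_scanCase (a : InputSymbol Sg) : Lin (scanCase a) := by
  rcases a with p | f | _ | _ | _ <;> unfold scanCase double <;> fun_prop

theorem exists_scanStep (Sg : Alphabet) : ∃ G : Tr → Tr, Lin G ∧
    (∀ (a : InputSymbol Sg) x, G (.node (symTag a) x) = scanCase a x) ∧
      ∀ x, G x = .nil ∨ ∃ a : InputSymbol Sg, G x = scanCase a x.snd :=
  Lin.exists_case symTag_injective lin_scanCase

noncomputable def scanStep (Sg : Alphabet) : Tr → Tr := (exists_scanStep Sg).choose

noncomputable def scan (Sg : Alphabet) (t : Tr) : Tr :=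
  listRec (fun x => scanStep Sg (.node x.snd.fst x.snd.snd.snd))
    (fun _ => .node .nil (.node .nil .nil)) .nil t

noncomputable def scanWord (w : List (InputSymbol Sg)) : Tr := scan Sg (.ofList (w.map symTag))

theorem scanWord_cons (a : InputSymbol Sg) (w : List (InputSymbol Sg)) :
    scanWord (a :: w) = scanCase a (scanWord w) :=
  (exists_scanStep Sg).choose_spec.2.1 a _

/-- Doubling can turn many digits one into the larger digit two, so the plain size may jump.
Charging every digit its maximal size in advance makes the growth per symbol constant. -/
def stateBulk (s : Tr) : ℕ := bulk s.fst + s.snd.fst.size + s.snd.snd.size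

theorem size_le_stateBulk (s : Tr) : s.size ≤ stateBulk s + 2 := by
  have := fun t => size_le_bulk t
  rcases s with _ | ⟨b, _ | ⟨T, F⟩⟩
  · simp [stateBulk]
  · have := this b
    simp [stateBulk]
    omega
  · have := this b
    simp [stateBulk]
    omega

theorem exists_stateBulk_le (Sg : Alphabet) :
    ∃ K, ∀ (a : InputSymbol Sg) s, stateBulk (scanCase a s) ≤ stateBulk s + K := by
  have h : ∀ a : InputSymbol Sg, ∃ K, ∀ s, stateBulk (scanCase a s) ≤ stateBulk s + K := by
    rintro (p | f | _ | _ | _)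
    · refine ⟨(predTag p).size + 3 * Sg.predArity p + 10, fun s => ?_⟩
      have h1 := size_take_add_le (Sg.predArity p) s.snd.fst
      have h2 := size_le_bulk s.fst
      simp [scanCase, stateBulk, bulk]
      omega
    · refine ⟨(fnTag f).size + 3 * Sg.fnArity f + 10, fun s => ?_⟩
      have h1 := size_take_add_le (Sg.fnArity f) s.snd.fst
      simp [scanCase, stateBulk]
      omega
    · exact ⟨0, fun s => le_rfl⟩
    · refine ⟨4, fun s => ?_⟩
      have := bulk_double_le s.fst
      simp [scanCase, stateBulk]
      omega
    · refine ⟨4, fun s => ?_⟩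
      simp [scanCase, stateBulk, bulk]
      omega
  choose K hK using h
  exact ⟨∑ a, K a, fun a s => (hK a s).trans (Nat.add_le_add_left
    (Finset.single_le_sum (f := K) (fun _ _ => Nat.zero_le _) (Finset.mem_univ a)) _)⟩

theorem lin_scan (Sg : Alphabet) {f : Tr → Tr} (hf : Lin f) : Lin fun x => scan Sg (f x) := by
  obtain ⟨h1, -, h2⟩ := (exists_scanStep Sg).choose_spec
  change Lin (scanStep Sg) at h1
  obtain ⟨K, hK⟩ := exists_stateBulk_le Sg
  refine Lin.listRec (C := K + 5) (by fun_prop) (by fun_prop) (fun c t => ?_) (Lin.const _) hf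
  have key : stateBulk (listRec (fun x => scanStep Sg (.node x.snd.fst x.snd.snd.snd))
      (fun _ => .node .nil (.node .nil .nil)) c t) ≤ (K + 3) * t.size := by
    induction t with
    | nil => simp [listRec, stateBulk, bulk]
    | node a r _ ih =>
      simp only [listRec, Tr.snd_node, Tr.fst_node] at ih ⊢
      have h3 := Nat.mul_le_mul_left (K + 3) (show 1 + r.size ≤ (Tr.node a r).size by
        simp only [Tr.size_node]; omega)
      rw [mul_add] at h3
      rcases h2 (.node a (listRec (fun x => scanStep Sg (.node x.snd.fst x.snd.snd.snd))
        (fun _ => .node .nil (.node .nil .nil)) c r)) with h | ⟨b, h⟩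
      · change scanStep Sg _ = _ at h
        rw [h]
        have : stateBulk .nil = 3 := rfl
        omega
      · change scanStep Sg _ = _ at h
        rw [h]
        have := hK b (listRec (fun x => scanStep Sg (.node x.snd.fst x.snd.snd.snd))
          (fun _ => .node .nil (.node .nil .nil)) c r)
        simp only [Tr.snd_node]
        omega
  have h3 := size_le_stateBulk (listRec (fun x => scanStep Sg (.node x.snd.fst x.snd.snd.snd))
      (fun _ => .node .nil (.node .nil .nil)) c t)
  have h4 := t.size_pos
  have h5 := Nat.zero_le ((K + 5) * c.size)
  nlinarith

section

variable {w : List (InputSymbol Sg)} {b T F : Tr}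

theorem scanWord_flatten {n : ℕ} {f : Fin n → List (InputSymbol Sg)} {g : Fin n → Tr}
    (hfg : ∀ i w b T F, scanWord w = .node b (.node T F) →
      scanWord (f i ++ w) = .node b (.node (.node (g i) T) F))
    (h : scanWord w = .node b (.node T F)) :
    scanWord ((List.ofFn f).flatten ++ w) =
      .node b (.node (consAll (List.ofFn g) T) F) := by
  induction n with
  | zero => simpa [consAll] using h
  | succ n ih =>
    rw [List.ofFn_succ, List.ofFn_succ, List.flatten_cons, List.append_assoc]
    exact hfg _ _ _ _ _ (ih fun i => hfg i.succ)

theorem scanWord_term {s : Sg.Srt} (t : GroundTerm Sg s) :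
    ∀ {w : List (InputSymbol Sg)} {b T F : Tr}, scanWord w = .node b (.node T F) →
      scanWord (encodeTerm t ++ w) = .node b (.node (.node t.tree T) F) := by
  induction t with
  | var x => exact x.elim
  | app f args ih =>
    intro w b T F h
    have h1 := scanWord_flatten (fun i w b T F h => ih i (w := w) (b := b) (T := T) (F := F) h) h
    rw [encodeTerm, List.cons_append, scanWord_cons, h1]
    simp only [scanCase, Tr.fst_node, Tr.snd_node, take_consAll, drop'_consAll]
    rfl

theorem scanWord_fact (G : GroundFact Sg) (h : scanWord w = .node b (.node T F)) :
    scanWord (encodeFact G ++ w) = .node .nil (.node T (.node (.node G.tree b) F)) := by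
  have h1 := scanWord_flatten (fun i w b T F h =>
    scanWord_term (G.args i) (w := w) (b := b) (T := T) (F := F) h) h
  rw [encodeFact, List.cons_append, scanWord_cons, h1]
  simp only [scanCase, Tr.fst_node, Tr.snd_node, take_consAll, drop'_consAll]
  rfl

/-- `Nat.bits` puts the least significant bit first, so scanning from the right is Horner's scheme
starting from 0. Predicate symbols reset the number, which is why separators need no action. -/
theorem scanWord_nat (n : ℕ) (h : scanWord w = .node .nil (.node T F)) :
    scanWord (encodeNat Sg n ++ w) = .node (num n) (.node T F) := by
  induction n using Nat.strong_induction_on with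
  | _ n ih =>
    rcases Nat.eq_zero_or_pos n with rfl | hn
    · simpa [encodeNat] using h
    obtain ⟨m, rfl | rfl⟩ := Nat.even_or_odd' n
    · have h1 := ih m (by omega)
      rw [encodeNat, Nat.bit0_bits m (by omega), List.map_cons, List.cons_append, scanWord_cons]
      rw [encodeNat] at h1
      rw [h1]
      simp only [scanCase, Tr.fst_node, Tr.snd_node, double_num]
    · have h1 := ih m (by omega)
      rw [encodeNat, Nat.bit1_bits, List.map_cons, List.cons_append, scanWord_cons]
      rw [encodeNat] at h1
      rw [h1]
      simp only [scanCase, Tr.fst_node, Tr.snd_node, double_add_one_num]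

theorem scanWord_facts (L : List (GroundFact Sg × ℕ)) :
    scanWord (L.flatMap fun F => encodeFact F.1 ++ encodeNat Sg F.2 ++ [separator Sg]) =
      .node .nil (.node .nil (.ofList (L.map entry))) := by
  induction L with
  | nil => rfl
  | cons F L ih =>
    rw [List.flatMap_cons, List.append_assoc, List.append_assoc]
    refine (scanWord_fact F.1 (scanWord_nat F.2 (T := .nil) (F := .ofList (L.map entry)) ?_)).trans
      rfl
    rw [List.singleton_append, scanWord_cons, ih]
    rfl

theorem scanWord_config (t : ℕ) (L : List (GroundFact Sg × ℕ)) :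
    scanWord (encodeConfig t L) = .node (num t) (.node .nil (.ofList (L.map entry))) := by
  refine scanWord_nat t ?_
  rw [scanWord_cons, scanWord_facts]
  rfl

end

/-- The tree of the configuration described by the list `x` of symbols, the last one first. -/
noncomputable def readConfig (Sg : Alphabet) (x : Tr) : Tr :=
  .node (scan Sg (x.revApp .nil)).fst (scan Sg (x.revApp .nil)).snd.snd

theorem lin_readConfig (Sg : Alphabet) : Lin (readConfig Sg) := by
  have := lin_scan Sg (f := fun x => x.revApp .nil) (by fun_prop)
  unfold readConfig
  fun_prop

theorem rep_readConfig (t : ℕ) (L : List (GroundFact Sg × ℕ)) :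
    Rep (readConfig Sg (.ofList ((encodeConfig t L).reverse.map symTag)))
      (⟨t, (L : Multiset (GroundFact Sg × ℕ))⟩ : Config Sg) := by
  have e : (Tr.ofList ((encodeConfig t L).reverse.map symTag)).revApp .nil =
      .ofList ((encodeConfig t L).map symTag) := by
    rw [← Tr.ofList_toList (Tr.revApp _ _), Tr.toList_revApp]
    simp [Tr.toList]
  have h := scanWord_config t L
  rw [scanWord] at h
  rw [readConfig, e, h]
  exact ⟨_, rfl, by simp⟩

end TimedMSR

/-! ### Space bounds and the final machine. -/

namespace TimedMSR

open LinSpace Classical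

variable {Sg : Alphabet}

/-! ### Bounds -/

/-- This `D` belongs to the system and may be built into the machine; `Dmax` is then needed only for
the initial timestamps. -/
theorem exists_value_bound (A : System Sg) (CS : CriticalSpec Sg) : ∃ D,
    (∀ r ∈ A, ∀ q ∈ r.created, q.2 ≤ D) ∧ (∀ r ∈ A, ∀ c ∈ r.guard, c.offset.natAbs ≤ D) ∧
      ∀ P ∈ CS, ∀ c ∈ P.constraints, c.offset.natAbs ≤ D := by
  have h : ∀ {α β : Type} (s : Finset α) (l : α → List β) (f : ∀ a, β → ℕ),
      ∃ D, ∀ a ∈ s, ∀ b ∈ l a, f a b ≤ D := by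
    intro α β s l f
    refine ⟨∑ a ∈ s, ((l a).map (f a)).sum, fun a ha b hb => ?_⟩
    exact (List.single_le_sum (fun _ _ => Nat.zero_le _) _ (List.mem_map_of_mem hb)).trans
      (Finset.single_le_sum (f := fun a => ((l a).map (f a)).sum) (fun _ _ => Nat.zero_le _) ha)
  have h' : ∃ D, ∀ r ∈ A, ∀ d ∈ r.created.map Prod.snd, d ≤ D := h A _ fun _ d => d
  obtain ⟨D₁, h₁⟩ := h'
  obtain ⟨D₂, h₂⟩ := h A Rule.guard fun _ c => c.offset.natAbs
  obtain ⟨D₃, h₃⟩ := h CS CriticalPair.constraints fun _ c => c.offset.natAbs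
  refine ⟨D₁ + D₂ + D₃, fun r hr q hq => ?_, fun r hr c hc => ?_, fun P hP c hc => ?_⟩
  · have := h₁ r hr q.2 (List.mem_map_of_mem hq)
    omega
  · have := h₂ r hr c hc
    omega
  · have := h₃ P hP c hc
    omega

/-- The crude bound `m * (D + 1) ≤ 2 ^ (m + D + 1)` suffices: `m` is itself a parameter of the
polynomial and `D` is a constant. -/
theorem log_le_of_le {x m d D : ℕ} (h : x ≤ d + m * (D + 1) + D + 1) :
    Nat.log 2 x ≤ Nat.log 2 d + m + D + 2 := by
  have h1 := Nat.lt_pow_succ_log_self (b := 2) (by norm_num) d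
  have h2 : m < 2 ^ m := Nat.lt_two_pow_self
  have h3 : D + 1 < 2 ^ (D + 1) := Nat.lt_two_pow_self
  have h4 : m * (D + 1) ≤ 2 ^ (m + D + 1) := by
    rw [add_assoc, pow_add]
    exact Nat.mul_le_mul h2.le h3.le
  have h5 : 2 ^ (Nat.log 2 d + 1) ≤ 2 ^ (Nat.log 2 d + m + D + 1) :=
    Nat.pow_le_pow_right (by norm_num) (by omega)
  have h6 : 2 ^ (m + D + 1) ≤ 2 ^ (Nat.log 2 d + m + D + 1) :=
    Nat.pow_le_pow_right (by norm_num) (by omega)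
  have h7 : 2 ^ (D + 1) ≤ 2 ^ (Nat.log 2 d + m + D + 1) :=
    Nat.pow_le_pow_right (by norm_num) (by omega)
  have h8 : 2 ^ (Nat.log 2 d + m + D + 3) = 4 * 2 ^ (Nat.log 2 d + m + D + 1) := by
    rw [show Nat.log 2 d + m + D + 3 = Nat.log 2 d + m + D + 1 + 2 by omega, pow_add]
    ring
  exact Nat.lt_succ_iff.1 (Nat.log_lt_of_lt_pow' (by omega) (by
    rw [show (Nat.log 2 d + m + D + 2).succ = Nat.log 2 d + m + D + 3 from rfl]
    omega))

/-- There are `m` facts including `Time`; each fact has size `O(k)` and each timestamp size `O(log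
Dmax + m)`. The constant `K` depends on the system and is absorbed later by the packing. -/
theorem exists_treeSize_lt {A : System Sg} (D : ℕ) (hA : Progressive A)
    (hc : ∀ r ∈ A, ∀ q ∈ r.created, q.2 ≤ D) (hg : ∀ r ∈ A, ∀ c ∈ r.guard, c.offset.natAbs ≤ D) :
    ∃ K : ℕ, ∀ (S₀ : Config Sg) (k d : ℕ), FactsBounded A S₀ k → S₀.time ≤ d →
      (∀ F ∈ S₀.facts, F.2 ≤ d) → ∀ S, CutReach A D S₀ S →
        S.treeSize < K * (S₀.numFacts + k + Nat.log 2 d + 1) ^ 2 := by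
  obtain ⟨C, -, hC⟩ := exists_size_tree_le Sg
  refine ⟨8 * (D + 3) + C + 10, fun S₀ k d hk h0 h1 S hS => ?_⟩
  set m := S₀.numFacts with hm
  set N := m + k + Nat.log 2 d + 1 with hN
  obtain ⟨h2, h3⟩ := hS.time_le (B := d + m * (D + 1)) hA.1 hc (Nat.le_add_left _ _)
    (h0.trans (Nat.le_add_right _ _)) (fun F hF => (h1 F hF).trans (by omega))
  have hnum : ∀ t ≤ d + m * (D + 1) + D, (num t).size ≤ 4 * ((D + 3) * N) + 1 := by
    intro t ht
    have h4 := size_num_le t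
    have h5 := log_le_of_le (x := t + 1) (m := m) (d := d) (D := D) (by omega)
    have h6 : Nat.log 2 d + m + D + 2 ≤ (D + 3) * N := by
      have : D + 2 ≤ (D + 2) * N := Nat.le_mul_of_pos_right _ (by omega)
      have : (D + 3) * N = (D + 2) * N + N := by ring
      omega
    omega
  have hentry : ∀ F ∈ S.facts, (entry F).size + 1 ≤ 3 + C * N + 4 * ((D + 3) * N) := by
    intro F hF
    have h4 := hnum F.2 (h3 F hF)
    have h5 := hC F.1
    have h6 := Nat.mul_le_mul_left C ((hS.size_le hg hk hF).trans (by omega : k ≤ N))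
    simp only [entry, Tr.size_node]
    omega
  have hsum := Multiset.sum_le_card_nsmul (S.facts.map fun F => (entry F).size + 1)
    (3 + C * N + 4 * ((D + 3) * N)) (by
      intro x hx
      obtain ⟨F, hF, rfl⟩ := Multiset.mem_map.1 hx
      exact hentry F hF)
  rw [Multiset.card_map, smul_eq_mul, hS.card_eq hA.1] at hsum
  have hcard : Multiset.card S₀.facts ≤ N := by
    rw [hN, hm, Config.numFacts]
    omega
  have h4 := hnum S.time (h2.trans (Nat.le_add_right _ _))
  have h5 := hsum.trans (Nat.mul_le_mul_right _ hcard)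
  have hN1 : 1 ≤ N := by omega
  have hN2 : N ≤ N ^ 2 := Nat.le_self_pow two_ne_zero N
  have h6 : (D + 3) * N ≤ (D + 3) * N ^ 2 := Nat.mul_le_mul_left _ hN2
  have h7 : N * (3 + C * N + 4 * ((D + 3) * N)) = 3 * N + C * N ^ 2 + 4 * ((D + 3) * N ^ 2) := by
    ring
  have h8 : (8 * (D + 3) + C + 10) * N ^ 2 = 8 * ((D + 3) * N ^ 2) + C * N ^ 2 + 10 * N ^ 2 := by
    ring
  rw [h8, Config.treeSize]
  omega

theorem length_flatten_ofFn {α : Type*} {n : ℕ} {f : Fin n → List α} {k : Fin n → ℕ}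
    (h : ∀ i, (f i).length = k i) : (List.ofFn f).flatten.length = ∑ i, k i := by
  rw [List.length_flatten, List.map_ofFn, List.sum_ofFn]
  exact Finset.sum_congr rfl fun i _ => h i

theorem length_encodeTerm {s : Sg.Srt} (t : GroundTerm Sg s) : (encodeTerm t).length = t.size := by
  induction t with
  | var x => exact x.elim
  | app f args ih =>
    rw [encodeTerm, List.length_cons, length_flatten_ofFn ih, Term.size, add_comm]

theorem length_encodeFact (F : GroundFact Sg) : (encodeFact F).length = F.size := by
  rw [encodeFact, List.length_cons, length_flatten_ofFn fun i => length_encodeTerm (F.args i),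
    Fact.size, add_comm]

theorem length_encodeNat_le {n d : ℕ} (h : n ≤ d) :
    (encodeNat Sg n).length ≤ Nat.log 2 d + 1 := by
  rw [encodeNat, List.length_map, Nat.size_eq_bits_len, Nat.size_le]
  exact h.trans_lt (Nat.lt_pow_succ_log_self (by norm_num) d)

/-- The input is not packed, so here the constant must not depend on the system. -/
theorem length_encodeConfig_le {t k d : ℕ} {L : List (GroundFact Sg × ℕ)} (ht : t ≤ d)
    (hL : ∀ F ∈ L, F.2 ≤ d) (hk : ∀ F ∈ L, F.1.size ≤ k) :
    (encodeConfig t L).length ≤ 4 * (L.length + 1 + k + Nat.log 2 d + 1) ^ 2 := by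
  have h : (L.flatMap fun F => encodeFact F.1 ++ encodeNat Sg F.2 ++ [separator Sg]).length ≤
      L.length * (k + (Nat.log 2 d + 1) + 1) := by
    rw [List.length_flatMap]
    refine (List.sum_le_card_nsmul _ (k + (Nat.log 2 d + 1) + 1) fun x hx => ?_).trans_eq (by simp)
    obtain ⟨F, hF, rfl⟩ := List.mem_map.1 hx
    have h1 := length_encodeNat_le (Sg := Sg) (hL F hF)
    have h2 := hk F hF
    rw [← length_encodeFact] at h2
    simp only [List.length_append, List.length_singleton]
    omega
  have h1 := length_encodeNat_le (Sg := Sg) ht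
  simp only [encodeConfig, List.length_append, List.length_cons]
  nlinarith

/-- Survivability of progressive systems is decidable in polynomial space, with a polynomial that
does not depend on the system. -/
theorem exists_machine (Sg : Alphabet) :
    ∃ p : MvPolynomial (Fin 3) ℕ, ∀ (A : System Sg) (CS : CriticalSpec Sg), Progressive A →
      ∃ M : Turing.TM2ComputableAux (InputSymbol Sg) Bool, (∀ j, Finite (M.tm.Γ j)) ∧
        ∀ (t : ℕ) (L : List (GroundFact Sg × ℕ)) (S₀ : Config Sg) (m k Dmax : ℕ),
          S₀ = ⟨t, ↑L⟩ → m = S₀.numFacts → FactsBounded A S₀ k → ValuesBounded A CS S₀ Dmax →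
          (∃ b : Bool, (b = true ↔ Survivable A CS S₀) ∧ HaltsWith M (encodeConfig t L) b) ∧
          RunsInSpace M (encodeConfig t L) (MvPolynomial.eval ![m, k, Nat.log 2 Dmax] p) := by
  -- Trees of size `O(N ^ 2)` and the square from bisection give the exponent 4. The factor 6 is 4
  -- for the input, 1 for the packed stacks and 1 for the output cell.
  refine ⟨6 * (MvPolynomial.X 0 + MvPolynomial.X 1 + MvPolynomial.X 2 + 1) ^ 4, fun A CS hA => ?_⟩
  obtain ⟨D, hc, hg, hCS⟩ := exists_value_bound A CS
  obtain ⟨K, hK⟩ := exists_treeSize_lt D hA hc hg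
  obtain ⟨C₁, hC₁⟩ := lin_readConfig Sg
  obtain ⟨C₂, hC₂⟩ := exists_ev_critical CS hg
  obtain ⟨C₃, hC₃⟩ : ∃ C, ∀ a : InputSymbol Sg, (symTag a).size ≤ C :=
    ⟨∑ a : InputSymbol Sg, (symTag a).size, fun a => Finset.single_le_sum
      (f := fun a : InputSymbol Sg => (symTag a).size) (fun _ _ => Nat.zero_le _)
      (Finset.mem_univ a)⟩
  obtain ⟨G₁, hG₁⟩ := hC₁ (InputSymbol Sg)
  obtain ⟨G₂, hG₂⟩ := hC₂ (InputSymbol Sg)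
  -- The packing factor swallows all constants of the system: the first summand pays for reading,
  -- the second for deciding, and 1 keeps `c` positive. The work needs `c * N ^ 4` bits, that is, `N
  -- ^ 4` cells.
  set c := C₁ * (1 + 4 * (C₃ + 1)) + C₂ * K ^ 2 + 1 with hcdef
  refine ⟨(decideBy symTag (Frag.seq G₁ G₂)).machine c, Frag.machine_finite _, ?_⟩
  rintro t L _ m k d rfl rfl hk ⟨⟨ht, hL⟩, -⟩
  set S₀ : Config Sg := ⟨t, (L : Multiset (GroundFact Sg × ℕ))⟩
  set N := S₀.numFacts + k + Nat.log 2 d + 1 with hN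
  set w := encodeConfig t L
  have hN1 : 1 ≤ N := by omega
  have hlen : w.length ≤ 4 * N ^ 2 := by
    refine length_encodeConfig_le ht hL fun F hF => ?_
    exact hk.size_le (S := S₀) .refl hF
  have hsize : (Tr.ofList (w.reverse.map symTag)).size ≤ (1 + 4 * (C₃ + 1)) * N ^ 2 := by
    rw [Tr.size_ofList]
    have h1 := List.sum_le_card_nsmul ((w.reverse.map symTag).map fun t => t.size + 1) (C₃ + 1)
      fun x hx => by
        simp only [List.map_map, List.mem_map, Function.comp_apply] at hx
        obtain ⟨a, -, rfl⟩ := hx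
        exact Nat.succ_le_succ (hC₃ a)
    simp only [List.length_map, List.length_reverse, smul_eq_mul] at h1
    nlinarith [Nat.mul_le_mul_right (C₃ + 1) hlen]
  have hrep : Rep (readConfig Sg (.ofList (w.reverse.map symTag))) S₀ := rep_readConfig t L
  have h24 : N ^ 2 ≤ N ^ 4 := Nat.pow_le_pow_right hN1 (by norm_num)
  have hev : Ev (Frag.seq G₁ G₂) (.ofList (w.reverse.map symTag))
      (tt (¬∃ S, CutReach A D S₀ S ∧ Critical CS S)) (c * N ^ 4) := by
    refine Ev.seq ((hG₁ _).mono ?_) ((hG₂ S₀ k _ (K * N ^ 2) hrep hk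
      (hK S₀ k d hk ht hL)).mono ?_)
    · refine (Nat.mul_le_mul_left C₁ hsize).trans ?_
      rw [← mul_assoc]
      exact Nat.mul_le_mul (by omega) h24
    · have : C₂ * (K * N ^ 2) ^ 2 = C₂ * K ^ 2 * N ^ 4 := by ring
      rw [this]
      exact Nat.mul_le_mul_right _ (by omega)
  have hc0 : 0 < c := by omega
  obtain ⟨h1, h2⟩ := Frag.machine_spec hc0 (runs_decideBy symTag hev)
  refine ⟨⟨_, ?_, h1⟩, fun x hx => (h2 x hx).trans ?_⟩
  · refine (@decide_eq_true_iff _ (propDecidable _)).trans ?_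
    rw [survivable_iff_cutReach hA hg hCS]
    push Not
    rfl
  · rw [Nat.mul_div_cancel_left _ hc0]
    have : MvPolynomial.eval ![S₀.numFacts, k, Nat.log 2 d]
        (6 * (MvPolynomial.X 0 + MvPolynomial.X 1 + MvPolynomial.X 2 + 1) ^ 4) = 6 * N ^ 4 := by
      simp [hN]
    rw [this]
    have : 1 ≤ N ^ 4 := Nat.one_le_pow _ _ hN1
    omega

end TimedMSR

/-- For every finite alphabet there is one polynomial `p` in three variables such that, for every
progressive timed MSR system `A` and every critical configuration specification `CS` over it, some
deterministic multi-stack Turing machine with finite alphabets decides, on input `S₀`, whether `A` is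
survivable, in space `p (m, k, log₂ Dmax)`. -/
theorem mainTheorem3 (Sg : TimedMSR.Alphabet) :
    ∃ p : MvPolynomial (Fin 3) ℕ,
      ∀ (A : TimedMSR.System Sg) (CS : TimedMSR.CriticalSpec Sg), TimedMSR.Progressive A →
        ∃ M : Turing.TM2ComputableAux (TimedMSR.InputSymbol Sg) Bool,
          (∀ j, Finite (M.tm.Γ j)) ∧
          ∀ (t : ℕ) (L : List (TimedMSR.GroundFact Sg × ℕ)) (S₀ : TimedMSR.Config Sg)
            (m k Dmax : ℕ),
            S₀ = ⟨t, ↑L⟩ → m = S₀.numFacts →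
            TimedMSR.FactsBounded A S₀ k → TimedMSR.ValuesBounded A CS S₀ Dmax →
            (∃ b : Bool, (b = true ↔ TimedMSR.Survivable A CS S₀) ∧
              TimedMSR.HaltsWith M (TimedMSR.encodeConfig t L) b) ∧
            TimedMSR.RunsInSpace M (TimedMSR.encodeConfig t L)
              (MvPolynomial.eval ![m, k, Nat.log 2 Dmax] p) :=
  TimedMSR.exists_machine Sg
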